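/- **Conventions.** Let $\mathbb S=\{J\in\mathbb H: J^2=-1\}$, $\mathbb C_J=\mathbb R+J\mathbb R$ and $\Omega_J=\Omega\cap\mathbb C_J$. A *basic domain* is a nonempty connected open set $\Omega\subseteq\mathbb H$ that is axially symmetric (if it contains $x+Iy$ with $x,y\in\mathbb R$, $I\in\mathbb S$, it contains $x+Jy$ for all $J\in\mathbb S$) and such that for every $I\in\mathbb S$ each connected component of $\Omega_I$ is simply connected. For an axially symmetric open set $U$ put $U_i=\{x+iy\in\mathbb C: x+Jy\in U \text{ for } J\in\mathbb S\}$. A function $f:U\to\mathbb H$ is *slice-regular*, $f\in\mathcal{SR}(U)$, if there is a holomorphic $F=F_1+\iota F_2:U_i\to\mathbb H\otimes_{\mathbb R}\mathbb C=\mathbb H+\iota\mathbb H$ with $F(\bar z)=F_1(z)-\iota F_2(z)$ and $f(x+Jy)=F_1(x+iy)+JF_2(x+iy)$ for all $J\in\mathbb S$; $F$ is unique, and the $*$-product of $f$ and $g$ is the slice-regular function induced by the product of their stem functions $F$ and $G$. The function $f$ is *slice-preserving*, $f\in\mathcal{SR}_{\mathbb R}(U)$, if also $f(U_I)\subseteq\mathbb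 C_I$ for all $I\in\mathbb S$. Every $f\in\mathcal{SR}(U)$ is uniquely $f=f_0+f_1i+f_2j+f_3k$ with $f_l\in\mathcal{SR}_{\mathbb R}(U)$; put $f_v=f-f_0$ and $f^s=f_0^2+f_1^2+f_2^2+f_3^2$. Call $f$ *vectorial* if $f=f_v$. A *$*$-logarithm* of $g$ on $\Omega$ is an $f\in\mathcal{SR}(\Omega)$ with $\exp_*(f)=\sum_{n\ge0}f^{*n}/n!=g$ on $\Omega$. Two vectorial functions defined near $p$ are *equivalent at $p$* if on some axially symmetric domain $V\ni p$ they are linearly dependent over $\mathcal{SR}_{\mathbb R}(V)$ (i.e. $af+bg=0$ with $a,b\in\mathcal{SR}_{\mathbb R}(V)$ not both identically zero) and either both or none of them vanish identically near $p$; $[f]_p$ denotes the equivalence class. A *vectorial class* $\omega$ on $\Omega$ assigns to each $p\in\Omega$ a class $\omega(p)$ at $p$, such that whenever $\omega(p)=[f]_p$ and $\omega(q)=[g]_q$ with $f,g$ vectorial on axially symmetric domains $V\ni p$, $W\ni q$ contained in $\Omega$, then $[f]_t=[g]_t$ for all $t\in V\cap W$. Write $\omega=[0]$ if $\omega(p)=[0]_p$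 for all $p\in\Omega$. Let $\mathcal{SR}_\omega(\Omega)$ be the set of $g\in\mathcal{SR}(\Omega)$ with $[g_v]_p\in\{\omega(p),[0]_p\}$ for every $p\in\Omega$ (so $\mathcal{SR}_{\mathbb R}(\Omega)\subseteq\mathcal{SR}_\omega(\Omega)$, with equality for $\omega=[0]$). If $\omega\neq[0]$, the set $Z(\omega)$ consists of the zeros of all *minimal representatives* of $\omega$, that is, vectorial functions $w$ on axially symmetric open sets $U\subseteq\Omega$ with $[w]_p=\omega(p)$ for all $p\in U$, having no real zeros and vanishing identically on no sphere $x+\mathbb Sy\subseteq U$, $y\ne0$; put $Z([0])=\varnothing$. For $W\subseteq\mathbb H$ let $\mathbb SW$ be the union of the sets $x+\mathbb Sy$ that meet $W$. **Theorem 1.1.** Let $\Omega\subseteq\mathbb H$ be a basic domain, $\omega$ a vectorial class on $\Omega$, and $g\in\mathcal{SR}_\omega(\Omega)$ a function with no zeros in $\Omega$. (a) If $\omega=[0]$, then $g$ has a $*$-logarithm in $\mathcal{SR}_{[0]}(\Omega)=\mathcal{SR}_{\mathbb R}(\Omega)$ if and only if $g(\Omega\cap\mathbb R)\subset(0,+\infty)$.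 (b) If $\omega\ne[0]$ and either $Z(\omega)=\varnothing$ or $\mathbb SZ(\omega)=\Omega$, then $g$ has a $*$-logarithm in $\mathcal{SR}_\omega(\Omega)$. (c) If $\omega\neq[0]$ and $Z(\omega)$ is discrete, and if for some branch $\sqrt{g^s}$ (i.e. a function in $\mathcal{SR}_{\mathbb R}(\Omega)$ whose square is $g^s$) both $$\sqrt{g^s}(\Omega\cap\mathbb R)\subset(0,+\infty)\qquad\text{and}\qquad \frac{g_0}{\sqrt{g^s}}(\Omega)\subset\mathbb H\setminus(-\infty,-1]$$ hold, then $g$ has a $*$-logarithm in $\mathcal{SR}_\omega(\Omega)$. -/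

import Mathlib

open scoped Quaternion Topology Nat

noncomputable section

namespace StarLog

/-! ### Slices, axially symmetric sets, basic domains -/

/-- The 2-sphere of imaginary units of the quaternions. -/
def unitSphere : Set ℍ[ℝ] := {J | J * J = -1}

/-- The map `x + i y ↦ x + J y`. For `J` an imaginary unit its range is the slice `ℂ_J`. -/
def toSlice (J : ℍ[ℝ]) (z : ℂ) : ℍ[ℝ] := (z.re : ℍ[ℝ]) + z.im • J

/-- The slice `ℂ_J = ℝ + J ℝ`. -/
def slice (J : ℍ[ℝ]) : Set ℍ[ℝ] := Set.range (toSlice J)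

/-- The trace `Ω ∩ ℂ_J`, transported to `ℂ` through `x + J y ↔ x + i y`. -/
def trace (Ω : Set ℍ[ℝ]) (J : ℍ[ℝ]) : Set ℂ := toSlice J ⁻¹' Ω

/-- The real axis of the quaternions. -/
def realAxis : Set ℍ[ℝ] := Set.range (fun x : ℝ => (x : ℍ[ℝ]))

/-- `Ω` contains the sphere `x + 𝕊 y` as soon as it contains one of its points. -/
def AxiallySymmetric (Ω : Set ℍ[ℝ]) : Prop :=
  ∀ z : ℂ, ∀ I ∈ unitSphere, toSlice I z ∈ Ω → ∀ J ∈ unitSphere, toSlice J z ∈ Ω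

/-- The union of the spheres `x + 𝕊 y` that meet `W`. -/
def axialHull (W : Set ℍ[ℝ]) : Set ℍ[ℝ] :=
  {q | ∃ z : ℂ, ∃ I ∈ unitSphere, ∃ J ∈ unitSphere, toSlice I z ∈ W ∧ q = toSlice J z}

/-- Axially symmetric domains: open, connected (hence nonempty), axially symmetric. -/
structure IsAxialDomain (Ω : Set ℍ[ℝ]) : Prop where
  isOpen : IsOpen Ω
  isConnected : IsConnected Ω
  axiallySymmetric : AxiallySymmetric Ω

/-- Basic domains: every connected component of every `Ω ∩ ℂ_I` is simply connected. -/
structure IsBasicDomain (Ω : Set ℍ[ℝ]) : Prop extends IsAxialDomain Ω where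
  simplyConnected : ∀ I ∈ unitSphere, ∀ z ∈ trace Ω I,
    IsSimplyConnected (connectedComponentIn (trace Ω I) z)

/-! ### Stem functions and slice-regular functions

The complexification `ℍ + ι ℍ` of the quaternions is realised as the ring `ℍ[ℂ]` of quaternions
with complex coefficients, `ι` being the central element `Complex.I`. -/

/-- The first component of `x + ι y`, for quaternions `x`, `y`. -/
def rePart (F : ℍ[ℂ]) : ℍ[ℝ] := ⟨F.re.re, F.imI.re, F.imJ.re, F.imK.re⟩

/-- The second component of `x + ι y`, for quaternions `x`, `y`. -/
def imPart (F : ℍ[ℂ]) : ℍ[ℝ] := ⟨F.re.im, F.imI.im, F.imJ.im, F.imK.im⟩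

/-- The element `x + ι y` of the complexification. -/
def complexify (x y : ℍ[ℝ]) : ℍ[ℂ] :=
  ⟨⟨x.re, y.re⟩, ⟨x.imI, y.imI⟩, ⟨x.imJ, y.imJ⟩, ⟨x.imK, y.imK⟩⟩

/-- The involution `x + ι y ↦ x - ι y`. -/
def involution (F : ℍ[ℂ]) : ℍ[ℂ] := complexify (rePart F) (-imPart F)

/-- The map `φ_J : x + ι y ↦ x + J y`. -/
def phi (J : ℍ[ℝ]) (F : ℍ[ℂ]) : ℍ[ℝ] := rePart F + J * imPart F

/-- The imaginary unit `i` of the standard basis. -/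
def unitI : ℍ[ℝ] := ⟨0, 1, 0, 0⟩

/-- `F` is a holomorphic stem function on the conjugation invariant set `D`. -/
structure IsHolomorphicStem (D : Set ℂ) (F : ℂ → ℍ[ℂ]) : Prop where
  symm : ∀ z ∈ D, F (starRingEnd ℂ z) = involution (F z)
  holo_re : DifferentiableOn ℂ (fun z => (F z).re) D
  holo_imI : DifferentiableOn ℂ (fun z => (F z).imI) D
  holo_imJ : DifferentiableOn ℂ (fun z => (F z).imJ) D
  holo_imK : DifferentiableOn ℂ (fun z => (F z).imK) D

/-- `f` is the slice function induced on `Ω` by `F`. -/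
def Induces (Ω : Set ℍ[ℝ]) (F : ℂ → ℍ[ℂ]) (f : ℍ[ℝ] → ℍ[ℝ]) : Prop :=
  ∀ J ∈ unitSphere, ∀ z ∈ trace Ω unitI, f (toSlice J z) = phi J (F z)

/-- Slice-regular functions on an axially symmetric open set `Ω`. Functions are total; their
values outside of `Ω` play no role. -/
def SR (Ω : Set ℍ[ℝ]) : Set (ℍ[ℝ] → ℍ[ℝ]) :=
  {f | ∃ F : ℂ → ℍ[ℂ], IsHolomorphicStem (trace Ω unitI) F ∧ Induces Ω F f}

/-- Slice-regular functions that are slice-preserving. -/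
def SRReal (Ω : Set ℍ[ℝ]) : Set (ℍ[ℝ] → ℍ[ℝ]) :=
  {f | f ∈ SR Ω ∧ ∀ I ∈ unitSphere, ∀ q ∈ Ω ∩ slice I, f q ∈ slice I}

/-- The slice function induced by `F`: at `q = x + I y` with `y ≥ 0` its value is
`φ_I (F (x + i y))`. At a real `q` the value is the first component of `F q`
(the second one vanishes for a stem function). -/
def induced (F : ℂ → ℍ[ℂ]) (q : ℍ[ℝ]) : ℍ[ℝ] :=
  phi (‖q.im‖⁻¹ • q.im) (F ⟨q.re, ‖q.im‖⟩)

/-- The unique stem function that induces a slice function `f`, recovered from the values of `f`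
on the slice `ℂ_i`: for `q = x + i y` its components are `(f q + f q̄) / 2` and
`- i (f q - f q̄) / 2`. -/
def stemOf (f : ℍ[ℝ] → ℍ[ℝ]) (z : ℂ) : ℍ[ℂ] :=
  complexify
    ((1 / 2 : ℝ) • (f (toSlice unitI z) + f (toSlice unitI (starRingEnd ℂ z))))
    ((1 / 2 : ℝ) • (-unitI * (f (toSlice unitI z) - f (toSlice unitI (starRingEnd ℂ z)))))

/-- The slice function induced by a complex valued (that is, slice-preserving) stem function. -/
def inducedScalar (F : ℂ → ℂ) : ℍ[ℝ] → ℍ[ℝ] := induced (fun z => (F z : ℍ[ℂ]))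

/-- The slice-preserving components of `f = f₀ + f₁ i + f₂ j + f₃ k`; `comp₀` is the scalar part. -/
def comp₀ (f : ℍ[ℝ] → ℍ[ℝ]) : ℍ[ℝ] → ℍ[ℝ] := inducedScalar (fun z => (stemOf f z).re)

/-- The component `f₁`. -/
def comp₁ (f : ℍ[ℝ] → ℍ[ℝ]) : ℍ[ℝ] → ℍ[ℝ] := inducedScalar (fun z => (stemOf f z).imI)

/-- The component `f₂`. -/
def comp₂ (f : ℍ[ℝ] → ℍ[ℝ]) : ℍ[ℝ] → ℍ[ℝ] := inducedScalar (fun z => (stemOf f z).imJ)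

/-- The component `f₃`. -/
def comp₃ (f : ℍ[ℝ] → ℍ[ℝ]) : ℍ[ℝ] → ℍ[ℝ] := inducedScalar (fun z => (stemOf f z).imK)

/-- The vectorial part `f_v = f - f₀`. -/
def vecPart (f : ℍ[ℝ] → ℍ[ℝ]) (q : ℍ[ℝ]) : ℍ[ℝ] := f q - comp₀ f q

/-- The symmetrization `f^s = f₀² + f₁² + f₂² + f₃²`. -/
def symmetrization (f : ℍ[ℝ] → ℍ[ℝ]) (q : ℍ[ℝ]) : ℍ[ℝ] :=
  comp₀ f q ^ 2 + comp₁ f q ^ 2 + comp₂ f q ^ 2 + comp₃ f q ^ 2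

/-- Vectorial functions on `Ω`: the slice-regular functions equal to their vectorial part. -/
def SRVec (Ω : Set ℍ[ℝ]) : Set (ℍ[ℝ] → ℍ[ℝ]) :=
  {f | f ∈ SR Ω ∧ ∀ q ∈ Ω, f q = vecPart f q}

/-! ### The `*`-product and the `*`-exponential -/

/-- The `*`-product. -/
def starMul (f g : ℍ[ℝ] → ℍ[ℝ]) : ℍ[ℝ] → ℍ[ℝ] := induced (fun z => stemOf f z * stemOf g z)

/-- The `*`-powers. -/
def starPow (f : ℍ[ℝ] → ℍ[ℝ]) : ℕ → ℍ[ℝ] → ℍ[ℝ]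
  | 0 => fun _ => 1
  | n + 1 => starMul f (starPow f n)

/-- `f` is a `*`-logarithm of `g` on `Ω`: the series `∑ f^{*n} / n!` converges to `g` on `Ω`. -/
def IsStarLog (Ω : Set ℍ[ℝ]) (f g : ℍ[ℝ] → ℍ[ℝ]) : Prop :=
  ∀ q ∈ Ω, HasSum (fun n : ℕ => (n ! : ℝ)⁻¹ • starPow f n q) (g q)

/-! ### Vectorial classes -/

/-- Linear dependence of `f`, `g` over the slice-preserving functions on a domain `V`. -/
def LinDepOn (V : Set ℍ[ℝ]) (f g : ℍ[ℝ] → ℍ[ℝ]) : Prop :=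
  ∃ a ∈ SRReal V, ∃ b ∈ SRReal V, ((∃ q ∈ V, a q ≠ 0) ∨ (∃ q ∈ V, b q ≠ 0)) ∧
    ∀ q ∈ V, a q * f q + b q * g q = 0

/-- Equivalence at `p` of vectorial functions: they are linearly dependent near `p`. Since `0`
depends linearly on every function, the last clause is needed for an equivalence relation: the
zero germ is equivalent only to itself. -/
def VecEquiv (p : ℍ[ℝ]) (f g : ℍ[ℝ] → ℍ[ℝ]) : Prop :=
  ∃ V : Set ℍ[ℝ], IsAxialDomain V ∧ p ∈ V ∧ f ∈ SRVec V ∧ g ∈ SRVec V ∧ LinDepOn V f g ∧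
    ((∀ᶠ q in 𝓝 p, f q = 0) ↔ (∀ᶠ q in 𝓝 p, g q = 0))

/-- Equivalence classes at `p`. -/
def VecQuot (p : ℍ[ℝ]) : Type := Quot (VecEquiv p)

/-- The equivalence class `[f]_p`. -/
def vecClass (p : ℍ[ℝ]) (f : ℍ[ℝ] → ℍ[ℝ]) : VecQuot p := Quot.mk _ f

/-- The set of the classes at `p` of vectorial functions defined near `p`. -/
def vecClasses (p : ℍ[ℝ]) : Set (VecQuot p) :=
  {c | ∃ U : Set ℍ[ℝ], IsOpen U ∧ AxiallySymmetric U ∧ p ∈ U ∧ ∃ f ∈ SRVec U, c = vecClass p f}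

/-- Vectorial classes on `Ω`. -/
structure VectorialClass (Ω : Set ℍ[ℝ]) where
  /-- the class at a point -/
  classAt : ∀ p ∈ Ω, VecQuot p
  mem : ∀ p (hp : p ∈ Ω), classAt p hp ∈ vecClasses p
  compatible : ∀ p (hp : p ∈ Ω) q (hq : q ∈ Ω) (V W : Set ℍ[ℝ]) (f g : ℍ[ℝ] → ℍ[ℝ]),
    IsAxialDomain V → V ⊆ Ω → p ∈ V → f ∈ SRVec V → classAt p hp = vecClass p f →
    IsAxialDomain W → W ⊆ Ω → q ∈ W → g ∈ SRVec W → classAt q hq = vecClass q g →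
    ∀ t ∈ V ∩ W, vecClass t f = vecClass t g

namespace VectorialClass

variable {Ω : Set ℍ[ℝ]}

/-- `ω = [0]`. -/
def IsZero (ω : VectorialClass Ω) : Prop := ∀ p (hp : p ∈ Ω), ω.classAt p hp = vecClass p 0

/-- The set `SR_ω(Ω)` of the slice-regular functions whose vectorial part is in the class `ω`;
slice-preserving functions (zero vectorial part) belong to it for every `ω`. -/
def SR (ω : VectorialClass Ω) : Set (ℍ[ℝ] → ℍ[ℝ]) :=
  {g | g ∈ StarLog.SR Ω ∧ ∀ p (hp : p ∈ Ω),
    vecClass p (vecPart g) = ω.classAt p hp ∨ vecClass p (vecPart g) = vecClass p 0}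

/-- `w` has neither real nor spherical zeros on `U`. -/
def IsMinimalOn (U : Set ℍ[ℝ]) (w : ℍ[ℝ] → ℍ[ℝ]) : Prop :=
  (∀ q ∈ U ∩ realAxis, w q ≠ 0) ∧
  ∀ z : ℂ, z.im ≠ 0 → ¬ ∀ I ∈ unitSphere, toSlice I z ∈ U ∧ w (toSlice I z) = 0

/-- `w` is a minimal representative of `ω` on the axially symmetric open set `U ⊆ Ω`. -/
structure IsMinimalRep (ω : VectorialClass Ω) (U : Set ℍ[ℝ]) (w : ℍ[ℝ] → ℍ[ℝ]) : Prop where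
  isOpen : IsOpen U
  axiallySymmetric : AxiallySymmetric U
  subset : U ⊆ Ω
  mem : w ∈ SRVec U
  rep : ∀ p (hp : p ∈ U), vecClass p w = ω.classAt p (subset hp)
  minimal : IsMinimalOn U w

/-- The zero set `Z(ω)`: the zeros of all local minimal representatives; empty for `ω = [0]`. -/
def zeroSet (ω : VectorialClass Ω) : Set ℍ[ℝ] :=
  {q | ¬ ω.IsZero ∧ ∃ U w, ω.IsMinimalRep U w ∧ q ∈ U ∧ w q = 0}

end VectorialClass

end StarLog

end

open StarLog

noncomputable section

namespace StarLog

/-! ### Slices -/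

/-! A slice-regular function is equivalent to its stem function `F = a + V`: a scalar part `a` and a
vector `V` in `ℂ³`, holomorphic and compatible with conjugation. The `*`-product is pointwise
multiplication in `ℍ[ℂ]`, where `V² = -(V ⬝ᵥ V)` for the bilinear product. With `θ² = V ⬝ᵥ V` this
gives `exp (a + V) = e^a (cos θ + (sin θ / θ) V)` (`hasSum_phi_exp`). A `*`-logarithm of `g = g₀ +
G` therefore amounts to a symmetric holomorphic solution of `e^a cos θ = g₀` and `e^a (sin θ / θ) V
= G` (`isStarLog_of_stem`). That `g` has no zeros means that `g₀² + G ⬝ᵥ G` has none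
(`exists_phi_eq_zero_iff`).

A class `ω ≠ [0]` is a complex line in `ℂ³` over each point of the trace, spanned by the nowhere
vanishing stem vectors of minimal representatives (`exists_isMinimalRep`). Membership in `SR_ω`
means that the vector part lies in this line (`par_of_mem`, `mem_SR_of_par`). The sphere over `z`
meets `Z(ω)` exactly when the line over `z` is isotropic.

For `ω = [0]` one has `V = 0`, and a logarithm of `g₀` compatible with conjugation is needed. It is
real on the real axis, so positivity there is necessary; `exists_symmetric_log` shows that it
suffices.

If no line is isotropic, simple connectedness gives a global field `W` with `W ⬝ᵥ W = 1`
(`exists_unit`). Then `g = g₀ + c W` with `W² = -1`, and with `V = θ W` the problem splits into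
`e^(a ± iθ) = g₀ ± i c`. Conjugation exchanges the two equations, so a logarithm of one side and its
reflection solve both, without any condition on the real axis.

If all lines are isotropic, `exp (a + V) = e^a (1 + V)`, solved by `a = log g₀` and `V = G / g₀`.
There are no real points, because minimal representatives have no real zeros.

In the remaining case put `R = √(g^s)`, `a = log R`, `cos θ = u = g₀ / R` and `V = (θ / sin θ) G /
R`. The quotient `θ / sin θ` is even in `θ`, hence a holomorphic function of `u` off `(-∞, -1]`,
also at the branch point `u = 1` (`differentiableOn_arccosDivSin`). -/

theorem mem_unitSphere_iff {J : ℍ[ℝ]} :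
    J ∈ unitSphere ↔ J.re = 0 ∧ J.imI ^ 2 + J.imJ ^ 2 + J.imK ^ 2 = 1 := by
  simp only [unitSphere, Set.mem_ofPred_eq, Quaternion.ext_iff]
  simp only [Quaternion.re_mul, Quaternion.imI_mul, Quaternion.imJ_mul, Quaternion.imK_mul,
    Quaternion.re_neg, Quaternion.imI_neg, Quaternion.imJ_neg, Quaternion.imK_neg,
    Quaternion.re_one, Quaternion.imI_one, Quaternion.imJ_one, Quaternion.imK_one]
  constructor
  · rintro ⟨h0, h1, h2, h3⟩
    -- A nonzero real part would force the three imaginary parts to vanish, and then its square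
    -- would be `-1`.
    have hre : J.re = 0 := by
      by_contra hne
      have e1 : J.imI = 0 := by
        have : J.re * J.imI = 0 := by linarith
        simpa [hne] using this
      have e2 : J.imJ = 0 := by
        have : J.re * J.imJ = 0 := by linarith
        simpa [hne] using this
      have e3 : J.imK = 0 := by
        have : J.re * J.imK = 0 := by linarith
        simpa [hne] using this
      rw [e1, e2, e3] at h0
      nlinarith [sq_nonneg J.re]
    refine ⟨hre, ?_⟩
    rw [hre] at h0
    linarith
  · rintro ⟨h0, h1⟩
    rw [h0]
    refine ⟨by linarith, by ring, by ring, by ring⟩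

/-- The imaginary unit `j` of the standard basis. -/
def unitJ : ℍ[ℝ] := ⟨0, 0, 1, 0⟩

@[simp] theorem unitI_re : unitI.re = 0 := rfl
@[simp] theorem unitI_imI : unitI.imI = 1 := rfl
@[simp] theorem unitI_imJ : unitI.imJ = 0 := rfl
@[simp] theorem unitI_imK : unitI.imK = 0 := rfl
@[simp] theorem unitJ_re : unitJ.re = 0 := rfl
@[simp] theorem unitJ_imI : unitJ.imI = 0 := rfl
@[simp] theorem unitJ_imJ : unitJ.imJ = 1 := rfl
@[simp] theorem unitJ_imK : unitJ.imK = 0 := rfl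

theorem unitI_mem : unitI ∈ unitSphere := by
  rw [mem_unitSphere_iff]; simp

theorem unitJ_mem : unitJ ∈ unitSphere := by
  rw [mem_unitSphere_iff]; simp

theorem neg_mem_unitSphere {J : ℍ[ℝ]} (hJ : J ∈ unitSphere) : -J ∈ unitSphere := by
  simpa [unitSphere] using hJ

/-- The isomorphism of `ℂ` with the slice of `J`, as a homomorphism of algebras. -/
def sliceHom (J : ℍ[ℝ]) (hJ : J ∈ unitSphere) : ℂ →ₐ[ℝ] ℍ[ℝ] := Complex.liftAux J hJ

theorem sliceHom_apply {J : ℍ[ℝ]} (hJ : J ∈ unitSphere) (z : ℂ) :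
    sliceHom J hJ z = toSlice J z := by
  simp only [sliceHom, toSlice]
  rfl

theorem toSlice_mul {J : ℍ[ℝ]} (hJ : J ∈ unitSphere) (a b : ℂ) :
    toSlice J (a * b) = toSlice J a * toSlice J b := by
  simp only [← sliceHom_apply hJ, map_mul]

theorem toSlice_pow {J : ℍ[ℝ]} (hJ : J ∈ unitSphere) (a : ℂ) (n : ℕ) :
    toSlice J (a ^ n) = toSlice J a ^ n := by
  simp only [← sliceHom_apply hJ, map_pow]

theorem toSlice_inv {J : ℍ[ℝ]} (hJ : J ∈ unitSphere) (a : ℂ) :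
    toSlice J a⁻¹ = (toSlice J a)⁻¹ := by
  simp only [← sliceHom_apply hJ, map_inv₀]

theorem toSlice_add (J : ℍ[ℝ]) (a b : ℂ) : toSlice J (a + b) = toSlice J a + toSlice J b := by
  simp only [toSlice, Complex.add_re, Complex.add_im, Quaternion.coe_add, add_smul]; abel

theorem toSlice_neg (J : ℍ[ℝ]) (a : ℂ) : toSlice J (-a) = -toSlice J a := by
  simp only [toSlice, Complex.neg_re, Complex.neg_im, Quaternion.coe_neg, neg_smul]; abel

theorem toSlice_ofReal (J : ℍ[ℝ]) (x : ℝ) : toSlice J (x : ℂ) = (x : ℍ[ℝ]) := by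
  simp [toSlice]

theorem toSlice_zero (J : ℍ[ℝ]) : toSlice J 0 = 0 := by
  simp [toSlice]

theorem toSlice_inj {J : ℍ[ℝ]} (hJ : J ∈ unitSphere) {a b : ℂ} :
    toSlice J a = toSlice J b ↔ a = b := by
  simp only [← sliceHom_apply hJ]
  exact (sliceHom J hJ).injective.eq_iff

theorem toSlice_eq_zero {J : ℍ[ℝ]} (hJ : J ∈ unitSphere) {a : ℂ} :
    toSlice J a = 0 ↔ a = 0 := by
  rw [← toSlice_zero J, toSlice_inj hJ]

theorem toSlice_neg_unit (J : ℍ[ℝ]) (z : ℂ) :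
    toSlice (-J) z = toSlice J (starRingEnd ℂ z) := by
  simp [toSlice]

theorem toSlice_re {J : ℍ[ℝ]} (hJ : J ∈ unitSphere) (z : ℂ) : (toSlice J z).re = z.re := by
  simp [toSlice, (mem_unitSphere_iff.1 hJ).1]

theorem toSlice_im {J : ℍ[ℝ]} (hJ : J ∈ unitSphere) (z : ℂ) :
    (toSlice J z).im = z.im • J := by
  have := (mem_unitSphere_iff.1 hJ).1
  ext <;> simp [toSlice, this]

theorem norm_unit {J : ℍ[ℝ]} (hJ : J ∈ unitSphere) : ‖J‖ = 1 := by
  have h : ‖J‖ * ‖J‖ = 1 := by rw [← norm_mul, show J * J = -1 from hJ]; simp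
  nlinarith [norm_nonneg J]

theorem toSlice_norm_im {J : ℍ[ℝ]} (hJ : J ∈ unitSphere) (z : ℂ) :
    ‖(toSlice J z).im‖ = |z.im| := by
  rw [toSlice_im hJ, norm_smul, norm_unit hJ, mul_one, Real.norm_eq_abs]

theorem continuous_toSlice (J : ℍ[ℝ]) : Continuous (toSlice J) := by
  unfold toSlice
  have := Quaternion.continuous_coe
  fun_prop

/-- The point of the closed upper half plane that represents the sphere of `q`. -/
def planePoint (q : ℍ[ℝ]) : ℂ := ⟨q.re, ‖q.im‖⟩

theorem continuous_planePoint : Continuous planePoint := by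
  have h : planePoint = fun q => ((q.re : ℝ) : ℂ) + ((‖q.im‖ : ℝ) : ℂ) * Complex.I := by
    funext q
    apply Complex.ext <;> simp [planePoint]
  rw [h]
  have h1 := Quaternion.continuous_re
  have h2 := Quaternion.continuous_im
  fun_prop

theorem planePoint_toSlice {J : ℍ[ℝ]} (hJ : J ∈ unitSphere) (z : ℂ) :
    planePoint (toSlice J z) = ⟨z.re, |z.im|⟩ := by
  simp [planePoint, toSlice_re hJ, toSlice_norm_im hJ]

theorem planePoint_toSlice_of_nonneg {J : ℍ[ℝ]} (hJ : J ∈ unitSphere) {z : ℂ} (hz : 0 ≤ z.im) :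
    planePoint (toSlice J z) = z := by
  rw [planePoint_toSlice hJ, abs_of_nonneg hz]

theorem planePoint_toSlice_of_neg {J : ℍ[ℝ]} (hJ : J ∈ unitSphere) {z : ℂ} (hz : z.im < 0) :
    planePoint (toSlice J z) = starRingEnd ℂ z := by
  rw [planePoint_toSlice hJ, abs_of_neg hz]
  rfl

theorem planePoint_im_nonneg (q : ℍ[ℝ]) : 0 ≤ (planePoint q).im := norm_nonneg _

theorem unit_of_im_ne_zero {v : ℍ[ℝ]} (hv : v.im ≠ 0) : ‖v.im‖⁻¹ • v.im ∈ unitSphere := by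
  have hn : ‖v.im‖ ≠ 0 := norm_ne_zero_iff.2 hv
  rw [mem_unitSphere_iff]
  refine ⟨by simp, ?_⟩
  have h : ‖v.im‖ * ‖v.im‖ = v.imI ^ 2 + v.imJ ^ 2 + v.imK ^ 2 := by
    rw [← Quaternion.normSq_eq_norm_mul_self, Quaternion.normSq_def']; simp
  simp only [Quaternion.imI_smul, Quaternion.imJ_smul, Quaternion.imK_smul, Quaternion.imI_im,
    Quaternion.imJ_im, Quaternion.imK_im, smul_eq_mul, mul_pow, ← mul_add, ← h]
  field_simp

theorem exists_toSlice_planePoint (q : ℍ[ℝ]) :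
    ∃ J ∈ unitSphere, q = toSlice J (planePoint q) := by
  -- A real point lies on every slice, so any unit serves; otherwise the unit is the direction of
  -- the imaginary part.
  by_cases h : q.im = 0
  · refine ⟨unitI, unitI_mem, ?_⟩
    have : q = (q.re : ℍ[ℝ]) + q.im := (Quaternion.re_add_im q).symm
    rw [this]
    simp [toSlice, planePoint, h]
  · refine ⟨_, unit_of_im_ne_zero h, ?_⟩
    have hn : ‖q.im‖ ≠ 0 := norm_ne_zero_iff.2 h
    conv_lhs => rw [← Quaternion.re_add_im q]
    simp [toSlice, planePoint, smul_smul, hn]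

theorem AxiallySymmetric.mem_trace_conj {Ω : Set ℍ[ℝ]} (hΩ : AxiallySymmetric Ω) {z : ℂ}
    (hz : z ∈ trace Ω unitI) : starRingEnd ℂ z ∈ trace Ω unitI := by
  have := hΩ z unitI unitI_mem hz (-unitI) (neg_mem_unitSphere unitI_mem)
  rwa [toSlice_neg_unit] at this

theorem AxiallySymmetric.mem_of_mem_trace {Ω : Set ℍ[ℝ]} (hΩ : AxiallySymmetric Ω) {z : ℂ}
    (hz : z ∈ trace Ω unitI) {J : ℍ[ℝ]} (hJ : J ∈ unitSphere) : toSlice J z ∈ Ω :=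
  hΩ z unitI unitI_mem hz J hJ

theorem AxiallySymmetric.mem_trace_of_mem {Ω : Set ℍ[ℝ]} (hΩ : AxiallySymmetric Ω) {z : ℂ}
    {J : ℍ[ℝ]} (hJ : J ∈ unitSphere) (h : toSlice J z ∈ Ω) : z ∈ trace Ω unitI :=
  hΩ z J hJ h unitI unitI_mem

theorem AxiallySymmetric.planePoint_mem {Ω : Set ℍ[ℝ]} (hΩ : AxiallySymmetric Ω) {q : ℍ[ℝ]}
    (hq : q ∈ Ω) : planePoint q ∈ trace Ω unitI := by
  obtain ⟨J, hJ, h⟩ := exists_toSlice_planePoint q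
  rw [h] at hq
  exact hΩ.mem_trace_of_mem hJ hq

theorem isOpen_trace {Ω : Set ℍ[ℝ]} (hΩ : IsOpen Ω) (J : ℍ[ℝ]) : IsOpen (trace Ω J) :=
  hΩ.preimage (continuous_toSlice J)

/-! ### The maps `φ_J` -/

section Components

variable (X : ℍ[ℂ]) (x y : ℍ[ℝ])

@[simp] theorem rePart_re : (rePart X).re = X.re.re := rfl
@[simp] theorem rePart_imI : (rePart X).imI = X.imI.re := rfl
@[simp] theorem rePart_imJ : (rePart X).imJ = X.imJ.re := rfl
@[simp] theorem rePart_imK : (rePart X).imK = X.imK.re := rfl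
@[simp] theorem imPart_re : (imPart X).re = X.re.im := rfl
@[simp] theorem imPart_imI : (imPart X).imI = X.imI.im := rfl
@[simp] theorem imPart_imJ : (imPart X).imJ = X.imJ.im := rfl
@[simp] theorem imPart_imK : (imPart X).imK = X.imK.im := rfl
@[simp] theorem complexify_re : (complexify x y).re = ⟨x.re, y.re⟩ := rfl
@[simp] theorem complexify_imI : (complexify x y).imI = ⟨x.imI, y.imI⟩ := rfl
@[simp] theorem complexify_imJ : (complexify x y).imJ = ⟨x.imJ, y.imJ⟩ := rfl
@[simp] theorem complexify_imK : (complexify x y).imK = ⟨x.imK, y.imK⟩ := rfl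

@[simp] theorem involution_re : (involution X).re = starRingEnd ℂ X.re := by
  apply Complex.ext <;> simp [involution]
@[simp] theorem involution_imI : (involution X).imI = starRingEnd ℂ X.imI := by
  apply Complex.ext <;> simp [involution]
@[simp] theorem involution_imJ : (involution X).imJ = starRingEnd ℂ X.imJ := by
  apply Complex.ext <;> simp [involution]
@[simp] theorem involution_imK : (involution X).imK = starRingEnd ℂ X.imK := by
  apply Complex.ext <;> simp [involution]

end Components

theorem phi_coe (J : ℍ[ℝ]) (c : ℂ) : phi J (c : ℍ[ℂ]) = toSlice J c := by
  have h1 : rePart (c : ℍ[ℂ]) = (c.re : ℍ[ℝ]) := by ext <;> simp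
  have h2 : imPart (c : ℍ[ℂ]) = (c.im : ℍ[ℝ]) := by ext <;> simp
  rw [phi, h1, h2, toSlice, Quaternion.mul_coe_eq_smul]

theorem phi_add (J : ℍ[ℝ]) (X Y : ℍ[ℂ]) : phi J (X + Y) = phi J X + phi J Y := by
  have h1 : rePart (X + Y) = rePart X + rePart Y := by ext <;> simp
  have h2 : imPart (X + Y) = imPart X + imPart Y := by ext <;> simp
  rw [phi, h1, h2, phi, phi, mul_add]; abel

/-- `φ_J` is not multiplicative on `ℍ + ι ℍ`, but `ι` turns into left multiplication by `J`; this
makes it left linear over `ℂ` identified with the slice of `J`. -/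
theorem phi_smul {J : ℍ[ℝ]} (hJ : J ∈ unitSphere) (c : ℂ) (X : ℍ[ℂ]) :
    phi J (c • X) = toSlice J c * phi J X := by
  have h1 : rePart (c • X) = c.re • rePart X - c.im • imPart X := by ext <;> simp
  have h2 : imPart (c • X) = c.re • imPart X + c.im • rePart X := by
    ext <;> simp
  have hJ' : J * J = -1 := hJ
  rw [phi, h1, h2, phi, toSlice]
  rw [add_mul, mul_add, mul_add, mul_add, smul_mul_assoc, smul_mul_assoc, ← mul_assoc J J, hJ',
    Quaternion.coe_mul_eq_smul, Quaternion.coe_mul_eq_smul]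
  simp only [mul_smul_comm, smul_neg, neg_mul, one_mul]
  abel

theorem phi_zero (J : ℍ[ℝ]) : phi J 0 = 0 := by
  have := phi_coe J 0
  simpa [toSlice_zero] using this

theorem phi_involution (J : ℍ[ℝ]) (X : ℍ[ℂ]) : phi J (involution X) = phi (-J) X := by
  have h1 : rePart (involution X) = rePart X := by ext <;> simp
  have h2 : imPart (involution X) = -imPart X := by
    ext <;> simp
  rw [phi, phi, h1, h2]; simp

theorem complexify_parts (X : ℍ[ℂ]) : complexify (rePart X) (imPart X) = X := by
  ext <;> simp

/-- An element of `ℍ + ι ℍ` is determined by its images under `φ_J` and `φ_{-J}`. -/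
theorem eq_of_phi_eq {J : ℍ[ℝ]} (hJ : J ∈ unitSphere) {X Y : ℍ[ℂ]} (h1 : phi J X = phi J Y)
    (h2 : phi (-J) X = phi (-J) Y) : X = Y := by
  have hJ' : J * J = -1 := hJ
  simp only [phi, neg_mul] at h1 h2
  have e1 : (2 : ℝ) • rePart X = (2 : ℝ) • rePart Y := by
    rw [two_smul, two_smul]
    calc rePart X + rePart X = (rePart X + J * imPart X) + (rePart X + -(J * imPart X)) := by abel
      _ = _ := by rw [h1, h2]; abel
  have e1' : rePart X = rePart Y := smul_right_injective _ (two_ne_zero) e1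
  have e2 : J * imPart X = J * imPart Y := by
    rw [e1'] at h1
    exact add_left_cancel h1
  have e2' : imPart X = imPart Y := by
    have := congrArg (fun t => J * t) e2
    simpa [← mul_assoc, hJ'] using this
  rw [← complexify_parts X, ← complexify_parts Y, e1', e2']

/-! ### Scalar and vectorial stem functions -/

/-- Holomorphic complex valued stem functions. -/
structure ScalarStem (D : Set ℂ) (a : ℂ → ℂ) : Prop where
  symm : ∀ z ∈ D, a (starRingEnd ℂ z) = starRingEnd ℂ (a z)
  holo : DifferentiableOn ℂ a D

/-- The vector of the three imaginary coordinates. -/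
def vec (X : ℍ[ℂ]) : Fin 3 → ℂ := ![X.imI, X.imJ, X.imK]

/-- The element of `ℍ + ι ℍ` with given real coordinate and imaginary coordinates. -/
def ofParts (a : ℂ) (v : Fin 3 → ℂ) : ℍ[ℂ] := ⟨a, v 0, v 1, v 2⟩

@[simp] theorem ofParts_re (a : ℂ) (v : Fin 3 → ℂ) : (ofParts a v).re = a := rfl
@[simp] theorem ofParts_imI (a : ℂ) (v : Fin 3 → ℂ) : (ofParts a v).imI = v 0 := rfl
@[simp] theorem ofParts_imJ (a : ℂ) (v : Fin 3 → ℂ) : (ofParts a v).imJ = v 1 := rfl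
@[simp] theorem ofParts_imK (a : ℂ) (v : Fin 3 → ℂ) : (ofParts a v).imK = v 2 := rfl
@[simp] theorem vec_ofParts (a : ℂ) (v : Fin 3 → ℂ) : vec (ofParts a v) = v := by
  funext i; fin_cases i <;> rfl
@[simp] theorem ofParts_vec (X : ℍ[ℂ]) : ofParts X.re (vec X) = X := rfl
@[simp] theorem vec_zero : vec 0 = 0 := by
  funext i; fin_cases i <;> rfl

/-- Vectors of holomorphic complex valued stem functions. -/
def VecStem (D : Set ℂ) (V : ℂ → Fin 3 → ℂ) : Prop := ∀ i, ScalarStem D (fun z => V z i)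

theorem IsHolomorphicStem.re {D : Set ℂ} {F : ℂ → ℍ[ℂ]} (h : IsHolomorphicStem D F) :
    ScalarStem D (fun z => (F z).re) :=
  ⟨fun z hz => by simp [h.symm z hz], h.holo_re⟩

theorem IsHolomorphicStem.vec {D : Set ℂ} {F : ℂ → ℍ[ℂ]} (h : IsHolomorphicStem D F) :
    VecStem D (fun z => vec (F z)) := by
  intro i
  fin_cases i
  · exact ⟨fun z hz => by simp [h.symm z hz, StarLog.vec], h.holo_imI⟩
  · exact ⟨fun z hz => by simp [h.symm z hz, StarLog.vec], h.holo_imJ⟩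
  · exact ⟨fun z hz => by simp [h.symm z hz, StarLog.vec], h.holo_imK⟩

theorem isHolomorphicStem_ofParts {D : Set ℂ} {a : ℂ → ℂ} {V : ℂ → Fin 3 → ℂ}
    (ha : ScalarStem D a) (hV : VecStem D V) :
    IsHolomorphicStem D (fun z => ofParts (a z) (V z)) where
  symm z hz := by
    ext
    · simpa using ha.symm z hz
    · simpa using (hV 0).symm z hz
    · simpa using (hV 1).symm z hz
    · simpa using (hV 2).symm z hz
  holo_re := ha.holo
  holo_imI := (hV 0).holo
  holo_imJ := (hV 1).holo
  holo_imK := (hV 2).holo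

theorem IsHolomorphicStem.congr {D : Set ℂ} (hD : ∀ z ∈ D, starRingEnd ℂ z ∈ D)
    {F G : ℂ → ℍ[ℂ]} (h : IsHolomorphicStem D F) (hFG : ∀ z ∈ D, G z = F z) :
    IsHolomorphicStem D G where
  symm z hz := by rw [hFG _ (hD z hz), hFG z hz, h.symm z hz]
  holo_re := h.holo_re.congr fun z hz => by rw [hFG z hz]
  holo_imI := h.holo_imI.congr fun z hz => by rw [hFG z hz]
  holo_imJ := h.holo_imJ.congr fun z hz => by rw [hFG z hz]
  holo_imK := h.holo_imK.congr fun z hz => by rw [hFG z hz]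

theorem IsHolomorphicStem.mono {D E : Set ℂ} (hED : E ⊆ D) {F : ℂ → ℍ[ℂ]}
    (h : IsHolomorphicStem D F) : IsHolomorphicStem E F where
  symm z hz := h.symm z (hED hz)
  holo_re := h.holo_re.mono hED
  holo_imI := h.holo_imI.mono hED
  holo_imJ := h.holo_imJ.mono hED
  holo_imK := h.holo_imK.mono hED

namespace ScalarStem

variable {D : Set ℂ} {a b : ℂ → ℂ}

theorem mono {E : Set ℂ} (h : ScalarStem D a) (hED : E ⊆ D) : ScalarStem E a :=
  ⟨fun z hz => h.symm z (hED hz), h.holo.mono hED⟩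

theorem const (D : Set ℂ) (r : ℝ) : ScalarStem D (fun _ => (r : ℂ)) :=
  ⟨fun _ _ => by simp, differentiableOn_const _⟩

theorem zero (D : Set ℂ) : ScalarStem D (fun _ => 0) := by
  simpa using const D 0

theorem add (ha : ScalarStem D a) (hb : ScalarStem D b) : ScalarStem D (fun z => a z + b z) :=
  ⟨fun z hz => by rw [ha.symm z hz, hb.symm z hz, map_add], ha.holo.add hb.holo⟩

theorem neg (ha : ScalarStem D a) : ScalarStem D (fun z => -a z) :=
  ⟨fun z hz => by rw [ha.symm z hz, map_neg], ha.holo.neg⟩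

theorem mul (ha : ScalarStem D a) (hb : ScalarStem D b) : ScalarStem D (fun z => a z * b z) :=
  ⟨fun z hz => by rw [ha.symm z hz, hb.symm z hz, map_mul], ha.holo.mul hb.holo⟩

theorem inv (ha : ScalarStem D a) (h0 : ∀ z ∈ D, a z ≠ 0) : ScalarStem D (fun z => (a z)⁻¹) :=
  ⟨fun z hz => by rw [ha.symm z hz, map_inv₀], ha.holo.inv h0⟩

theorem div (ha : ScalarStem D a) (hb : ScalarStem D b) (h0 : ∀ z ∈ D, b z ≠ 0) :
    ScalarStem D (fun z => a z / b z) := by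
  simpa [div_eq_mul_inv] using ha.mul (hb.inv h0)

/-- A stem function is real on the real axis. -/
theorem im_eq_zero (ha : ScalarStem D a) {z : ℂ} (hz : z ∈ D) (h : z.im = 0) :
    (a z).im = 0 := by
  have h1 := ha.symm z hz
  rw [Complex.conj_eq_iff_im.2 h] at h1
  exact Complex.conj_eq_iff_im.1 h1.symm

end ScalarStem

theorem VecStem.smul {D : Set ℂ} {a : ℂ → ℂ} {V : ℂ → Fin 3 → ℂ} (ha : ScalarStem D a)
    (hV : VecStem D V) : VecStem D (fun z => a z • V z) := fun i => ha.mul (hV i)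

theorem VecStem.zero (D : Set ℂ) : VecStem D (fun _ => 0) := fun _ => ScalarStem.zero D

theorem VecStem.mono {D E : Set ℂ} {V : ℂ → Fin 3 → ℂ} (h : VecStem D V) (hED : E ⊆ D) :
    VecStem E V := fun i => (h i).mono hED

/-! ### Slice functions and their stem functions -/

/-- `induced` evaluates `F` on the closed upper half plane only. Below the axis both the point and
the unit get conjugated, and the symmetry of `F` cancels the two changes. -/
theorem induces_induced {Ω : Set ℍ[ℝ]} {F : ℂ → ℍ[ℂ]}
    (hF : ∀ z ∈ trace Ω unitI, F (starRingEnd ℂ z) = involution (F z)) :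
    Induces Ω F (induced F) := by
  intro J hJ z hz
  rcases lt_trichotomy z.im 0 with h | h | h
  · have hp : (⟨(toSlice J z).re, ‖(toSlice J z).im‖⟩ : ℂ) = starRingEnd ℂ z :=
      planePoint_toSlice_of_neg hJ h
    have hu : ‖(toSlice J z).im‖⁻¹ • (toSlice J z).im = -J := by
      rw [toSlice_norm_im hJ, toSlice_im hJ, abs_of_neg h, smul_smul]
      have : (-z.im)⁻¹ * z.im = -1 := by
        rw [inv_neg, neg_mul, inv_mul_cancel₀ h.ne]
      rw [this]; simp
    rw [induced, hp, hu, hF z hz, phi_involution, neg_neg]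
  · have hp : (⟨(toSlice J z).re, ‖(toSlice J z).im‖⟩ : ℂ) = z :=
      planePoint_toSlice_of_nonneg hJ h.ge
    -- At a real point the unit used by `induced` is the default `0`; this is harmless because the
    -- second component vanishes there.
    have hi : imPart (F z) = 0 := by
      have h1 := hF z hz
      rw [Complex.conj_eq_iff_im.2 h] at h1
      ext
      · have := congrArg (fun X => X.re) h1
        simpa using Complex.conj_eq_iff_im.1 (by simpa using this.symm)
      · have := congrArg (fun X => X.imI) h1
        simpa using Complex.conj_eq_iff_im.1 (by simpa using this.symm)
      · have := congrArg (fun X => X.imJ) h1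
        simpa using Complex.conj_eq_iff_im.1 (by simpa using this.symm)
      · have := congrArg (fun X => X.imK) h1
        simpa using Complex.conj_eq_iff_im.1 (by simpa using this.symm)
    rw [induced, hp, phi, phi, hi, mul_zero, mul_zero]
  · have hp : (⟨(toSlice J z).re, ‖(toSlice J z).im‖⟩ : ℂ) = z :=
      planePoint_toSlice_of_nonneg hJ h.le
    have hu : ‖(toSlice J z).im‖⁻¹ • (toSlice J z).im = J := by
      rw [toSlice_norm_im hJ, toSlice_im hJ, abs_of_pos h, smul_smul, inv_mul_cancel₀ h.ne',
        one_smul]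
    rw [induced, hp, hu]

/-- On the slice of `i` the values at `z` and at its conjugate are `x ± i y`, so half sum and half
difference return the two components. -/
theorem stemOf_eq {Ω : Set ℍ[ℝ]} (hΩ : AxiallySymmetric Ω) {F : ℂ → ℍ[ℂ]} {f : ℍ[ℝ] → ℍ[ℝ]}
    (hF : ∀ z ∈ trace Ω unitI, F (starRingEnd ℂ z) = involution (F z))
    (hf : Induces Ω F f) {z : ℂ} (hz : z ∈ trace Ω unitI) : stemOf f z = F z := by
  have hz' := hΩ.mem_trace_conj hz
  have hI : unitI * unitI = -1 := unitI_mem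
  have h1 : f (toSlice unitI z) = rePart (F z) + unitI * imPart (F z) := hf _ unitI_mem z hz
  have h2 : f (toSlice unitI (starRingEnd ℂ z)) = rePart (F z) - unitI * imPart (F z) := by
    rw [hf _ unitI_mem _ hz', hF z hz, phi_involution, phi, neg_mul, sub_eq_add_neg]
  rw [stemOf, h1, h2]
  have e1 : (1 / 2 : ℝ) • (rePart (F z) + unitI * imPart (F z) +
      (rePart (F z) - unitI * imPart (F z))) = rePart (F z) := by
    rw [add_add_sub_cancel, ← two_smul ℝ, smul_smul]; norm_num
  have e2 : (1 / 2 : ℝ) • (-unitI * (rePart (F z) + unitI * imPart (F z) -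
      (rePart (F z) - unitI * imPart (F z)))) = imPart (F z) := by
    rw [add_sub_sub_cancel, ← two_smul ℝ, mul_smul_comm, smul_smul, ← mul_assoc, neg_mul, hI]
    norm_num
  rw [e1, e2, complexify_parts]

theorem mem_SR_of_induces {Ω : Set ℍ[ℝ]} {F : ℂ → ℍ[ℂ]} {f : ℍ[ℝ] → ℍ[ℝ]}
    (hF : IsHolomorphicStem (trace Ω unitI) F) (hf : Induces Ω F f) : f ∈ SR Ω := ⟨F, hF, hf⟩

theorem isHolomorphicStem_stemOf {Ω : Set ℍ[ℝ]} (hΩ : AxiallySymmetric Ω) {f : ℍ[ℝ] → ℍ[ℝ]}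
    (hf : f ∈ SR Ω) : IsHolomorphicStem (trace Ω unitI) (stemOf f) := by
  obtain ⟨F, hF, hi⟩ := hf
  exact hF.congr (fun z => hΩ.mem_trace_conj) fun z hz => stemOf_eq hΩ hF.symm hi hz

theorem apply_toSlice {Ω : Set ℍ[ℝ]} (hΩ : AxiallySymmetric Ω) {f : ℍ[ℝ] → ℍ[ℝ]}
    (hf : f ∈ SR Ω) {J : ℍ[ℝ]} (hJ : J ∈ unitSphere) {z : ℂ} (hz : z ∈ trace Ω unitI) :
    f (toSlice J z) = phi J (stemOf f z) := by
  obtain ⟨F, hF, hi⟩ := hf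
  rw [hi J hJ z hz, stemOf_eq hΩ hF.symm hi hz]

theorem induced_mem_SR {Ω : Set ℍ[ℝ]} {F : ℂ → ℍ[ℂ]}
    (hF : IsHolomorphicStem (trace Ω unitI) F) : induced F ∈ SR Ω :=
  ⟨F, hF, induces_induced hF.symm⟩

theorem stemOf_induced {Ω : Set ℍ[ℝ]} (hΩ : AxiallySymmetric Ω) {F : ℂ → ℍ[ℂ]}
    (hF : ∀ z ∈ trace Ω unitI, F (starRingEnd ℂ z) = involution (F z))
    {z : ℂ} (hz : z ∈ trace Ω unitI) : stemOf (induced F) z = F z :=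
  stemOf_eq hΩ hF (induces_induced hF) hz

theorem SR_mono {U V : Set ℍ[ℝ]} (h : U ⊆ V) {f : ℍ[ℝ] → ℍ[ℝ]} (hf : f ∈ SR V) : f ∈ SR U := by
  obtain ⟨F, hF, hi⟩ := hf
  have ht : trace U unitI ⊆ trace V unitI := Set.preimage_mono h
  exact ⟨F, hF.mono ht, fun J hJ z hz => hi J hJ z (ht hz)⟩

theorem forall_mem_iff_toSlice {Ω : Set ℍ[ℝ]} (hΩ : AxiallySymmetric Ω) {P : ℍ[ℝ] → Prop} :
    (∀ q ∈ Ω, P q) ↔ ∀ J ∈ unitSphere, ∀ z ∈ trace Ω unitI, P (toSlice J z) := by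
  constructor
  · intro h J hJ z hz
    exact h _ (hΩ.mem_of_mem_trace hz hJ)
  · intro h q hq
    obtain ⟨J, hJ, e⟩ := exists_toSlice_planePoint q
    rw [e]
    exact h J hJ _ (hΩ.planePoint_mem hq)

theorem inducedScalar_toSlice {Ω : Set ℍ[ℝ]} {a : ℂ → ℂ}
    (ha : ∀ z ∈ trace Ω unitI, a (starRingEnd ℂ z) = starRingEnd ℂ (a z))
    {J : ℍ[ℝ]} (hJ : J ∈ unitSphere) {z : ℂ} (hz : z ∈ trace Ω unitI) :
    inducedScalar a (toSlice J z) = toSlice J (a z) := by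
  rw [inducedScalar, induces_induced _ J hJ z hz, phi_coe]
  intro w hw
  ext <;> simp [ha w hw]

theorem comp₀_toSlice {Ω : Set ℍ[ℝ]} (hΩ : AxiallySymmetric Ω)
    {f : ℍ[ℝ] → ℍ[ℝ]} (hf : f ∈ SR Ω) {J : ℍ[ℝ]} (hJ : J ∈ unitSphere) {z : ℂ}
    (hz : z ∈ trace Ω unitI) : comp₀ f (toSlice J z) = toSlice J (stemOf f z).re :=
  inducedScalar_toSlice (isHolomorphicStem_stemOf hΩ hf).re.symm hJ hz

theorem symmetrization_toSlice {Ω : Set ℍ[ℝ]} (hΩ : AxiallySymmetric Ω)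
    {f : ℍ[ℝ] → ℍ[ℝ]} (hf : f ∈ SR Ω) {J : ℍ[ℝ]} (hJ : J ∈ unitSphere)
    {z : ℂ} (hz : z ∈ trace Ω unitI) : symmetrization f (toSlice J z) =
      toSlice J ((stemOf f z).re ^ 2 + vec (stemOf f z) ⬝ᵥ vec (stemOf f z)) := by
  have h1 : comp₁ f (toSlice J z) = toSlice J (stemOf f z).imI :=
    inducedScalar_toSlice ((isHolomorphicStem_stemOf hΩ hf).vec 0).symm hJ hz
  have h2 : comp₂ f (toSlice J z) = toSlice J (stemOf f z).imJ :=
    inducedScalar_toSlice ((isHolomorphicStem_stemOf hΩ hf).vec 1).symm hJ hz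
  have h3 : comp₃ f (toSlice J z) = toSlice J (stemOf f z).imK :=
    inducedScalar_toSlice ((isHolomorphicStem_stemOf hΩ hf).vec 2).symm hJ hz
  rw [symmetrization, comp₀_toSlice hΩ hf hJ hz, h1, h2, h3]
  simp only [← toSlice_pow hJ, ← toSlice_add]
  congr 1
  simp [vec, dotProduct, Fin.sum_univ_three]
  ring

theorem induces_vecPart {Ω : Set ℍ[ℝ]} (hΩ : AxiallySymmetric Ω)
    {f : ℍ[ℝ] → ℍ[ℝ]} (hf : f ∈ SR Ω) :
    Induces Ω (fun z => ofParts 0 (vec (stemOf f z))) (vecPart f) := by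
  intro J hJ z hz
  rw [vecPart, apply_toSlice hΩ hf hJ hz, comp₀_toSlice hΩ hf hJ hz, ← phi_coe, sub_eq_iff_eq_add,
    ← phi_add]
  congr 1
  ext <;> simp [vec]

theorem isHolomorphicStem_vecPart {Ω : Set ℍ[ℝ]} (hΩ : AxiallySymmetric Ω)
    {f : ℍ[ℝ] → ℍ[ℝ]} (hf : f ∈ SR Ω) :
    IsHolomorphicStem (trace Ω unitI) (fun z => ofParts 0 (vec (stemOf f z))) :=
  isHolomorphicStem_ofParts (ScalarStem.zero _) (isHolomorphicStem_stemOf hΩ hf).vec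

theorem stemOf_vecPart {Ω : Set ℍ[ℝ]} (hΩ : AxiallySymmetric Ω)
    {f : ℍ[ℝ] → ℍ[ℝ]} (hf : f ∈ SR Ω) {z : ℂ} (hz : z ∈ trace Ω unitI) :
    stemOf (vecPart f) z = ofParts 0 (vec (stemOf f z)) :=
  stemOf_eq hΩ (isHolomorphicStem_vecPart hΩ hf).symm (induces_vecPart hΩ hf) hz

theorem mem_SRVec_iff {Ω : Set ℍ[ℝ]} (hΩ : AxiallySymmetric Ω)
    {f : ℍ[ℝ] → ℍ[ℝ]} :
    f ∈ SRVec Ω ↔ f ∈ SR Ω ∧ ∀ z ∈ trace Ω unitI, (stemOf f z).re = 0 := by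
  refine and_congr_right fun hf => ?_
  rw [forall_mem_iff_toSlice hΩ (P := fun q => f q = vecPart f q)]
  constructor
  · intro h z hz
    have := h unitI unitI_mem z hz
    rw [vecPart, comp₀_toSlice hΩ hf unitI_mem hz] at this
    exact (toSlice_eq_zero unitI_mem).1 (sub_eq_self.1 this.symm)
  · intro h J hJ z hz
    rw [vecPart, comp₀_toSlice hΩ hf hJ hz, h z hz, toSlice_zero, sub_zero]

theorem vecPart_mem_SRVec {Ω : Set ℍ[ℝ]} (hΩ : AxiallySymmetric Ω)
    {f : ℍ[ℝ] → ℍ[ℝ]} (hf : f ∈ SR Ω) : vecPart f ∈ SRVec Ω := by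
  rw [mem_SRVec_iff hΩ]
  refine ⟨mem_SR_of_induces (isHolomorphicStem_vecPart hΩ hf) (induces_vecPart hΩ hf), ?_⟩
  intro z hz
  rw [stemOf_vecPart hΩ hf hz, ofParts_re]

/-! ### Slice-preserving functions in terms of stem functions -/

theorem mem_SRReal_of_stem {Ω : Set ℍ[ℝ]} (hΩ : AxiallySymmetric Ω)
    {f : ℍ[ℝ] → ℍ[ℝ]} (hf : f ∈ SR Ω)
    (h : ∀ z ∈ trace Ω unitI, vec (stemOf f z) = 0) : f ∈ SRReal Ω := by
  refine ⟨hf, ?_⟩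
  rintro I hI q ⟨hq, z, rfl⟩
  have hz := hΩ.mem_trace_of_mem hI hq
  rw [apply_toSlice hΩ hf hI hz]
  refine ⟨(stemOf f z).re, ?_⟩
  rw [← phi_coe]
  congr 1
  have := h z hz
  ext
  · simp
  · simpa [vec] using (congrFun this 0).symm
  · simpa [vec] using (congrFun this 1).symm
  · simpa [vec] using (congrFun this 2).symm

theorem mem_slice_of_add_sub {J a b : ℍ[ℝ]} (hJ : J ∈ unitSphere) (h1 : a + J * b ∈ slice J)
    (h2 : a - J * b ∈ slice J) : a ∈ slice J ∧ b ∈ slice J := by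
  obtain ⟨z, hz⟩ := h1
  obtain ⟨w, hw⟩ := h2
  have hJ' : J * J = -1 := hJ
  constructor
  · refine ⟨((1 / 2 : ℝ) : ℂ) * (z + w), ?_⟩
    rw [toSlice_mul hJ, toSlice_add, hz, hw, toSlice_ofReal, add_add_sub_cancel,
      Quaternion.coe_mul_eq_smul, ← two_smul ℝ, smul_smul]
    norm_num
  · refine ⟨-Complex.I * (((1 / 2 : ℝ) : ℂ) * (z + -w)), ?_⟩
    have hI : toSlice J Complex.I = J := by simp [toSlice]
    rw [toSlice_mul hJ, toSlice_mul hJ, toSlice_add, toSlice_neg, toSlice_neg, hz, hw, hI,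
      toSlice_ofReal, ← sub_eq_add_neg, add_sub_sub_cancel, ← two_smul ℝ (J * b),
      Quaternion.coe_mul_eq_smul, smul_smul, ]
    norm_num
    rw [← mul_assoc, hJ']; simp

theorem vec_eq_zero_iff_parts {X : ℍ[ℂ]} :
    vec X = 0 ↔ (rePart X).im = 0 ∧ (imPart X).im = 0 := by
  constructor
  · intro h
    have h0 : X.imI = 0 := congrFun h 0
    have h1 : X.imJ = 0 := congrFun h 1
    have h2 : X.imK = 0 := congrFun h 2
    constructor <;> ext <;> simp [h0, h1, h2]
  · rintro ⟨h1, h2⟩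
    have a1 := congrArg (fun t => t.imI) h1
    have a2 := congrArg (fun t => t.imJ) h1
    have a3 := congrArg (fun t => t.imK) h1
    have b1 := congrArg (fun t => t.imI) h2
    have b2 := congrArg (fun t => t.imJ) h2
    have b3 := congrArg (fun t => t.imK) h2
    funext i
    simp only [Quaternion.imI_im, Quaternion.imJ_im, Quaternion.imK_im, rePart_imI, rePart_imJ,
      rePart_imK, imPart_imI, imPart_imJ, imPart_imK, Quaternion.imI_zero, Quaternion.imJ_zero,
      Quaternion.imK_zero] at a1 a2 a3 b1 b2 b3
    fin_cases i <;> apply Complex.ext <;> simpa [vec]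

/-- Two different slices, here those of `i` and `j`, meet only in the real axis. -/
theorem im_eq_zero_of_mem_slices {a : ℍ[ℝ]} (h : ∀ J ∈ unitSphere, a ∈ slice J) : a.im = 0 := by
  obtain ⟨z, hz⟩ := h _ unitI_mem
  obtain ⟨w, hw⟩ := h _ unitJ_mem
  have e1 := congrArg (fun t => t.imJ) hz
  have e2 := congrArg (fun t => t.imK) hz
  have e3 := congrArg (fun t => t.imI) hw
  simp [toSlice] at e1 e2 e3
  ext <;> simp [← e1, ← e2, ← e3]

theorem mem_SRReal_iff {Ω : Set ℍ[ℝ]} (hΩ : AxiallySymmetric Ω) {f : ℍ[ℝ] → ℍ[ℝ]} :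
    f ∈ SRReal Ω ↔ f ∈ SR Ω ∧ ∀ z ∈ trace Ω unitI, vec (stemOf f z) = 0 := by
  refine ⟨fun hf => ⟨hf.1, fun z hz => ?_⟩, fun h => mem_SRReal_of_stem hΩ h.1 h.2⟩
  -- The values at `z` and at its conjugate are `x ± J y`, both in the slice of `J`; hence `x` and
  -- `y` lie in every slice.
  have key : ∀ J ∈ unitSphere, rePart (stemOf f z) ∈ slice J ∧ imPart (stemOf f z) ∈ slice J := by
    intro J hJ
    apply mem_slice_of_add_sub hJ
    · have := hf.2 J hJ _ ⟨hΩ.mem_of_mem_trace hz hJ, ⟨z, rfl⟩⟩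
      rwa [apply_toSlice hΩ hf.1 hJ hz] at this
    · have hz' := hΩ.mem_trace_conj hz
      have := hf.2 J hJ _ ⟨hΩ.mem_of_mem_trace hz' hJ, ⟨_, rfl⟩⟩
      rw [apply_toSlice hΩ hf.1 hJ hz', (isHolomorphicStem_stemOf hΩ hf.1).symm z hz,
        phi_involution, phi] at this
      simpa [sub_eq_add_neg] using this
  exact vec_eq_zero_iff_parts.2 ⟨im_eq_zero_of_mem_slices fun J hJ => (key J hJ).1,
    im_eq_zero_of_mem_slices fun J hJ => (key J hJ).2⟩

/-- The sphere over `z` contains a zero of the slice function induced by `F` exactly when the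
symmetrization of `F` vanishes at `z`. -/
theorem exists_phi_eq_zero_iff (X : ℍ[ℂ]) :
    (∃ J ∈ unitSphere, phi J X = 0) ↔ X.re ^ 2 + vec X ⬝ᵥ vec X = 0 := by
  set x := rePart X with hx
  set y := imPart X with hy
  -- For `X = x + ι y` the complex norm has real part `|x|² - |y|²` and imaginary part `2⟨x, y⟩`.
  have hN : X.re ^ 2 + vec X ⬝ᵥ vec X =
      ⟨x.re ^ 2 + x.imI ^ 2 + x.imJ ^ 2 + x.imK ^ 2 -
        (y.re ^ 2 + y.imI ^ 2 + y.imJ ^ 2 + y.imK ^ 2),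
        2 * (x.re * y.re + x.imI * y.imI + x.imJ * y.imJ + x.imK * y.imK)⟩ := by
    simp only [vec, dotProduct, Fin.sum_univ_three]
    apply Complex.ext <;> simp [hx, hy, pow_two] <;> ring
  rw [hN, Complex.ext_iff]
  simp only [Complex.zero_re, Complex.zero_im]
  constructor
  · rintro ⟨J, hJ, h⟩
    obtain ⟨hJ0, hJ1⟩ := mem_unitSphere_iff.1 hJ
    have h' : x = -(J * y) := eq_neg_of_add_eq_zero_left h
    have e0 := congrArg (fun t => t.re) h'
    have e1 := congrArg (fun t => t.imI) h'
    have e2 := congrArg (fun t => t.imJ) h'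
    have e3 := congrArg (fun t => t.imK) h'
    simp [hJ0] at e0 e1 e2 e3
    rw [e0, e1, e2, e3]
    constructor
    · linear_combination (y.re ^ 2 + y.imI ^ 2 + y.imJ ^ 2 + y.imK ^ 2) * hJ1
    · ring
  · rintro ⟨h1, h2⟩
    by_cases hy0 : y = 0
    · refine ⟨unitI, unitI_mem, ?_⟩
      have hx0 : x = 0 := by
        rw [hy0] at h1
        rw [← Quaternion.normSq_eq_zero, Quaternion.normSq_def']
        simpa using h1
      change x + unitI * y = 0
      rw [hx0, hy0]; simp
    · have hne : Quaternion.normSq y ≠ 0 := Quaternion.normSq_ne_zero.2 hy0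
      -- This is the only solution of `x + J y = 0`; it is an imaginary unit because `x` and `y` are
      -- orthogonal of equal norm.
      refine ⟨-(x * y⁻¹), ?_, ?_⟩
      · rw [mem_unitSphere_iff]
        have hre : (x * y⁻¹).re = 0 := by
          rw [Quaternion.inv_def, mul_smul_comm]
          simp only [Quaternion.re_smul, Quaternion.re_mul, Quaternion.re_star,
            Quaternion.imI_star, Quaternion.imJ_star, Quaternion.imK_star, smul_eq_mul]
          rw [show x.re * y.re - x.imI * -y.imI - x.imJ * -y.imJ - x.imK * -y.imK = 0 by linarith,
            mul_zero]
        have hn : Quaternion.normSq (x * y⁻¹) = 1 := by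
          rw [map_mul, map_inv₀]
          have : Quaternion.normSq x = Quaternion.normSq y := by
            rw [Quaternion.normSq_def', Quaternion.normSq_def']; linarith
          rw [this, mul_inv_cancel₀ hne]
        rw [Quaternion.normSq_def', hre] at hn
        refine ⟨by simp [hre], ?_⟩
        simp only [Quaternion.imI_neg, Quaternion.imJ_neg, Quaternion.imK_neg]
        linarith
      · change x + -(x * y⁻¹) * y = 0
        rw [neg_mul, mul_assoc, inv_mul_cancel₀ hy0, mul_one, add_neg_cancel]

/-! ### The `*`-exponential on the level of stem functions -/

theorem involution_mul (X Y : ℍ[ℂ]) : involution (X * Y) = involution X * involution Y := by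
  ext <;> simp

theorem involution_one : involution 1 = 1 := by
  ext <;> simp

theorem involution_pow (X : ℍ[ℂ]) (n : ℕ) : involution (X ^ n) = involution X ^ n := by
  induction n with
  | zero => simp [involution_one]
  | succ n ih => rw [pow_succ, pow_succ, involution_mul, ih]

theorem phi_one (J : ℍ[ℝ]) : phi J 1 = 1 := by
  have := phi_coe J 1
  simpa [toSlice] using this

theorem induces_starPow {Ω : Set ℍ[ℝ]} (hΩ : AxiallySymmetric Ω) {f : ℍ[ℝ] → ℍ[ℝ]}
    (hf : f ∈ SR Ω) (n : ℕ) : Induces Ω (fun z => stemOf f z ^ n) (starPow f n) := by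
  have hF := isHolomorphicStem_stemOf hΩ hf
  induction n with
  | zero => intro J hJ z hz; simp [starPow, phi_one]
  | succ n ih =>
    intro J hJ z hz
    have hsymm : ∀ n : ℕ, ∀ z ∈ trace Ω unitI,
        stemOf f (starRingEnd ℂ z) ^ n = involution (stemOf f z ^ n) := fun n z hz => by
      rw [hF.symm z hz, involution_pow]
    have hst : ∀ w ∈ trace Ω unitI, stemOf (starPow f n) w = stemOf f w ^ n := fun w hw =>
      stemOf_eq hΩ (hsymm n) ih hw
    have key : Induces Ω (fun z => stemOf f z * stemOf (starPow f n) z)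
        (induced fun z => stemOf f z * stemOf (starPow f n) z) := by
      apply induces_induced
      intro w hw
      rw [hst _ (hΩ.mem_trace_conj hw), hst w hw, hsymm n w hw, hF.symm w hw, involution_mul]
    rw [starPow, starMul, key J hJ z hz]
    simp only [hst z hz, pow_succ']

/-- Because `v² = -(v ⬝ᵥ v)`, the combinations of `1` and `v` form a commutative algebra, which
contains all powers of `a + v`. -/
theorem ofParts_smul_mul (v : Fin 3 → ℂ) (a b c d : ℂ) :
    ofParts a (b • v) * ofParts c (d • v) =
      ofParts (a * c - b * d * (v ⬝ᵥ v)) ((a * d + b * c) • v) := by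
  ext <;> simp [dotProduct, Fin.sum_univ_three] <;> ring

theorem phi_ofParts_smul {J : ℍ[ℝ]} (hJ : J ∈ unitSphere) (v : Fin 3 → ℂ) (a b : ℂ) :
    phi J (ofParts a (b • v)) = toSlice J a + toSlice J b * phi J (ofParts 0 v) := by
  rw [← phi_coe, ← phi_smul hJ, ← phi_add]
  congr 1
  ext <;> simp

theorem hasSum_complex_exp (c : ℂ) :
    HasSum (fun n : ℕ => (n ! : ℝ)⁻¹ • c ^ n) (Complex.exp c) := by
  rw [Complex.exp_eq_exp_ℂ]
  exact NormedSpace.exp_series_hasSum_exp' (𝕂 := ℝ) c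

theorem HasSum.of_eq {f g : ℕ → ℂ} {a b : ℂ} (h : HasSum f a) (hfg : ∀ n, g n = f n)
    (hab : b = a) : HasSum g b := by
  rw [hab, funext hfg]; exact h

theorem HasSum.toSlice {J : ℍ[ℝ]} (hJ : J ∈ unitSphere) {p : ℕ → ℂ} {P : ℂ}
    (h : HasSum (fun n : ℕ => (n ! : ℝ)⁻¹ • p n) P) :
    HasSum (fun n : ℕ => (n ! : ℝ)⁻¹ • StarLog.toSlice J (p n)) (StarLog.toSlice J P) := by
  have h2 := h.map (sliceHom J hJ) (by
    simpa [funext (sliceHom_apply hJ)] using continuous_toSlice J)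
  rw [sliceHom_apply] at h2
  convert h2 using 2 with n
  rw [Function.comp_apply, map_smul, sliceHom_apply]

/-- The recurrences are those of the coefficients in `(a + v)^n = p n + q n v`; the exponential thus
reduces to two complex series. -/
theorem hasSum_phi_pow_of_coeffs {J : ℍ[ℝ]} (hJ : J ∈ unitSphere) {a P Q : ℂ} {v : Fin 3 → ℂ}
    {p q : ℕ → ℂ} (hp0 : p 0 = 1) (hq0 : q 0 = 0)
    (hp : ∀ n, p (n + 1) = p n * a - q n * (v ⬝ᵥ v)) (hq : ∀ n, q (n + 1) = p n + q n * a)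
    (hP : HasSum (fun n : ℕ => (n ! : ℝ)⁻¹ • p n) P)
    (hQ : HasSum (fun n : ℕ => (n ! : ℝ)⁻¹ • q n) Q) :
    HasSum (fun n : ℕ => (n ! : ℝ)⁻¹ • phi J (ofParts a v ^ n)) (phi J (ofParts P (Q • v))) := by
  have hpow : ∀ n : ℕ, ofParts a v ^ n = ofParts (p n) (q n • v) := by
    intro n
    induction n with
    | zero => rw [hp0, hq0]; ext <;> simp
    | succ n ih =>
      have := ofParts_smul_mul v (p n) (q n) a 1
      rw [one_smul] at this
      rw [pow_succ, ih, this, hp, hq, mul_one, mul_one]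
  rw [phi_ofParts_smul hJ]
  simp only [hpow, phi_ofParts_smul hJ, smul_add, ← smul_mul_assoc]
  exact (hP.toSlice hJ).add ((hQ.toSlice hJ).mul_right _)

/-- The value of the exponential of `a + v`, `v² = -θ²`; here `s` stands for `sin θ / θ`. -/
theorem hasSum_phi_exp {J : ℍ[ℝ]} (hJ : J ∈ unitSphere) {a θ s : ℂ} {v : Fin 3 → ℂ}
    (hθ : θ ^ 2 = v ⬝ᵥ v) (hs : s * θ = Complex.sin θ) (hs0 : θ = 0 → s = 1) :
    HasSum (fun n : ℕ => (n ! : ℝ)⁻¹ • phi J (ofParts a v ^ n))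
      (phi J (ofParts (Complex.exp a * Complex.cos θ) ((Complex.exp a * s) • v))) := by
  have hI := Complex.I_sq
  by_cases h0 : θ = 0
  -- Nilpotent case `v² = 0`: `(a + v)^n = a^n + n a^(n-1) v`. The truncated exponent at `n = 0` is
  -- multiplied by `0`.
  · rw [hs0 h0, h0, Complex.cos_zero, mul_one]
    have hv : v ⬝ᵥ v = 0 := by rw [← hθ, h0]; simp
    refine hasSum_phi_pow_of_coeffs hJ (p := fun n => a ^ n) (q := fun n => n * a ^ (n - 1))
      (by simp) (by simp) (fun n => by rw [hv]; ring) (fun n => ?_) (hasSum_complex_exp a) ?_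
    · cases n with
      | zero => simp
      | succ n => push_cast; ring
    -- The term `n = 0` vanishes, and `n / n! = 1 / (n-1)!` turns the rest into the exponential
    -- series.
    · rw [← hasSum_nat_add_iff' 1]
      refine (hasSum_complex_exp a).of_eq (fun n => ?_) (by simp)
      rw [Nat.add_sub_cancel, Nat.factorial_succ]
      have : (n ! : ℂ) ≠ 0 := by exact_mod_cast n.factorial_ne_zero
      have : (n + 1 : ℂ) ≠ 0 := by exact_mod_cast n.succ_ne_zero
      simp only [Complex.real_smul]
      push_cast
      field_simp
  -- The eigenvalues of multiplication by `a + v` are `a ± iθ`; `p` and `q` are the half sum and the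
  -- difference quotient of their powers.
  · have h1 := hasSum_complex_exp (a + θ * Complex.I)
    have h2 := hasSum_complex_exp (a + -θ * Complex.I)
    rw [Complex.exp_add, Complex.exp_mul_I] at h1 h2
    rw [Complex.cos_neg, Complex.sin_neg, ← hs] at h2
    rw [← hs] at h1
    have hI0 := Complex.I_ne_zero
    refine hasSum_phi_pow_of_coeffs hJ
      (p := fun n => ((a + θ * Complex.I) ^ n + (a + -θ * Complex.I) ^ n) * (1 / 2))
      (q := fun n => ((a + θ * Complex.I) ^ n - (a + -θ * Complex.I) ^ n) *
        (1 / (2 * θ * Complex.I)))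
      (by norm_num) (by simp) (fun n => ?_) (fun n => ?_) ?_ ?_
    · rw [← hθ]
      field_simp
      ring_nf
      rw [hI]
      ring
    · field_simp
      ring
    · refine ((h1.add h2).mul_right (1 / 2)).of_eq (fun n => ?_) (by ring)
      simp only [Complex.real_smul]
      ring
    · refine ((h1.sub h2).mul_right (1 / (2 * θ * Complex.I))).of_eq (fun n => ?_) ?_
      · simp only [Complex.real_smul]
        ring
      · field_simp
        ring

/-- The root `θ` may be chosen separately at each point, with no continuity, since only the even
functions `cos θ` and `sin θ / θ` enter. -/
theorem isStarLog_of_stem {Ω : Set ℍ[ℝ]} (hΩ : AxiallySymmetric Ω) {f g : ℍ[ℝ] → ℍ[ℝ]}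
    (hf : f ∈ SR Ω) (hg : g ∈ SR Ω)
    (h : ∀ z ∈ trace Ω unitI, ∃ θ s : ℂ, θ ^ 2 = vec (stemOf f z) ⬝ᵥ vec (stemOf f z) ∧
      s * θ = Complex.sin θ ∧ (θ = 0 → s = 1) ∧
      (stemOf g z).re = Complex.exp (stemOf f z).re * Complex.cos θ ∧
      vec (stemOf g z) = (Complex.exp (stemOf f z).re * s) • vec (stemOf f z)) :
    IsStarLog Ω f g := by
  rw [IsStarLog, forall_mem_iff_toSlice hΩ]
  intro J hJ z hz
  obtain ⟨θ, s, h1, h2, h3, h4, h5⟩ := h z hz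
  have := hasSum_phi_exp hJ (a := (stemOf f z).re) h1 h2 h3
  rw [← h4, ← h5, ofParts_vec, ofParts_vec] at this
  rw [apply_toSlice hΩ hg hJ hz]
  convert this using 2 with n
  rw [induces_starPow hΩ hf n J hJ z hz]

/-- The `*`-exponential of a slice-preserving function. -/
theorem IsStarLog.eq_toSlice_exp {Ω : Set ℍ[ℝ]} (hΩ : AxiallySymmetric Ω) {f g : ℍ[ℝ] → ℍ[ℝ]}
    (hf : f ∈ SRReal Ω) (h : IsStarLog Ω f g) {J : ℍ[ℝ]} (hJ : J ∈ unitSphere) {z : ℂ}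
    (hz : z ∈ trace Ω unitI) : g (toSlice J z) = toSlice J (Complex.exp (stemOf f z).re) := by
  obtain ⟨hf1, hf2⟩ := (mem_SRReal_iff hΩ).1 hf
  refine (h _ (hΩ.mem_of_mem_trace hz hJ)).unique ?_
  convert (hasSum_complex_exp (stemOf f z).re).toSlice hJ using 3 with n
  rw [induces_starPow hΩ hf1 n J hJ z hz]
  have : stemOf f z = ((stemOf f z).re : ℍ[ℂ]) := by
    have h0 := hf2 z hz
    conv_lhs => rw [← ofParts_vec (stemOf f z), h0]
    ext <;> simp
  change phi J (stemOf f z ^ n) = _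
  rw [this, ← phi_coe]
  simp

/-! ### Topology of axially symmetric domains -/

/-- Normalisation maps the connected space `ℝ³ ∖ {0}` onto the sphere. -/
theorem isConnected_unitSphere : IsConnected unitSphere := by
  have hrank : 1 < Module.rank ℝ (Fin 3 → ℝ) := by
    rw [rank_fin_fun]; exact_mod_cast (by norm_num : 1 < 3)
  have hc := isConnected_compl_singleton_of_one_lt_rank hrank (0 : Fin 3 → ℝ)
  let unitK : ℍ[ℝ] := ⟨0, 0, 0, 1⟩
  let Q : (Fin 3 → ℝ) → ℍ[ℝ] := fun v => v 0 • unitI + v 1 • unitJ + v 2 • unitK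
  have hre : ∀ v, (Q v).re = 0 := fun v => by simp [Q, show unitK.re = 0 from rfl]
  have hI : ∀ v, (Q v).imI = v 0 := fun v => by simp [Q, show unitK.imI = 0 from rfl]
  have hJ : ∀ v, (Q v).imJ = v 1 := fun v => by simp [Q, show unitK.imJ = 0 from rfl]
  have hK : ∀ v, (Q v).imK = v 2 := fun v => by simp [Q, show unitK.imK = 1 from rfl]
  have him : ∀ v, (Q v).im = Q v := fun v => by ext <;> simp [hre]
  have hQ0 : ∀ v, v ≠ 0 → Q v ≠ 0 := by
    intro v hv h
    apply hv
    funext i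
    fin_cases i
    · simpa [hI] using congrArg (fun t => t.imI) h
    · simpa [hJ] using congrArg (fun t => t.imJ) h
    · simpa [hK] using congrArg (fun t => t.imK) h
  have hQc : Continuous Q := by fun_prop
  have himage : unitSphere = (fun v => ‖Q v‖⁻¹ • Q v) '' {0}ᶜ := by
    apply Set.Subset.antisymm
    · intro J hJ'
      refine ⟨![J.imI, J.imJ, J.imK], ?_, ?_⟩
      · intro h
        have h0 := congrFun h 0
        have h1 := congrFun h 1
        have h2 := congrFun h 2
        simp at h0 h1 h2
        have := (mem_unitSphere_iff.1 hJ').2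
        rw [h0, h1, h2] at this
        norm_num at this
      · have e : Q ![J.imI, J.imJ, J.imK] = J := by
          ext
          · rw [hre, (mem_unitSphere_iff.1 hJ').1]
          · simp [hI]
          · simp [hJ]
          · simp [hK]
        simp [e, norm_unit hJ']
    · rintro _ ⟨v, hv, rfl⟩
      have := unit_of_im_ne_zero (v := Q v) (by rw [him]; exact hQ0 v hv)
      rwa [him] at this
  rw [himage]
  refine hc.image _ ?_
  refine ContinuousOn.smul (ContinuousOn.inv₀ hQc.norm.continuousOn ?_) hQc.continuousOn
  intro v hv
  exact norm_ne_zero_iff.2 (hQ0 v hv)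

/-- Supplies a second unit arbitrarily close to a given one; values for two units determine both
components of a stem function. -/
theorem accPt_unitSphere {J : ℍ[ℝ]} (hJ : J ∈ unitSphere) :
    AccPt J (Filter.principal unitSphere) := by
  refine isConnected_unitSphere.isPreconnected.preperfect_of_nontrivial
    ⟨unitI, unitI_mem, unitJ, unitJ_mem, ?_⟩ J hJ
  intro h
  simpa using congrArg (fun t => t.imI) h

theorem continuous_uncurry_toSlice :
    Continuous (fun p : ℂ × ℍ[ℝ] => toSlice p.2 p.1) := by
  unfold toSlice
  have := Quaternion.continuous_coe
  fun_prop

theorem axiallySymmetric_preimage_planePoint (N : Set ℂ) :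
    AxiallySymmetric (planePoint ⁻¹' N) := by
  intro z I hI h J hJ
  rw [Set.mem_preimage, planePoint_toSlice hJ]
  rwa [Set.mem_preimage, planePoint_toSlice hI] at h

theorem AxiallySymmetric.mem_of_planePoint_mem {Ω : Set ℍ[ℝ]} (hΩ : AxiallySymmetric Ω) {q : ℍ[ℝ]}
    (hq : planePoint q ∈ trace Ω unitI) : q ∈ Ω := by
  obtain ⟨J, hJ, e⟩ := exists_toSlice_planePoint q
  rw [e]
  exact hΩ.mem_of_mem_trace hq hJ

/-- Every point has a fundamental system of axially symmetric domains. -/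
theorem exists_axialDomain {q : ℍ[ℝ]} {N : Set ℂ} (hN : N ∈ 𝓝 (planePoint q)) :
    ∃ V, IsAxialDomain V ∧ q ∈ V ∧ ∀ q' ∈ V, planePoint q' ∈ N := by
  obtain ⟨ε, hε, hb⟩ := Metric.mem_nhds_iff.1 hN
  obtain ⟨J, hJ, hq⟩ := exists_toSlice_planePoint q
  rcases (planePoint_im_nonneg q).eq_or_lt with h | h
  · refine ⟨planePoint ⁻¹' Metric.ball (planePoint q) ε,
      ⟨Metric.isOpen_ball.preimage continuous_planePoint, ?_,
        axiallySymmetric_preimage_planePoint _⟩, Metric.mem_ball_self hε, fun q' hq' => hb hq'⟩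
    -- `planePoint` preserves distances to a real centre, so the preimage of a disc is a ball, which
    -- is convex.
    have : planePoint ⁻¹' Metric.ball (planePoint q) ε = Metric.ball q ε := by
      ext q'
      rw [Set.mem_preimage, Metric.mem_ball, Metric.mem_ball]
      have hq0 : q.im = 0 := norm_eq_zero.1 h.symm
      have h0 : q.imI = 0 ∧ q.imJ = 0 ∧ q.imK = 0 := by
        refine ⟨?_, ?_, ?_⟩
        · simpa using congrArg (fun t => t.imI) hq0
        · simpa using congrArg (fun t => t.imJ) hq0
        · simpa using congrArg (fun t => t.imK) hq0
      have : dist (planePoint q') (planePoint q) = dist q' q := by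
        rw [dist_eq_norm, dist_eq_norm]
        rw [← sq_eq_sq₀ (norm_nonneg _) (norm_nonneg _), ← Complex.normSq_eq_norm_sq,
          pow_two ‖q' - q‖, ← Quaternion.normSq_eq_norm_mul_self, Complex.normSq_apply,
          Quaternion.normSq_def']
        have hn : ‖q'.im‖ * ‖q'.im‖ = q'.imI ^ 2 + q'.imJ ^ 2 + q'.imK ^ 2 := by
          rw [← Quaternion.normSq_eq_norm_mul_self, Quaternion.normSq_def']; simp
        simp [planePoint, hq0, h0, hn]
        ring
      rw [this]
    rw [this]
    exact (convex_ball q ε).isConnected ⟨q, Metric.mem_ball_self hε⟩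
  -- The cap by the height of the centre keeps the disc off the real axis; its preimage is then the
  -- image of disc times sphere, hence connected.
  · set δ := min ε (planePoint q).im with hδ
    have hδ0 : 0 < δ := lt_min hε h
    have hpos : ∀ w ∈ Metric.ball (planePoint q) δ, 0 < w.im := by
      intro w hw
      have h1 : ‖w - planePoint q‖ < (planePoint q).im :=
        (mem_ball_iff_norm.1 hw).trans_le (min_le_right _ _)
      have h2 := (Complex.abs_im_le_norm (w - planePoint q)).trans_lt h1
      rw [Complex.sub_im, abs_lt] at h2
      linarith [h2.1]
    refine ⟨planePoint ⁻¹' Metric.ball (planePoint q) δ,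
      ⟨Metric.isOpen_ball.preimage continuous_planePoint, ?_,
        axiallySymmetric_preimage_planePoint _⟩, Metric.mem_ball_self hδ0, fun q' hq' => hb ?_⟩
    · have : planePoint ⁻¹' Metric.ball (planePoint q) δ =
          (fun p : ℂ × ℍ[ℝ] => toSlice p.2 p.1) '' (Metric.ball (planePoint q) δ ×ˢ unitSphere) := by
        apply Set.Subset.antisymm
        · intro q' hq'
          obtain ⟨J', hJ', e⟩ := exists_toSlice_planePoint q'
          exact ⟨(planePoint q', J'), ⟨hq', hJ'⟩, e.symm⟩
        · rintro _ ⟨⟨w, J'⟩, ⟨hw, hJ'⟩, rfl⟩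
          rw [Set.mem_preimage, planePoint_toSlice_of_nonneg hJ' (hpos w hw).le]
          exact hw
      rw [this]
      exact (((convex_ball _ _).isConnected ⟨_, Metric.mem_ball_self hδ0⟩).prod
        isConnected_unitSphere).image _ continuous_uncurry_toSlice.continuousOn
    · exact Metric.ball_subset_ball (min_le_left _ _) hq'

/-- The part of the trace in the closed upper half plane is preconnected. -/
theorem IsAxialDomain.isPreconnected_planePoint {Ω : Set ℍ[ℝ]} (hΩ : IsAxialDomain Ω) :
    IsPreconnected (planePoint '' Ω) :=
  hΩ.isConnected.isPreconnected.image _ continuous_planePoint.continuousOn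

theorem AxiallySymmetric.planePoint_image_subset {Ω : Set ℍ[ℝ]} (hΩ : AxiallySymmetric Ω) :
    planePoint '' Ω ⊆ trace Ω unitI := by
  rintro _ ⟨q, hq, rfl⟩
  exact hΩ.planePoint_mem hq

theorem mem_planePoint_image {Ω : Set ℍ[ℝ]} {z : ℂ}
    (hz : z ∈ trace Ω unitI) (h : 0 ≤ z.im) : z ∈ planePoint '' Ω :=
  ⟨toSlice unitI z, hz, planePoint_toSlice_of_nonneg unitI_mem h⟩

/-- A property of the points of the trace that is invariant under conjugation holds everywhere if
it holds on the closed upper half plane. -/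
theorem AxiallySymmetric.trace_induction {Ω : Set ℍ[ℝ]} (hΩ : AxiallySymmetric Ω) {P : ℂ → Prop}
    (h : ∀ z ∈ planePoint '' Ω, P z) (hconj : ∀ z ∈ trace Ω unitI, P z → P (starRingEnd ℂ z))
    {z : ℂ} (hz : z ∈ trace Ω unitI) : P z := by
  rcases le_or_gt 0 z.im with h0 | h0
  · exact h z (mem_planePoint_image hz h0)
  · have hz' := hΩ.mem_trace_conj hz
    have := hconj _ hz' (h _ (mem_planePoint_image hz' (by simpa using h0.le)))
    simpa using this

theorem eventually_conj {P : ℂ → Prop} {z : ℂ} (h : ∀ᶠ w in 𝓝 z, P w) :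
    ∀ᶠ w in 𝓝 (starRingEnd ℂ z), P (starRingEnd ℂ w) := by
  have hc : Filter.Tendsto (starRingEnd ℂ) (𝓝 (starRingEnd ℂ z)) (𝓝 z) := by
    have := Complex.continuous_conj.tendsto (starRingEnd ℂ z)
    rwa [Complex.conj_conj] at this
  exact hc.eventually h

/-- The identity theorem for scalar stem functions. -/
theorem ScalarStem.eq_zero {Ω : Set ℍ[ℝ]} (hΩ : IsAxialDomain Ω) {a : ℂ → ℂ}
    (ha : ScalarStem (trace Ω unitI) a) {z₀ : ℂ} (hz₀ : z₀ ∈ trace Ω unitI)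
    (h : ∀ᶠ z in 𝓝 z₀, a z = 0) {z : ℂ} (hz : z ∈ trace Ω unitI) : a z = 0 := by
  have hD := isOpen_trace hΩ.isOpen unitI
  have hs := hΩ.axiallySymmetric
  -- The trace is disconnected when `Ω` misses the real axis. Its part in the closed upper half
  -- plane is always preconnected, so the identity theorem is applied there and carried over by
  -- conjugation.
  have han : AnalyticOnNhd ℂ a (planePoint '' Ω) :=
    (ha.holo.analyticOnNhd hD).mono hs.planePoint_image_subset
  have main : ∀ w ∈ planePoint '' Ω, (∀ᶠ z in 𝓝 w, a z = 0) → ∀ z ∈ planePoint '' Ω, a z = 0 :=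
    fun w hw h0 z hz => han.eqOn_zero_of_preconnected_of_eventuallyEq_zero
      hΩ.isPreconnected_planePoint hw h0 hz
  have hall : ∀ z ∈ planePoint '' Ω, a z = 0 := by
    rcases le_or_gt 0 z₀.im with h0 | h0
    · exact main z₀ (mem_planePoint_image hz₀ h0) h
    · have hz' := hs.mem_trace_conj hz₀
      refine main _ (mem_planePoint_image hz' (by simpa using h0.le)) ?_
      filter_upwards [eventually_conj h, hD.mem_nhds hz'] with w hw hwD
      rw [ha.symm w hwD] at hw
      simpa using hw
  refine hs.trace_induction hall (fun w hw h0 => ?_) hz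
  rw [ha.symm w hw, h0, map_zero]

/-- The two values differ by `(J' - J)` times the second component, and `ℍ` has no zero divisors. -/
theorem phi_eq_zero_of_two {J J' : ℍ[ℝ]} (hne : J' ≠ J) {X : ℍ[ℂ]} (h : phi J X = 0)
    (h' : phi J' X = 0) : X = 0 := by
  have h1 : (J' - J) * imPart X = 0 := by
    have : phi J' X - phi J X = 0 := by rw [h, h', sub_zero]
    rw [phi, phi, add_sub_add_left_eq_sub, ← sub_mul] at this
    exact this
  have h2 : imPart X = 0 := (mul_eq_zero.1 h1).resolve_left (sub_ne_zero.2 hne)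
  have h3 : rePart X = 0 := by simpa [phi, h2] using h
  rw [← complexify_parts X, h2, h3]
  ext <;> apply Complex.ext <;> simp

/-- A slice-regular function vanishes near `p` exactly when its stem function vanishes near the
point of the plane that corresponds to `p`. -/
theorem eventually_eq_zero_iff {U : Set ℍ[ℝ]} (hU : IsOpen U) (hs : AxiallySymmetric U)
    {f : ℍ[ℝ] → ℍ[ℝ]} (hf : f ∈ SR U) {p : ℍ[ℝ]} (hp : p ∈ U) :
    (∀ᶠ q in 𝓝 p, f q = 0) ↔ ∀ᶠ z in 𝓝 (planePoint p), stemOf f z = 0 := by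
  constructor
  · intro h
    obtain ⟨J, hJ, e⟩ := exists_toSlice_planePoint p
    have hc : Filter.Tendsto (fun p : ℂ × ℍ[ℝ] => toSlice p.2 p.1) (𝓝 (planePoint p) ×ˢ 𝓝 J)
        (𝓝 p) := by
      have := continuous_uncurry_toSlice.tendsto (planePoint p, J)
      rw [nhds_prod_eq] at this
      simpa only [← e] using this
    obtain ⟨A, hA, B, hB, hAB⟩ := Filter.mem_prod_iff.1 (hc h)
    -- A neighbourhood of `p` contains nearby plane points for `J` and also for some other unit
    -- `J'`, which kills the whole stem value.
    obtain ⟨J', ⟨hJ'B, hJ'S⟩, hne⟩ := accPt_iff_nhds.1 (accPt_unitSphere hJ) B hB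
    filter_upwards [hA, (isOpen_trace hU unitI).mem_nhds (hs.planePoint_mem hp)] with z hzA hzD
    refine phi_eq_zero_of_two hne ?_ ?_
    · rw [← apply_toSlice hs hf hJ hzD]
      exact hAB (Set.mk_mem_prod hzA (mem_of_mem_nhds hB))
    · rw [← apply_toSlice hs hf hJ'S hzD]
      exact hAB (Set.mk_mem_prod hzA hJ'B)
  · intro h
    filter_upwards [continuous_planePoint.continuousAt.eventually h, hU.mem_nhds hp] with q hq hqU
    obtain ⟨J, hJ, e⟩ := exists_toSlice_planePoint q
    rw [e, apply_toSlice hs hf hJ (hs.planePoint_mem hqU), hq, phi_zero]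

/-! ### Parallel vectors -/

/-- Parallel vectors of `ℂ³`. -/
def Par (v w : Fin 3 → ℂ) : Prop := ∀ i j, v i * w j = v j * w i

theorem Par.refl (v : Fin 3 → ℂ) : Par v v := fun _ _ => mul_comm _ _

theorem Par.symm {v w : Fin 3 → ℂ} (h : Par v w) : Par w v := fun i j => by
  linear_combination -(h i j)

theorem Par.zero_left (v : Fin 3 → ℂ) : Par 0 v := fun i j => by simp

theorem Par.smul_left {v w : Fin 3 → ℂ} (h : Par v w) (c : ℂ) : Par (c • v) w := fun i j => by
  simp only [Pi.smul_apply, smul_eq_mul, mul_assoc, h i j]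

/-- The middle vector must be nonzero, as `0` is parallel to everything. Multiplying by the square
of one of its nonzero coordinates avoids division. -/
theorem Par.trans {u v w : Fin 3 → ℂ} (h : Par u v) (h' : Par v w) (hv : v ≠ 0) : Par u w := by
  obtain ⟨i, hi⟩ := Function.ne_iff.1 hv
  have hi' : v i ≠ 0 := hi
  intro j k
  apply mul_left_cancel₀ (mul_ne_zero hi' hi')
  linear_combination (v i * w k) * h j i + (u i * v j) * h' i k - (v i * w j) * h k i -
    (u i * v k) * h' i j

theorem Par.exists_smul {v w : Fin 3 → ℂ} (h : Par v w) (hw : w ≠ 0) : ∃ c : ℂ, v = c • w := by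
  obtain ⟨i, hi⟩ := Function.ne_iff.1 hw
  have hi' : w i ≠ 0 := hi
  refine ⟨v i / w i, funext fun j => ?_⟩
  rw [Pi.smul_apply, smul_eq_mul, div_mul_eq_mul_div, eq_div_iff hi']
  exact h j i

theorem Par.conj {v w : Fin 3 → ℂ} (h : Par v w) : Par (star v) (star w) := fun i j => by
  simp only [Pi.star_apply, ← star_mul', h i j]

theorem VecStem.conj {D : Set ℂ} {V : ℂ → Fin 3 → ℂ} (h : VecStem D V) {z : ℂ} (hz : z ∈ D) :
    V (starRingEnd ℂ z) = star (V z) := funext fun i => (h i).symm z hz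

theorem VecStem.analyticAt {D : Set ℂ} (hD : IsOpen D) {V : ℂ → Fin 3 → ℂ} (h : VecStem D V)
    {z : ℂ} (hz : z ∈ D) (i : Fin 3) : AnalyticAt ℂ (fun w => V w i) z :=
  (h i).holo.analyticAt (hD.mem_nhds hz)

theorem eventually_of_eventually_ne {a b : ℂ → ℂ} {z : ℂ} (ha : AnalyticAt ℂ a z)
    (hb : AnalyticAt ℂ b z) (h : ∀ᶠ w in 𝓝[≠] z, a w = b w) : ∀ᶠ w in 𝓝 z, a w = b w :=
  (ha.frequently_eq_iff_eventually_eq hb).1 h.frequently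

/-- Parallelism of analytic vectors extends to isolated points. -/
theorem eventually_par_of_eventually_ne {V W : ℂ → Fin 3 → ℂ} {z : ℂ}
    (hV : ∀ i, AnalyticAt ℂ (fun w => V w i) z) (hW : ∀ i, AnalyticAt ℂ (fun w => W w i) z)
    (h : ∀ᶠ w in 𝓝[≠] z, Par (V w) (W w)) : ∀ᶠ w in 𝓝 z, Par (V w) (W w) := by
  simp only [Par, Filter.eventually_all] at h ⊢
  exact fun i j => eventually_of_eventually_ne ((hV i).mul (hW j)) ((hV j).mul (hW i)) (h i j)

/-- Each coordinate either vanishes near `z` or has no further zeros near `z`; not all of them can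
be of the first kind. -/
theorem eventually_ne_zero_vec {V : ℂ → Fin 3 → ℂ} {z : ℂ}
    (hV : ∀ i, AnalyticAt ℂ (fun w => V w i) z) (h : ¬ ∀ᶠ w in 𝓝 z, V w = 0) :
    ∃ i, ∀ᶠ w in 𝓝[≠] z, V w i ≠ 0 := by
  by_contra hne
  push Not at hne
  apply h
  have : ∀ i, ∀ᶠ w in 𝓝 z, V w i = 0 := fun i =>
    (hV i).eventually_eq_zero_or_eventually_ne_zero.resolve_right (hne i)
  filter_upwards [Filter.eventually_all.2 this] with w hw
  exact funext hw

/-- Pointwise transitivity can fail only at zeros of `V`. Near `z` these are isolated, and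
parallelism of analytic vectors extends over them. -/
theorem eventually_par_trans {U V W : ℂ → Fin 3 → ℂ} {z : ℂ}
    (hU : ∀ i, AnalyticAt ℂ (fun w => U w i) z) (hV : ∀ i, AnalyticAt ℂ (fun w => V w i) z)
    (hW : ∀ i, AnalyticAt ℂ (fun w => W w i) z) (h0 : ¬ ∀ᶠ w in 𝓝 z, V w = 0)
    (h : ∀ᶠ w in 𝓝 z, Par (U w) (V w)) (h' : ∀ᶠ w in 𝓝 z, Par (V w) (W w)) :
    ∀ᶠ w in 𝓝 z, Par (U w) (W w) := by
  obtain ⟨i, hi⟩ := eventually_ne_zero_vec hV h0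
  apply eventually_par_of_eventually_ne hU hW
  filter_upwards [hi, h.filter_mono nhdsWithin_le_nhds, h'.filter_mono nhdsWithin_le_nhds]
    with w hw h1 h2
  exact h1.trans h2 fun h3 => hw (by rw [h3]; rfl)

/-! ### Vectorial functions -/

section SRVec

variable {U : Set ℍ[ℝ]} {f : ℍ[ℝ] → ℍ[ℝ]}

theorem vecStem_of_mem (hs : AxiallySymmetric U) (hf : f ∈ SR U) :
    VecStem (trace U unitI) (fun z => vec (stemOf f z)) :=
  (isHolomorphicStem_stemOf hs hf).vec

theorem stemOf_eq_ofParts (hs : AxiallySymmetric U) (hf : f ∈ SRVec U) {z : ℂ}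
    (hz : z ∈ trace U unitI) : stemOf f z = ofParts 0 (vec (stemOf f z)) := by
  rw [← ((mem_SRVec_iff hs).1 hf).2 z hz, ofParts_vec]

theorem stemOf_eq_zero_iff (hs : AxiallySymmetric U) (hf : f ∈ SRVec U) {z : ℂ}
    (hz : z ∈ trace U unitI) : stemOf f z = 0 ↔ vec (stemOf f z) = 0 := by
  refine ⟨fun h => by rw [h, vec_zero], fun h => ?_⟩
  rw [stemOf_eq_ofParts hs hf hz, h]
  ext <;> simp

theorem SRVec_mono {V : Set ℍ[ℝ]} (hs : AxiallySymmetric U) (hsV : AxiallySymmetric V)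
    (hVU : V ⊆ U) (hf : f ∈ SRVec U) : f ∈ SRVec V :=
  (mem_SRVec_iff hsV).2 ⟨SR_mono hVU hf.1, fun z hz =>
    ((mem_SRVec_iff hs).1 hf).2 z (hVU hz)⟩

/-- The vectorial function with given coordinates. -/
def ofVec (V : ℂ → Fin 3 → ℂ) : ℍ[ℝ] → ℍ[ℝ] := induced (fun z => ofParts 0 (V z))

theorem isHolomorphicStem_ofVec {D : Set ℂ} {V : ℂ → Fin 3 → ℂ} (hV : VecStem D V) :
    IsHolomorphicStem D (fun z => ofParts 0 (V z)) :=
  isHolomorphicStem_ofParts (ScalarStem.zero _) hV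

theorem stemOf_ofVec (hs : AxiallySymmetric U) {V : ℂ → Fin 3 → ℂ}
    (hV : VecStem (trace U unitI) V) {z : ℂ} (hz : z ∈ trace U unitI) :
    stemOf (ofVec V) z = ofParts 0 (V z) :=
  stemOf_induced hs (isHolomorphicStem_ofVec hV).symm hz

theorem ofVec_mem (hs : AxiallySymmetric U) {V : ℂ → Fin 3 → ℂ}
    (hV : VecStem (trace U unitI) V) : ofVec V ∈ SRVec U :=
  (mem_SRVec_iff hs).2 ⟨induced_mem_SR (isHolomorphicStem_ofVec hV), fun z hz => by
    rw [stemOf_ofVec hs hV hz, ofParts_re]⟩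

theorem zero_mem_SRVec (hs : AxiallySymmetric U) : (0 : ℍ[ℝ] → ℍ[ℝ]) ∈ SRVec U := by
  have h := ofVec_mem hs (VecStem.zero (trace U unitI))
  have : ofVec (fun _ => 0) = 0 := by
    funext q
    have h0 : ofParts 0 0 = 0 := by ext <;> simp
    simp only [ofVec, induced, h0, phi_zero, Pi.zero_apply]
  rwa [this] at h

theorem stemOf_zero (z : ℂ) : stemOf 0 z = 0 := by
  ext <;> apply Complex.ext <;> simp [stemOf]

theorem inducedScalar_mem (hs : AxiallySymmetric U) {a : ℂ → ℂ}
    (ha : ScalarStem (trace U unitI) a) : inducedScalar a ∈ SRReal U := by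
  have hF : IsHolomorphicStem (trace U unitI) (fun z => (a z : ℍ[ℂ])) := by
    have := isHolomorphicStem_ofParts ha (VecStem.zero _)
    convert this using 1
    funext z
    ext <;> simp
  refine (mem_SRReal_iff hs).2 ⟨induced_mem_SR hF, fun z hz => ?_⟩
  rw [inducedScalar, stemOf_induced hs hF.symm hz]
  funext i
  fin_cases i <;> simp [vec]

end SRVec

/-- The stem function of `f` vanishes identically near the point of the plane over `p`. -/
def GermZero (p : ℍ[ℝ]) (f : ℍ[ℝ] → ℍ[ℝ]) : Prop :=
  ∀ᶠ z in 𝓝 (planePoint p), vec (stemOf f z) = 0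

/-- The vectors of `f` and `g` are parallel near the point of the plane over `p`. -/
def GermPar (p : ℍ[ℝ]) (f g : ℍ[ℝ] → ℍ[ℝ]) : Prop :=
  ∀ᶠ z in 𝓝 (planePoint p), Par (vec (stemOf f z)) (vec (stemOf g z))

/-- `f` is a vectorial function near `p`. -/
def IsVecAt (p : ℍ[ℝ]) (f : ℍ[ℝ] → ℍ[ℝ]) : Prop :=
  ∃ U, IsOpen U ∧ AxiallySymmetric U ∧ p ∈ U ∧ f ∈ SRVec U

theorem IsVecAt.analyticAt {p : ℍ[ℝ]} {f : ℍ[ℝ] → ℍ[ℝ]} (h : IsVecAt p f) (i : Fin 3) :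
    AnalyticAt ℂ (fun w => vec (stemOf f w) i) (planePoint p) := by
  obtain ⟨U, hU, hs, hp, hf⟩ := h
  exact (vecStem_of_mem hs hf.1).analyticAt (isOpen_trace hU _) (hs.planePoint_mem hp) i

theorem eventually_eq_zero_iff_germZero {p : ℍ[ℝ]} {f : ℍ[ℝ] → ℍ[ℝ]} (h : IsVecAt p f) :
    (∀ᶠ q in 𝓝 p, f q = 0) ↔ GermZero p f := by
  obtain ⟨U, hU, hs, hp, hf⟩ := h
  rw [eventually_eq_zero_iff hU hs hf.1 hp]
  refine Filter.eventually_congr ?_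
  filter_upwards [(isOpen_trace hU unitI).mem_nhds (hs.planePoint_mem hp)] with z hz
  exact stemOf_eq_zero_iff hs hf hz

theorem GermPar.symm {p : ℍ[ℝ]} {f g : ℍ[ℝ] → ℍ[ℝ]} (h : GermPar p f g) : GermPar p g f :=
  h.mono fun _ hz => hz.symm

theorem GermZero.par_left {p : ℍ[ℝ]} {f : ℍ[ℝ] → ℍ[ℝ]} (g : ℍ[ℝ] → ℍ[ℝ]) (h : GermZero p f) :
    GermPar p f g := h.mono fun z hz => by rw [hz]; exact Par.zero_left _

/-- Equality of germs of vectorial functions up to slice-preserving factors. -/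
structure GermEquiv (p : ℍ[ℝ]) (f g : ℍ[ℝ] → ℍ[ℝ]) : Prop where
  left : IsVecAt p f
  right : IsVecAt p g
  par : GermPar p f g
  zero_iff : GermZero p f ↔ GermZero p g

theorem GermEquiv.symm {p : ℍ[ℝ]} {f g : ℍ[ℝ] → ℍ[ℝ]} (h : GermEquiv p f g) : GermEquiv p g f :=
  ⟨h.right, h.left, h.par.symm, h.zero_iff.symm⟩

theorem GermEquiv.trans {p : ℍ[ℝ]} {f g k : ℍ[ℝ] → ℍ[ℝ]} (h : GermEquiv p f g)
    (h' : GermEquiv p g k) : GermEquiv p f k := by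
  refine ⟨h.left, h'.right, ?_, h.zero_iff.trans h'.zero_iff⟩
  by_cases h0 : GermZero p g
  · exact (h.zero_iff.2 h0).par_left k
  · exact eventually_par_trans h.left.analyticAt h.right.analyticAt h'.right.analyticAt h0 h.par
      h'.par

theorem exists_axialDomain_subset {U : Set ℍ[ℝ]} (hU : IsOpen U) (hs : AxiallySymmetric U)
    {p : ℍ[ℝ]} (hp : p ∈ U) {N : Set ℂ} (hN : N ∈ 𝓝 (planePoint p)) :
    ∃ V, IsAxialDomain V ∧ p ∈ V ∧ V ⊆ U ∧ ∀ q ∈ V, planePoint q ∈ N := by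
  obtain ⟨V, hV, hpV, h⟩ := exists_axialDomain
    (Filter.inter_mem hN ((isOpen_trace hU unitI).mem_nhds (hs.planePoint_mem hp)))
  exact ⟨V, hV, hpV, fun q hq => hs.mem_of_planePoint_mem (h q hq).2, fun q hq => (h q hq).1⟩

/-- A relation between stem functions that holds near `p`. -/
theorem linDep_stem {V : Set ℍ[ℝ]} (hs : AxiallySymmetric V) {f g a b : ℍ[ℝ] → ℍ[ℝ]}
    (hf : f ∈ SR V) (hg : g ∈ SR V) (ha : a ∈ SRReal V) (hb : b ∈ SRReal V) :
    (∀ q ∈ V, a q * f q + b q * g q = 0) ↔ ∀ z ∈ trace V unitI,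
      (stemOf a z).re • stemOf f z + (stemOf b z).re • stemOf g z = 0 := by
  have hval : ∀ {a : ℍ[ℝ] → ℍ[ℝ]}, a ∈ SRReal V → ∀ J ∈ unitSphere, ∀ z ∈ trace V unitI,
      a (toSlice J z) = toSlice J (stemOf a z).re := by
    intro a ha J hJ z hz
    rw [apply_toSlice hs ha.1 hJ hz, ← phi_coe]
    congr 1
    have := ((mem_SRReal_iff hs).1 ha).2 z hz
    conv_lhs => rw [← ofParts_vec (stemOf a z), this]
    ext <;> simp
  have key : ∀ J ∈ unitSphere, ∀ z ∈ trace V unitI, a (toSlice J z) * f (toSlice J z) +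
      b (toSlice J z) * g (toSlice J z) =
      phi J ((stemOf a z).re • stemOf f z + (stemOf b z).re • stemOf g z) := by
    intro J hJ z hz
    rw [phi_add, phi_smul hJ, phi_smul hJ, hval ha J hJ z hz, hval hb J hJ z hz,
      apply_toSlice hs hf hJ hz, apply_toSlice hs hg hJ hz]
  rw [forall_mem_iff_toSlice hs]
  constructor
  · intro h z hz
    apply eq_of_phi_eq unitI_mem
    · rw [← key _ unitI_mem z hz, h _ unitI_mem z hz, phi_zero]
    · rw [← key _ (neg_mem_unitSphere unitI_mem) z hz, h _ (neg_mem_unitSphere unitI_mem) z hz,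
        phi_zero]
  · intro h J hJ z hz
    rw [key J hJ z hz, h z hz, phi_zero]

/-- Where `a ≠ 0` the vector `V` is a multiple of `W`; near `z` the zeros of `a` are isolated. -/
theorem eventually_par_of_linDep {V W : ℂ → Fin 3 → ℂ} {a b : ℂ → ℂ} {z : ℂ}
    (hV : ∀ i, AnalyticAt ℂ (fun w => V w i) z) (hW : ∀ i, AnalyticAt ℂ (fun w => W w i) z)
    (ha : AnalyticAt ℂ a z) (h0 : ¬ ∀ᶠ w in 𝓝 z, a w = 0)
    (h : ∀ᶠ w in 𝓝 z, a w • V w + b w • W w = 0) : ∀ᶠ w in 𝓝 z, Par (V w) (W w) := by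
  apply eventually_par_of_eventually_ne hV hW
  filter_upwards [ha.eventually_eq_zero_or_eventually_ne_zero.resolve_left h0,
    h.filter_mono nhdsWithin_le_nhds] with w hw hw'
  intro i j
  apply mul_left_cancel₀ hw
  have hi : a w * V w i + b w * W w i = 0 := congrFun hw' i
  have hj : a w * V w j + b w * W w j = 0 := congrFun hw' j
  linear_combination W w j * hi - W w i * hj

theorem vec_smul_add (a b : ℂ) (X Y : ℍ[ℂ]) : vec (a • X + b • Y) = a • vec X + b • vec Y := by
  funext i
  fin_cases i <;> simp [vec]

/-- By the identity theorem a coefficient that is nonzero somewhere on the domain is not identically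
zero near `p`, so linear dependence gives parallelism at `p`. -/
theorem germEquiv_of_vecEquiv {p : ℍ[ℝ]} {f g : ℍ[ℝ] → ℍ[ℝ]} (h : VecEquiv p f g) :
    GermEquiv p f g := by
  obtain ⟨V, hV, hp, hf, hg, ⟨a, ha, b, hb, hne, hab⟩, hz⟩ := h
  have hs := hV.axiallySymmetric
  have hf' : IsVecAt p f := ⟨V, hV.isOpen, hs, hp, hf⟩
  have hg' : IsVecAt p g := ⟨V, hV.isOpen, hs, hp, hg⟩
  rw [eventually_eq_zero_iff_germZero hf', eventually_eq_zero_iff_germZero hg'] at hz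
  refine ⟨hf', hg', ?_, hz⟩
  have hpD := hs.planePoint_mem hp
  have hD := isOpen_trace hV.isOpen unitI
  have hrel : ∀ᶠ z in 𝓝 (planePoint p), (stemOf a z).re • vec (stemOf f z) +
      (stemOf b z).re • vec (stemOf g z) = 0 := by
    filter_upwards [hD.mem_nhds hpD] with z hzD
    rw [← vec_smul_add, (linDep_stem hs hf.1 hg.1 ha hb).1 hab z hzD, vec_zero]
  have hnz : ∀ {a : ℍ[ℝ] → ℍ[ℝ]}, a ∈ SRReal V → (∃ q ∈ V, a q ≠ 0) →
      AnalyticAt ℂ (fun z => (stemOf a z).re) (planePoint p) ∧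
      ¬ ∀ᶠ z in 𝓝 (planePoint p), (stemOf a z).re = 0 := by
    intro a ha ⟨q, hq, hq0⟩
    have hst := (isHolomorphicStem_stemOf hs ha.1).re
    refine ⟨hst.holo.analyticAt (hD.mem_nhds hpD), fun h0 => hq0 ?_⟩
    obtain ⟨J, hJ, e⟩ := exists_toSlice_planePoint q
    have hqD := hs.planePoint_mem hq
    rw [e, apply_toSlice hs ha.1 hJ hqD, ← ofParts_vec (stemOf a _),
      ((mem_SRReal_iff hs).1 ha).2 _ hqD, hst.eq_zero hV hpD h0 hqD]
    convert phi_zero J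
    ext <;> simp
  rcases hne with hne | hne
  · obtain ⟨h1, h2⟩ := hnz ha hne
    exact eventually_par_of_linDep hf'.analyticAt hg'.analyticAt h1 h2 hrel
  · obtain ⟨h1, h2⟩ := hnz hb hne
    refine GermPar.symm (eventually_par_of_linDep hg'.analyticAt hf'.analyticAt h1 h2
      (b := fun z => (stemOf a z).re) ?_)
    filter_upwards [hrel] with z hz
    rw [add_comm, hz]

theorem one_mem_SRReal {V : Set ℍ[ℝ]} (hs : AxiallySymmetric V) :
    (fun _ => 1 : ℍ[ℝ] → ℍ[ℝ]) ∈ SRReal V := by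
  have h := inducedScalar_mem hs (ScalarStem.const (trace V unitI) 1)
  have : inducedScalar (fun _ => ((1 : ℝ) : ℂ)) = fun _ => 1 := by
    funext q
    simp [inducedScalar, induced, phi_one]
  rwa [this] at h

theorem VecStem.par_trace {V : Set ℍ[ℝ]} (hs : AxiallySymmetric V) {F G : ℂ → Fin 3 → ℂ}
    (hF : VecStem (trace V unitI) F) (hG : VecStem (trace V unitI) G)
    (h : ∀ q ∈ V, Par (F (planePoint q)) (G (planePoint q))) {z : ℂ}
    (hz : z ∈ trace V unitI) : Par (F z) (G z) := by
  refine hs.trace_induction (P := fun z => Par (F z) (G z)) ?_ (fun w hw h0 => ?_) hz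
  · rintro _ ⟨q, hq, rfl⟩
    exact h q hq
  · rw [hF.conj hw, hG.conj hw]
    exact h0.conj

theorem vecEquiv_of_germEquiv {p : ℍ[ℝ]} {f g : ℍ[ℝ] → ℍ[ℝ]} (h : GermEquiv p f g) :
    VecEquiv p f g := by
  obtain ⟨⟨U, hU, hsU, hpU, hf⟩, ⟨U', hU', hsU', hpU', hg⟩, hpar, hz⟩ := id h
  have hz' := hz
  rw [← eventually_eq_zero_iff_germZero h.left, ← eventually_eq_zero_iff_germZero h.right] at hz'
  have hsI : AxiallySymmetric (U ∩ U') := fun z I hI hz J hJ =>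
    ⟨hsU z I hI hz.1 J hJ, hsU' z I hI hz.2 J hJ⟩
  by_cases h0 : GermZero p f
  -- If `f` vanishes near `p`, the coefficients `1` and `0` give a dependence.
  · obtain ⟨V, hV, hpV, hVU, hVN⟩ := exists_axialDomain_subset (hU.inter hU') hsI ⟨hpU, hpU'⟩ h0
    have hs := hV.axiallySymmetric
    have hfV := SRVec_mono hsU hs (hVU.trans Set.inter_subset_left) hf
    have hgV := SRVec_mono hsU' hs (hVU.trans Set.inter_subset_right) hg
    have h1 := one_mem_SRReal hs
    refine ⟨V, hV, hpV, hfV, hgV, ⟨_, h1, 0, ?_, Or.inl ⟨p, hpV, one_ne_zero⟩, ?_⟩, hz'⟩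
    · exact (mem_SRReal_iff hs).2 ⟨(zero_mem_SRVec hs).1, fun z _ => by
        rw [stemOf_zero, vec_zero]⟩
    · intro q hq
      obtain ⟨J, hJ, e⟩ := exists_toSlice_planePoint q
      have hqD := hs.planePoint_mem hq
      have hqz : stemOf f (planePoint q) = 0 := (stemOf_eq_zero_iff hs hfV hqD).2 (hVN q hq)
      have : f q = 0 := by
        conv_lhs => rw [e, apply_toSlice hs hfV.1 hJ hqD, hqz, phi_zero]
      simp [this]
  · obtain ⟨V, hV, hpV, hVU, hVN⟩ := exists_axialDomain_subset (hU.inter hU') hsI ⟨hpU, hpU'⟩ hpar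
    have hs := hV.axiallySymmetric
    have hfV := SRVec_mono hsU hs (hVU.trans Set.inter_subset_left) hf
    have hgV := SRVec_mono hsU' hs (hVU.trans Set.inter_subset_right) hg
    have hD := isOpen_trace hV.isOpen unitI
    have hFs := vecStem_of_mem hs hfV.1
    have hGs := vecStem_of_mem hs hgV.1
    have hparV : ∀ z ∈ trace V unitI, Par (vec (stemOf f z)) (vec (stemOf g z)) :=
      fun z hz => hFs.par_trace hs hGs hVN hz
    obtain ⟨i, hi⟩ := eventually_ne_zero_vec h.left.analyticAt h0
    have hDn : ∀ᶠ z in 𝓝[≠] planePoint p, z ∈ trace V unitI :=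
      nhdsWithin_le_nhds (hD.mem_nhds (hs.planePoint_mem hpV))
    obtain ⟨z₀, hz₀, hz₀D⟩ := (hi.and hDn).exists
    -- Parallelism reads `g_i f - f_i g = 0`. The coefficients `g_i` and `-f_i` are stem functions,
    -- and `f_i` is nonzero at `z₀`.
    have hA := hGs i
    have hB := (hFs i).neg
    have e1 : ∀ {a : ℂ → ℂ}, ScalarStem (trace V unitI) a → ∀ z ∈ trace V unitI,
        (stemOf (inducedScalar a) z).re = a z := by
      intro a ha z hz
      rw [inducedScalar, stemOf_induced hs _ hz]
      · simp
      · intro w hw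
        ext <;> simp [ha.symm w hw]
    refine ⟨V, hV, hpV, hfV, hgV, ⟨_, inducedScalar_mem hs hA, _, inducedScalar_mem hs hB,
      Or.inr ⟨toSlice unitI z₀, hz₀D, ?_⟩, ?_⟩, hz'⟩
    · rw [inducedScalar_toSlice hB.symm unitI_mem hz₀D, Ne, toSlice_eq_zero unitI_mem, neg_eq_zero]
      exact hz₀
    · rw [linDep_stem hs hfV.1 hgV.1 (inducedScalar_mem hs hA) (inducedScalar_mem hs hB)]
      intro z hz
      rw [e1 hA z hz, e1 hB z hz, stemOf_eq_ofParts hs hfV hz, stemOf_eq_ofParts hs hgV hz]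
      have hp' := hparV z hz
      ext
      · simp
      · have := hp' i 0; simp; linear_combination -this
      · have := hp' i 1; simp; linear_combination -this
      · have := hp' i 2; simp; linear_combination -this

/-- `VecEquiv p` relates only functions that are vectorial near `p`, whereas `Quot` uses the
equivalence relation generated on all functions; this accounts for the alternative `f = g`. -/
theorem eq_or_germEquiv_of_vecClass_eq {p : ℍ[ℝ]} {f g : ℍ[ℝ] → ℍ[ℝ]}
    (h : vecClass p f = vecClass p g) : f = g ∨ GermEquiv p f g := by
  have h' : Relation.EqvGen (VecEquiv p) f g := Quot.eqvGen_exact h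
  induction h' with
  | rel x y hxy => exact Or.inr (germEquiv_of_vecEquiv hxy)
  | refl x => exact Or.inl rfl
  | symm x y _ ih =>
    rcases ih (Quot.eqvGen_sound ‹_›) with ih | ih
    · exact Or.inl ih.symm
    · exact Or.inr ih.symm
  | trans x y z h1 h2 ih1 ih2 =>
    rcases ih1 (Quot.eqvGen_sound h1) with rfl | ih1
    · exact ih2 (Quot.eqvGen_sound h2)
    · rcases ih2 (Quot.eqvGen_sound h2) with rfl | ih2
      · exact Or.inr ih1
      · exact Or.inr (ih1.trans ih2)

/-- Equality of the classes at `p` in terms of stem functions. -/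
theorem vecClass_eq_iff {p : ℍ[ℝ]} {f g : ℍ[ℝ] → ℍ[ℝ]} (hf : IsVecAt p f) (hg : IsVecAt p g) :
    vecClass p f = vecClass p g ↔ GermPar p f g ∧ (GermZero p f ↔ GermZero p g) := by
  constructor
  · intro h
    rcases eq_or_germEquiv_of_vecClass_eq h with rfl | h
    · exact ⟨Filter.Eventually.of_forall fun z => Par.refl _, Iff.rfl⟩
    · exact ⟨h.par, h.zero_iff⟩
  · rintro ⟨h1, h2⟩
    exact Quot.sound (vecEquiv_of_germEquiv ⟨hf, hg, h1, h2⟩)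

theorem germZero_zero (p : ℍ[ℝ]) : GermZero p 0 :=
  Filter.Eventually.of_forall fun z => by rw [stemOf_zero, vec_zero]

theorem axiallySymmetric_univ : AxiallySymmetric (Set.univ : Set ℍ[ℝ]) :=
  fun _ _ _ _ _ _ => Set.mem_univ _

theorem isVecAt_zero (p : ℍ[ℝ]) : IsVecAt p 0 :=
  ⟨Set.univ, isOpen_univ, axiallySymmetric_univ, Set.mem_univ _,
    zero_mem_SRVec axiallySymmetric_univ⟩

theorem vecClass_eq_zero_iff {p : ℍ[ℝ]} {f : ℍ[ℝ] → ℍ[ℝ]} (hf : IsVecAt p f) :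
    vecClass p f = vecClass p 0 ↔ GermZero p f := by
  rw [vecClass_eq_iff hf (isVecAt_zero p)]
  exact ⟨fun h => h.2.2 (germZero_zero p), fun h => ⟨h.par_left 0, fun _ => germZero_zero p,
    fun _ => h⟩⟩

/-! ### Local representatives of vectorial classes -/

theorem IsVecAt.of_mem {V : Set ℍ[ℝ]} (hV : IsAxialDomain V) {f : ℍ[ℝ] → ℍ[ℝ]} (hf : f ∈ SRVec V)
    {p : ℍ[ℝ]} (hp : p ∈ V) : IsVecAt p f := ⟨V, hV.isOpen, hV.axiallySymmetric, hp, hf⟩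

theorem GermZero.vec_eq_zero {V : Set ℍ[ℝ]} (hV : IsAxialDomain V) {f : ℍ[ℝ] → ℍ[ℝ]}
    (hf : f ∈ SR V) {p : ℍ[ℝ]} (hp : p ∈ V) (h : GermZero p f) {z : ℂ}
    (hz : z ∈ trace V unitI) : vec (stemOf f z) = 0 := by
  have hs := hV.axiallySymmetric
  funext i
  refine (vecStem_of_mem hs hf i).eq_zero hV (hs.planePoint_mem hp) ?_ hz
  filter_upwards [h] with w hw
  rw [hw]; rfl

theorem GermZero.of_mem {V : Set ℍ[ℝ]} (hV : IsAxialDomain V) {f : ℍ[ℝ] → ℍ[ℝ]}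
    (hf : f ∈ SR V) {p q : ℍ[ℝ]} (hp : p ∈ V) (hq : q ∈ V) (h : GermZero p f) :
    GermZero q f := by
  filter_upwards [(isOpen_trace hV.isOpen unitI).mem_nhds
    (hV.axiallySymmetric.planePoint_mem hq)] with z hz
  exact h.vec_eq_zero hV hf hp hz

namespace VectorialClass

variable {Ω : Set ℍ[ℝ]}

/-- The class at a nearby `q` has a representative of its own, and compatibility with the one chosen
at `p` identifies the two at `q`. -/
theorem exists_local_rep (hΩ : IsAxialDomain Ω) (ω : VectorialClass Ω) {p : ℍ[ℝ]} (hp : p ∈ Ω) :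
    ∃ (V : Set ℍ[ℝ]) (f : ℍ[ℝ] → ℍ[ℝ]) (hVΩ : V ⊆ Ω), IsAxialDomain V ∧ p ∈ V ∧ f ∈ SRVec V ∧
      ∀ q (hq : q ∈ V), ω.classAt q (hVΩ hq) = vecClass q f := by
  have main : ∀ q (hq : q ∈ Ω), ∃ (V : Set ℍ[ℝ]) (f : ℍ[ℝ] → ℍ[ℝ]), V ⊆ Ω ∧ IsAxialDomain V ∧
      q ∈ V ∧ f ∈ SRVec V ∧ ω.classAt q hq = vecClass q f := by
    intro q hq
    obtain ⟨U, hU, hs, hqU, f, hf, hc⟩ := ω.mem q hq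
    have hsI : AxiallySymmetric (U ∩ Ω) := fun z I hI hz J hJ =>
      ⟨hs z I hI hz.1 J hJ, hΩ.axiallySymmetric z I hI hz.2 J hJ⟩
    obtain ⟨V, hV, hqV, hVU, -⟩ := exists_axialDomain_subset (hU.inter hΩ.isOpen) hsI ⟨hqU, hq⟩
      Filter.univ_mem
    exact ⟨V, f, hVU.trans Set.inter_subset_right, hV, hqV,
      SRVec_mono hs hV.axiallySymmetric (hVU.trans Set.inter_subset_left) hf, hc⟩
  obtain ⟨V, f, hVΩ, hV, hpV, hf, hc⟩ := main p hp
  refine ⟨V, f, hVΩ, hV, hpV, hf, fun q hq => ?_⟩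
  obtain ⟨W, k, hWΩ, hW, hqW, hk, hck⟩ := main q (hVΩ hq)
  rw [hck]
  exact (ω.compatible p hp q (hVΩ hq) V W f k hV hVΩ hpV hf hc hW hWΩ hqW hk hck q
    ⟨hq, hqW⟩).symm

/-- Being the zero class is locally constant, by the identity theorem for a local representative,
and `Ω` is connected. -/
theorem classAt_ne_zero (hΩ : IsAxialDomain Ω) (ω : VectorialClass Ω) (h : ¬ ω.IsZero) {p : ℍ[ℝ]}
    (hp : p ∈ Ω) : ω.classAt p hp ≠ vecClass p 0 := by
  intro h0
  apply h
  intro q hq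
  have key : (∃ h : p ∈ Ω, ω.classAt p h = vecClass p 0) ↔
      (∃ h : q ∈ Ω, ω.classAt q h = vecClass q 0) := by
    refine hΩ.isConnected.isPreconnected.induction₂ (fun p q =>
      (∃ h : p ∈ Ω, ω.classAt p h = vecClass p 0) ↔
      (∃ h : q ∈ Ω, ω.classAt q h = vecClass q 0)) ?_ ?_ ?_ hp hq
    · intro x hx
      obtain ⟨V, f, hVΩ, hV, hxV, hf, hc⟩ := ω.exists_local_rep hΩ hx
      filter_upwards [nhdsWithin_le_nhds (hV.isOpen.mem_nhds hxV)] with y hy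
      have e : ∀ x ∈ V, (∃ h : x ∈ Ω, ω.classAt x h = vecClass x 0) ↔ GermZero x f := by
        intro x hx
        rw [← vecClass_eq_zero_iff (IsVecAt.of_mem hV hf hx), ← hc x hx]
        exact ⟨fun ⟨_, h⟩ => h, fun h => ⟨_, h⟩⟩
      rw [e x hxV, e y hy]
      exact ⟨fun h => h.of_mem hV hf.1 hxV hy, fun h => h.of_mem hV hf.1 hy hxV⟩
    · intro x y z _ _ _ h1 h2
      exact h1.trans h2
    · intro x y _ _ h1
      exact h1.symm
  exact (key.1 ⟨hp, h0⟩).2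

end VectorialClass

/-! ### Division by common zeros -/

/-- An analytic vector is a power of `z - z₀` times a vector that does not vanish at `z₀`. -/
theorem exists_factor_vec {V : ℂ → Fin 3 → ℂ} {z₀ : ℂ}
    (hV : ∀ i, AnalyticAt ℂ (fun w => V w i) z₀) (h : ¬ ∀ᶠ w in 𝓝 z₀, V w = 0) :
    ∃ (n : ℕ) (W : ℂ → Fin 3 → ℂ), (∀ i, AnalyticAt ℂ (fun w => W w i) z₀) ∧ (∃ i, W z₀ i ≠ 0) ∧
      ∀ᶠ w in 𝓝 z₀, V w = (w - z₀) ^ n • W w := by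
  have hord : ∀ i, (∀ᶠ w in 𝓝 z₀, V w i = 0) ∨ ∃ (n : ℕ) (k : ℂ → ℂ), AnalyticAt ℂ k z₀ ∧
      k z₀ ≠ 0 ∧ ∀ᶠ w in 𝓝 z₀, V w i = (w - z₀) ^ n • k w := by
    intro i
    by_cases h0 : ∀ᶠ w in 𝓝 z₀, V w i = 0
    · exact Or.inl h0
    · exact Or.inr ((hV i).exists_eventuallyEq_pow_smul_nonzero_iff.2 h0)
  -- `P n` says that some coordinate vanishes to order exactly `n`; the smallest such power divides
  -- all coordinates.
  let P : ℕ → Prop := fun n => ∃ (i : Fin 3) (k : ℂ → ℂ), AnalyticAt ℂ k z₀ ∧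
      k z₀ ≠ 0 ∧ ∀ᶠ w in 𝓝 z₀, V w i = (w - z₀) ^ n • k w
  have hP : ∃ n, P n := by
    by_contra hne
    apply h
    have : ∀ i, ∀ᶠ w in 𝓝 z₀, V w i = 0 := fun i =>
      (hord i).resolve_right fun ⟨n, k, h'⟩ => hne ⟨n, i, k, h'⟩
    filter_upwards [Filter.eventually_all.2 this] with w hw
    exact funext hw
  classical
  obtain ⟨i₀, k₀, hk₀, hk₀0, hk₀V⟩ := Nat.find_spec hP
  set n := Nat.find hP with hn
  have hW : ∀ i, ∃ k : ℂ → ℂ, AnalyticAt ℂ k z₀ ∧ (i = i₀ → k z₀ ≠ 0) ∧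
      ∀ᶠ w in 𝓝 z₀, V w i = (w - z₀) ^ n * k w := by
    intro i
    by_cases hi : i = i₀
    · subst hi
      exact ⟨k₀, hk₀, fun _ => hk₀0, hk₀V⟩
    · rcases hord i with h0 | ⟨m, k, hk, hk0, hkV⟩
      · exact ⟨fun _ => 0, analyticAt_const, fun h => absurd h hi, by simpa using h0⟩
      · have hnm : n ≤ m := Nat.find_min' hP ⟨i, k, hk, hk0, hkV⟩
        refine ⟨fun w => (w - z₀) ^ (m - n) * k w, by fun_prop, fun h => absurd h hi, ?_⟩
        filter_upwards [hkV] with w hw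
        rw [hw, smul_eq_mul, ← mul_assoc, ← pow_add, Nat.add_sub_cancel' hnm]
  choose k hk hk0 hkV using hW
  refine ⟨n, fun w i => k i w, hk, ⟨i₀, hk0 i₀ rfl⟩, ?_⟩
  filter_upwards [Filter.eventually_all.2 hkV] with w hw
  exact funext hw

theorem differentiableAt_conj_conj {a : ℂ → ℂ} {z : ℂ}
    (h : DifferentiableAt ℂ a (starRingEnd ℂ z)) :
    DifferentiableAt ℂ (fun w => starRingEnd ℂ (a (starRingEnd ℂ w))) z :=
  differentiableAt_conj_conj_iff.2 h

/-! ### Reflection -/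

/-- The extension of a function on the upper half plane by reflection. -/
def reflect (h : ℂ → ℂ) (z : ℂ) : ℂ :=
  if 0 < z.im then h z else starRingEnd ℂ (h (starRingEnd ℂ z))

theorem reflect_of_pos (h : ℂ → ℂ) {z : ℂ} (hz : 0 < z.im) : reflect h z = h z := if_pos hz

theorem reflect_of_neg (h : ℂ → ℂ) {z : ℂ} (hz : z.im < 0) :
    reflect h z = starRingEnd ℂ (h (starRingEnd ℂ z)) := if_neg hz.le.not_gt

theorem scalarStem_reflect {D : Set ℂ} (hr : ∀ z ∈ D, z.im ≠ 0)
    (hD : ∀ z ∈ D, starRingEnd ℂ z ∈ D) {h : ℂ → ℂ}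
    (hh : ∀ z ∈ D, 0 < z.im → DifferentiableAt ℂ h z) : ScalarStem D (reflect h) := by
  constructor
  · intro z hz
    rcases (hr z hz).lt_or_gt with h0 | h0
    · rw [reflect_of_neg h h0, reflect_of_pos h (by simpa using h0), Complex.conj_conj]
    · rw [reflect_of_pos h h0, reflect_of_neg h (by simpa using h0), Complex.conj_conj]
  · intro z hz
    apply DifferentiableAt.differentiableWithinAt
    rcases (hr z hz).lt_or_gt with h0 | h0
    · have h1 := differentiableAt_conj_conj (hh _ (hD z hz) (by simpa using h0))
      refine h1.congr_of_eventuallyEq ?_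
      filter_upwards [(isOpen_lt Complex.continuous_im continuous_const).mem_nhds h0] with w hw
      exact reflect_of_neg h hw
    · refine (hh z hz h0).congr_of_eventuallyEq ?_
      filter_upwards [(isOpen_lt continuous_const Complex.continuous_im).mem_nhds h0] with w hw
      exact reflect_of_pos h hw

/-! ### Local minimal representatives -/

theorem trace_subset_of_planePoint {V : Set ℍ[ℝ]} {N : Set ℂ}
    (h : ∀ q ∈ V, planePoint q ∈ N) {z : ℂ} (hz : z ∈ trace V unitI) :
    (⟨z.re, |z.im|⟩ : ℂ) ∈ N := by
  have := h _ hz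
  rwa [planePoint_toSlice unitI_mem] at this

/-- Near a point where a vectorial function does not vanish identically, it is parallel to a
nowhere vanishing vector. -/
theorem exists_nonvanishing_par {p : ℍ[ℝ]} {f : ℍ[ℝ] → ℍ[ℝ]} {U : Set ℍ[ℝ]}
    (hU : IsAxialDomain U) (hp : p ∈ U) (hf : f ∈ SRVec U) (h0 : ¬ GermZero p f) :
    ∃ (V : Set ℍ[ℝ]) (W : ℂ → Fin 3 → ℂ), IsAxialDomain V ∧ p ∈ V ∧ V ⊆ U ∧
      VecStem (trace V unitI) W ∧ ∀ z ∈ trace V unitI, W z ≠ 0 ∧ Par (W z) (vec (stemOf f z)) := by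
  have hsU := hU.axiallySymmetric
  have hD := isOpen_trace hU.isOpen unitI
  have hpD := hsU.planePoint_mem hp
  have hF := vecStem_of_mem hsU hf.1
  obtain ⟨n, h, hh, ⟨i₀, hi₀⟩, hfac⟩ :=
    exists_factor_vec (IsVecAt.of_mem hU hf hp).analyticAt h0
  set z₀ := planePoint p with hz₀
  have hgood : ∀ᶠ z in 𝓝 z₀, (∀ i, AnalyticAt ℂ (fun w => h w i) z) ∧ h z i₀ ≠ 0 ∧
      vec (stemOf f z) = (z - z₀) ^ n • h z ∧ z ∈ trace U unitI :=
    (Filter.eventually_all.2 fun i => (hh i).eventually_analyticAt).and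
      (((hh i₀).continuousAt.eventually_ne hi₀).and (hfac.and (hD.mem_nhds hpD)))
  rcases (planePoint_im_nonneg p).eq_or_lt with hre | him
  -- For a real centre `(z - z₀)^n` is itself symmetric under conjugation, hence so is the quotient
  -- vector, at `z₀` by continuity.
  · have hreal : starRingEnd ℂ z₀ = z₀ := Complex.conj_eq_iff_im.2 hre.symm
    obtain ⟨ε, hε, hb⟩ := Metric.eventually_nhds_iff_ball.1 hgood
    have hbc : ∀ z ∈ Metric.ball z₀ ε, starRingEnd ℂ z ∈ Metric.ball z₀ ε := by
      intro z hz
      rw [Metric.mem_ball, ← hreal, Complex.dist_conj_conj]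
      exact hz
    have hsym : ∀ z ∈ Metric.ball z₀ ε, h (starRingEnd ℂ z) = star (h z) := by
      have hne : ∀ z ∈ Metric.ball z₀ ε, z ≠ z₀ → h (starRingEnd ℂ z) = star (h z) := by
        intro z hz hzne
        have h1 := (hb z hz).2.2.1
        have h2 := (hb _ (hbc z hz)).2.2.1
        have h3 : vec (stemOf f (starRingEnd ℂ z)) = star (vec (stemOf f z)) :=
          hF.conj (hb z hz).2.2.2
        rw [h1, h2] at h3
        have hu : starRingEnd ℂ z - z₀ ≠ 0 := by
          intro h'
          apply hzne
          rw [← hreal, ← map_sub, map_eq_zero] at h'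
          exact sub_eq_zero.1 h'
        funext i
        have h4 := congrFun h3 i
        simp only [Pi.smul_apply, smul_eq_mul, Pi.star_apply, star_mul', star_pow] at h4
        have h5 : star (z - z₀) = starRingEnd ℂ z - z₀ := by
          conv_rhs => rw [← hreal]
          rw [← map_sub]; rfl
        rw [h5] at h4
        exact mul_left_cancel₀ (pow_ne_zero n hu) h4
      intro z hz
      by_cases hzz : z = z₀
      · subst hzz
        funext i
        have c1 : ContinuousAt (fun w => h (starRingEnd ℂ w) i) z₀ := by
          have : ContinuousAt (fun w => h w i) (starRingEnd ℂ z₀) := by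
            rw [hreal]; exact (hh i).continuousAt
          exact this.comp Complex.continuous_conj.continuousAt
        have c2 : ContinuousAt (fun w => star (h w i)) z₀ := (hh i).continuousAt.star
        have : (fun w => h (starRingEnd ℂ w) i) =ᶠ[𝓝[≠] z₀] fun w => star (h w i) := by
          filter_upwards [self_mem_nhdsWithin, nhdsWithin_le_nhds (Metric.ball_mem_nhds z₀ hε)]
            with w hw hwb
          rw [hne w hwb hw]; rfl
        exact ((c1.eventuallyEq_nhds_iff_eventuallyEq_nhdsNE c2).1 this).eq_of_nhds
      · exact hne z hz hzz
    obtain ⟨V, hV, hpV, hVU, hVN⟩ := exists_axialDomain_subset hU.isOpen hsU hp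
      (Metric.ball_mem_nhds z₀ hε)
    have htr : ∀ z ∈ trace V unitI, z ∈ Metric.ball z₀ ε := by
      intro z hz
      have hz' := trace_subset_of_planePoint hVN hz
      rcases le_or_gt 0 z.im with h1 | h1
      · rwa [abs_of_nonneg h1] at hz'
      · rw [abs_of_neg h1] at hz'
        have := hbc _ hz'
        convert this using 1
        apply Complex.ext <;> simp
    refine ⟨V, h, hV, hpV, hVU, fun i => ⟨fun z hz => ?_, fun z hz => ?_⟩, fun z hz => ⟨?_, ?_⟩⟩
    · rw [hsym z (htr z hz)]; rfl
    · exact ((hb z (htr z hz)).1 i).differentiableAt.differentiableWithinAt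
    · exact fun h' => (hb z (htr z hz)).2.1 (by rw [h']; rfl)
    · rw [(hb z (htr z hz)).2.2.1]
      exact ((Par.refl _).smul_left _).symm
  -- Off the axis `(z - z₀)^n` has no such symmetry. The quotient is kept in the upper half plane
  -- and reflected to the lower one, where it remains parallel to the symmetric vector of `f`.
  · have hN := hgood.and ((isOpen_lt continuous_const Complex.continuous_im).mem_nhds him)
    obtain ⟨V, hV, hpV, hVU, hVN⟩ := exists_axialDomain_subset hU.isOpen hsU hp hN
    have hsV := hV.axiallySymmetric
    have htr := fun {z : ℂ} (hz : z ∈ trace V unitI) => trace_subset_of_planePoint hVN hz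
    have hne : ∀ z ∈ trace V unitI, z.im ≠ 0 := by
      intro z hz h'
      have := (htr hz).2
      simp [h'] at this
    have hpos : ∀ z ∈ trace V unitI, 0 < z.im → (∀ i, AnalyticAt ℂ (fun w => h w i) z) ∧
        h z i₀ ≠ 0 ∧ vec (stemOf f z) = (z - z₀) ^ n • h z := by
      intro z hz hz0
      have := (htr hz).1
      rw [abs_of_pos hz0] at this
      exact ⟨this.1, this.2.1, this.2.2.1⟩
    have hW : VecStem (trace V unitI) (fun z i => reflect (fun w => h w i) z) := fun i =>
      scalarStem_reflect hne (fun z hz => hsV.mem_trace_conj hz) fun z hz h1 =>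
        ((hpos z hz h1).1 i).differentiableAt
    have hFV : VecStem (trace V unitI) (fun z => vec (stemOf f z)) :=
      hF.mono (Set.preimage_mono hVU)
    have hval : ∀ z, 0 < z.im → (fun i => reflect (fun w => h w i) z) = h z := fun z hz =>
      funext fun i => reflect_of_pos _ hz
    have hppos : ∀ q ∈ V, 0 < (planePoint q).im := fun q hq =>
      (planePoint_im_nonneg q).lt_of_ne (hne _ (hsV.planePoint_mem hq)).symm
    refine ⟨V, _, hV, hpV, hVU, hW, fun z hz => ⟨?_, hW.par_trace hsV hFV (fun q hq => ?_) hz⟩⟩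
    · refine hsV.trace_induction (P := fun z => (fun i => reflect (fun w => h w i) z) ≠ 0) ?_ ?_ hz
      · rintro _ ⟨q, hq, rfl⟩
        have h1 := hppos q hq
        rw [hval _ h1]
        exact fun h' => (hpos _ (hsV.planePoint_mem hq) h1).2.1 (by rw [h']; rfl)
      · intro w hw h1
        rw [hW.conj hw]
        exact star_ne_zero.2 h1
    · have h1 := hppos q hq
      rw [hval _ h1, (hpos _ (hsV.planePoint_mem hq) h1).2.2]
      exact ((Par.refl _).smul_left _).symm

namespace VectorialClass

variable {Ω : Set ℍ[ℝ]}

/-- A slice function vanishing on a whole sphere, or at a real point, has a vanishing stem value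
there. Zeros at single points of nonreal spheres remain possible. -/
theorem ofVec_isMinimalOn {V : Set ℍ[ℝ]} (hs : AxiallySymmetric V) {W : ℂ → Fin 3 → ℂ}
    (hW : VecStem (trace V unitI) W) (h0 : ∀ z ∈ trace V unitI, W z ≠ 0) :
    IsMinimalOn V (ofVec W) := by
  have hmem := ofVec_mem hs hW
  have key : ∀ z ∈ trace V unitI, ¬ ∀ J ∈ unitSphere, ofVec W (toSlice J z) = 0 := by
    intro z hz h
    have h1 := fun J hJ => (apply_toSlice hs hmem.1 hJ hz).symm.trans (h J hJ)
    have h2 : stemOf (ofVec W) z = 0 := eq_of_phi_eq unitI_mem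
      (by rw [h1 _ unitI_mem, phi_zero])
      (by rw [h1 _ (neg_mem_unitSphere unitI_mem), phi_zero])
    rw [stemOf_ofVec hs hW hz] at h2
    exact h0 z hz (by rw [← vec_ofParts 0 (W z), h2, vec_zero])
  constructor
  · rintro _ ⟨hq, x, rfl⟩ h
    have hx : (x : ℂ) ∈ trace V unitI := by
      change toSlice unitI x ∈ V
      rw [toSlice_ofReal]; exact hq
    exact key x hx fun J _ => by rw [toSlice_ofReal]; exact h
  · intro z _ h
    exact key z (h unitI unitI_mem).1 fun J hJ => (h J hJ).2

/-- A local representative vanishes identically near no point, because `ω ≠ [0]`; dividing out the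
common zeros of its coordinates leaves a minimal one. -/
theorem exists_isMinimalRep (hΩ : IsAxialDomain Ω) (ω : VectorialClass Ω) (h : ¬ ω.IsZero)
    {p : ℍ[ℝ]} (hp : p ∈ Ω) :
    ∃ U w, IsAxialDomain U ∧ p ∈ U ∧ ω.IsMinimalRep U w := by
  obtain ⟨V, f, hVΩ, hV, hpV, hf, hc⟩ := ω.exists_local_rep hΩ hp
  have hnz : ∀ q ∈ V, ¬ GermZero q f := by
    intro q hq h0
    rw [← vecClass_eq_zero_iff (IsVecAt.of_mem hV hf hq), ← hc q hq] at h0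
    exact ω.classAt_ne_zero hΩ h (hVΩ hq) h0
  obtain ⟨U, W, hU, hpU, hUV, hW, hWf⟩ := exists_nonvanishing_par hV hpV hf (hnz p hpV)
  have hs := hU.axiallySymmetric
  have hD := isOpen_trace hU.isOpen unitI
  refine ⟨U, ofVec W, hU, hpU, hU.isOpen, hs, hUV.trans hVΩ, ofVec_mem hs hW, fun q hq => ?_,
    ofVec_isMinimalOn hs hW fun z hz => (hWf z hz).1⟩
  rw [hc q (hUV hq), vecClass_eq_iff (IsVecAt.of_mem hU (ofVec_mem hs hW) hq)
    (IsVecAt.of_mem hV hf (hUV hq))]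
  have hqD := hs.planePoint_mem hq
  refine ⟨?_, fun h0 => ?_, fun h0 => absurd h0 (hnz q (hUV hq))⟩
  · filter_upwards [hD.mem_nhds hqD] with z hz
    rw [stemOf_ofVec hs hW hz, vec_ofParts]
    exact (hWf z hz).2
  · have := h0.self_of_nhds
    rw [stemOf_ofVec hs hW hqD, vec_ofParts] at this
    exact absurd this (hWf _ hqD).1

namespace IsMinimalRep

variable {ω : VectorialClass Ω} {U : Set ℍ[ℝ]} {w : ℍ[ℝ] → ℍ[ℝ]}

theorem isVecAt (h : ω.IsMinimalRep U w) {p : ℍ[ℝ]} (hp : p ∈ U) : IsVecAt p w :=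
  ⟨U, h.isOpen, h.axiallySymmetric, hp, h.mem⟩

theorem vec_ne_zero (h : ω.IsMinimalRep U w) {z : ℂ} (hz : z ∈ trace U unitI) :
    vec (stemOf w z) ≠ 0 := by
  intro h0
  have hs := h.axiallySymmetric
  have h1 : stemOf w z = 0 := (stemOf_eq_zero_iff hs h.mem hz).2 h0
  have h2 : ∀ J ∈ unitSphere, w (toSlice J z) = 0 := fun J hJ => by
    rw [apply_toSlice hs h.mem.1 hJ hz, h1, phi_zero]
  by_cases hr : z.im = 0
  · have hzr : ((z.re : ℝ) : ℂ) = z := Complex.ext rfl (by simp [hr])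
    refine h.minimal.1 (toSlice unitI z) ⟨hz, z.re, ?_⟩ (h2 _ unitI_mem)
    conv_rhs => rw [← hzr, toSlice_ofReal]
  · exact h.minimal.2 z hr fun I hI => ⟨hs.mem_of_mem_trace hz hI, h2 I hI⟩

theorem not_germZero (h : ω.IsMinimalRep U w) {p : ℍ[ℝ]} (hp : p ∈ U) : ¬ GermZero p w :=
  fun h0 => h.vec_ne_zero (h.axiallySymmetric.planePoint_mem hp) h0.self_of_nhds

theorem vecStem (h : ω.IsMinimalRep U w) : VecStem (trace U unitI) (fun z => vec (stemOf w z)) :=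
  vecStem_of_mem h.axiallySymmetric h.mem.1

/-- The scalar part is zero, so the symmetrization is `v ⬝ᵥ v`: zeros of the class correspond to
isotropic directions. -/
theorem exists_zero_iff (h : ω.IsMinimalRep U w) {z : ℂ} (hz : z ∈ trace U unitI) :
    (∃ J ∈ unitSphere, w (toSlice J z) = 0) ↔ vec (stemOf w z) ⬝ᵥ vec (stemOf w z) = 0 := by
  have hs := h.axiallySymmetric
  have h1 := exists_phi_eq_zero_iff (stemOf w z)
  rw [((mem_SRVec_iff hs).1 h.mem).2 z hz] at h1
  simp only [ne_eq, OfNat.ofNat_ne_zero, not_false_eq_true, zero_pow, zero_add] at h1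
  rw [← h1]
  refine exists_congr fun J => and_congr_right fun hJ => ?_
  rw [apply_toSlice hs h.mem.1 hJ hz]

/-- Two minimal representatives are parallel. -/
theorem par {U' : Set ℍ[ℝ]} {w' : ℍ[ℝ] → ℍ[ℝ]} (h : ω.IsMinimalRep U w)
    (h' : ω.IsMinimalRep U' w') {z : ℂ} (hz : z ∈ trace U unitI) (hz' : z ∈ trace U' unitI) :
    Par (vec (stemOf w z)) (vec (stemOf w' z)) := by
  have hs : AxiallySymmetric (U ∩ U') := fun z I hI hz J hJ =>
    ⟨h.axiallySymmetric z I hI hz.1 J hJ, h'.axiallySymmetric z I hI hz.2 J hJ⟩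
  refine (h.vecStem.mono (Set.preimage_mono Set.inter_subset_left)).par_trace hs
    (h'.vecStem.mono (Set.preimage_mono Set.inter_subset_right)) ?_
    (show z ∈ trace (U ∩ U') unitI from ⟨hz, hz'⟩)
  intro q hq
  have := (h.rep q hq.1).trans (h'.rep q hq.2).symm
  rw [vecClass_eq_iff (h.isVecAt hq.1) (h'.isVecAt hq.2)] at this
  exact this.1.self_of_nhds

end IsMinimalRep

theorem isVecAt_vecPart (hΩ : IsAxialDomain Ω) {g : ℍ[ℝ] → ℍ[ℝ]} (hg : g ∈ StarLog.SR Ω)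
    {p : ℍ[ℝ]} (hp : p ∈ Ω) : IsVecAt p (vecPart g) :=
  IsVecAt.of_mem hΩ (vecPart_mem_SRVec hΩ.axiallySymmetric hg) hp

theorem vec_stemOf_vecPart (hΩ : IsAxialDomain Ω) {g : ℍ[ℝ] → ℍ[ℝ]} (hg : g ∈ StarLog.SR Ω)
    {z : ℂ} (hz : z ∈ trace Ω unitI) : vec (stemOf (vecPart g) z) = vec (stemOf g z) := by
  rw [stemOf_vecPart hΩ.axiallySymmetric hg hz, vec_ofParts]

/-- The vector of a function in `SR_ω` is parallel to every minimal representative. -/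
theorem par_of_mem (hΩ : IsAxialDomain Ω) {ω : VectorialClass Ω} {g : ℍ[ℝ] → ℍ[ℝ]}
    (hg : g ∈ ω.SR) {U : Set ℍ[ℝ]} {w : ℍ[ℝ] → ℍ[ℝ]} (h : ω.IsMinimalRep U w) {z : ℂ}
    (hz : z ∈ trace U unitI) : Par (vec (stemOf g z)) (vec (stemOf w z)) := by
  refine ((vecStem_of_mem hΩ.axiallySymmetric hg.1).mono (Set.preimage_mono h.subset)).par_trace
    h.axiallySymmetric h.vecStem (fun q hq => ?_) hz
  have hqΩ := h.subset hq
  rw [← vec_stemOf_vecPart hΩ hg.1 (hΩ.axiallySymmetric.planePoint_mem hqΩ)]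
  rcases hg.2 q hqΩ with h1 | h1
  · rw [← h.rep q hq, vecClass_eq_iff (isVecAt_vecPart hΩ hg.1 hqΩ) (h.isVecAt hq)] at h1
    exact h1.1.self_of_nhds
  · rw [vecClass_eq_zero_iff (isVecAt_vecPart hΩ hg.1 hqΩ)] at h1
    exact (h1.par_left w).self_of_nhds

theorem germPar_vecPart (hΩ : IsAxialDomain Ω) {f : ℍ[ℝ] → ℍ[ℝ]} (hf : f ∈ StarLog.SR Ω)
    {w : ℍ[ℝ] → ℍ[ℝ]} {U : Set ℍ[ℝ]} (hU : IsOpen U) (hs : AxiallySymmetric U) (hUΩ : U ⊆ Ω)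
    (h : ∀ z ∈ trace U unitI, Par (vec (stemOf f z)) (vec (stemOf w z))) {p : ℍ[ℝ]}
    (hp : p ∈ U) : GermPar p (vecPart f) w := by
  filter_upwards [(isOpen_trace hU unitI).mem_nhds (hs.planePoint_mem hp)] with z hz
  rw [vec_stemOf_vecPart hΩ hf (hUΩ hz)]
  exact h z hz

/-- A slice-regular function whose vector is parallel to minimal representatives belongs to
`SR_ω`. -/
theorem mem_SR_of_par (hΩ : IsAxialDomain Ω) {ω : VectorialClass Ω} {f : ℍ[ℝ] → ℍ[ℝ]}
    (hf : f ∈ StarLog.SR Ω) (h : ∀ p ∈ Ω, ∃ U w, p ∈ U ∧ ω.IsMinimalRep U w ∧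
      ∀ z ∈ trace U unitI, Par (vec (stemOf f z)) (vec (stemOf w z))) : f ∈ ω.SR := by
  refine ⟨hf, fun p hp => ?_⟩
  have hv := isVecAt_vecPart hΩ hf hp
  by_cases h0 : GermZero p (vecPart f)
  · exact Or.inr ((vecClass_eq_zero_iff hv).2 h0)
  · left
    obtain ⟨U, w, hpU, hw, hpar⟩ := h p hp
    rw [← hw.rep p hpU, vecClass_eq_iff hv (hw.isVecAt hpU)]
    exact ⟨germPar_vecPart hΩ hf hw.isOpen hw.axiallySymmetric hw.subset hpar hpU,
      fun h' => absurd h' h0, fun h' => absurd h' (hw.not_germZero hpU)⟩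

/-- For `ω ≠ [0]`, multiplying the vectorial part by a scalar and changing the scalar part does
not lead out of `SR_ω`. -/
theorem mem_SR_of_smul (hΩ : IsAxialDomain Ω) {ω : VectorialClass Ω} (hω : ¬ ω.IsZero)
    {f g : ℍ[ℝ] → ℍ[ℝ]} (hf : f ∈ StarLog.SR Ω) (hg : g ∈ ω.SR)
    (h : ∀ z ∈ trace Ω unitI, ∃ c : ℂ, vec (stemOf f z) = c • vec (stemOf g z)) : f ∈ ω.SR := by
  refine mem_SR_of_par hΩ hf fun p hp => ?_
  obtain ⟨U, w, _, hpU, hw⟩ := ω.exists_isMinimalRep hΩ hω hp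
  refine ⟨U, w, hpU, hw, fun z hz => ?_⟩
  obtain ⟨c, hc⟩ := h z (hw.subset hz)
  rw [hc]
  exact (par_of_mem hΩ hg hw hz).smul_left c

theorem isZero_mem_iff (hΩ : IsAxialDomain Ω) {ω : VectorialClass Ω} (hω : ω.IsZero)
    {f : ℍ[ℝ] → ℍ[ℝ]} : f ∈ ω.SR ↔ f ∈ SRReal Ω := by
  rw [mem_SRReal_iff hΩ.axiallySymmetric]
  refine and_congr_right fun hf => ?_
  constructor
  · intro h z hz
    obtain ⟨p, hp⟩ := hΩ.isConnected.nonempty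
    have h1 := h p hp
    rw [hω p hp, or_self, vecClass_eq_zero_iff (isVecAt_vecPart hΩ hf hp)] at h1
    rw [← vec_stemOf_vecPart hΩ hf hz]
    exact h1.vec_eq_zero hΩ (vecPart_mem_SRVec hΩ.axiallySymmetric hf).1 hp hz
  · intro h p hp
    right
    rw [vecClass_eq_zero_iff (isVecAt_vecPart hΩ hf hp)]
    filter_upwards [(isOpen_trace hΩ.isOpen unitI).mem_nhds
      (hΩ.axiallySymmetric.planePoint_mem hp)] with z hz
    rw [vec_stemOf_vecPart hΩ hf hz, h z hz]

end VectorialClass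

/-! ### Gluing over connected components and lifting -/

theorem exists_continuousOn_of_components {E : Type*} [TopologicalSpace E] [Nonempty E]
    {D : Set ℂ} (hD : IsOpen D) {P : ℂ → E → Prop}
    (h : ∀ z ∈ D, ∃ a : ℂ → E, ContinuousOn a (connectedComponentIn D z) ∧
      ∀ w ∈ connectedComponentIn D z, P w (a w)) :
    ∃ a : ℂ → E, ContinuousOn a D ∧ ∀ z ∈ D, P z (a z) := by
  classical
  let Q : Set ℂ → (ℂ → E) → Prop := fun C a => ContinuousOn a C ∧ ∀ w ∈ C, P w (a w)
  -- The choice depends only on the component as a set, so all points of one component share it.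
  let A : Set ℂ → ℂ → E := fun C =>
    if hC : ∃ a, Q C a then hC.choose else fun _ => Classical.arbitrary E
  have hA : ∀ z ∈ D, Q (connectedComponentIn D z) (A (connectedComponentIn D z)) := by
    intro z hz
    have hC : ∃ a, Q (connectedComponentIn D z) a := h z hz
    simp only [A, dif_pos hC]
    exact hC.choose_spec
  refine ⟨fun z => A (connectedComponentIn D z) z, fun z hz => ?_, fun z hz =>
    (hA z hz).2 z (mem_connectedComponentIn hz)⟩
  have hn : connectedComponentIn D z ∈ 𝓝 z :=
    hD.connectedComponentIn.mem_nhds (mem_connectedComponentIn hz)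
  have hc : ContinuousAt (A (connectedComponentIn D z)) z := (hA z hz).1.continuousAt hn
  refine (hc.congr ?_).continuousWithinAt
  filter_upwards [hn] with w hw
  rw [connectedComponentIn_eq hw]

theorem eq_zero_of_exp_eq_one {w : ℂ} (h : Complex.exp w = 1) (hw : ‖w‖ < 1) : w = 0 := by
  have him := (Complex.abs_im_le_norm w).trans_lt hw
  have hpi := Real.pi_gt_three
  rw [abs_lt] at him
  rw [← Complex.log_exp (x := w) (by linarith) (by linarith), h, Complex.log_one]

/-- Continuous logarithms of holomorphic functions are holomorphic. -/
theorem differentiableOn_of_exp {D : Set ℂ} (hD : IsOpen D) {A N : ℂ → ℂ}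
    (hA : ContinuousOn A D) (hN : DifferentiableOn ℂ N D)
    (h : ∀ z ∈ D, Complex.exp (A z) = N z) : DifferentiableOn ℂ A D := by
  intro z hz
  have hcont := hA.continuousAt (hD.mem_nhds hz)
  have hNz : N z ≠ 0 := by rw [← h z hz]; exact Complex.exp_ne_zero _
  -- Near `z` one has `A w = log (N w / N z) + A z`, because `A w - A z` is small and has
  -- exponential `N w / N z`.
  have hd : DifferentiableAt ℂ (fun w => Complex.log (N w / N z) + A z) z := by
    refine DifferentiableAt.add_const _ (DifferentiableAt.clog ?_ ?_)
    · exact ((hN z hz).differentiableAt (hD.mem_nhds hz)).div_const _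
    · rw [div_self hNz]; exact Complex.one_mem_slitPlane
  refine (hd.congr_of_eventuallyEq ?_).differentiableWithinAt
  filter_upwards [hD.mem_nhds hz, Metric.continuousAt_iff'.1 hcont 1 one_pos] with w hw hw1
  rw [dist_eq_norm] at hw1
  have him := (Complex.abs_im_le_norm (A w - A z)).trans_lt hw1
  have hpi := Real.pi_gt_three
  rw [abs_lt] at him
  rw [← h w hw, ← h z hz, ← Complex.exp_sub, Complex.log_exp (by linarith) (by linarith),
    sub_add_cancel]

theorem exists_log {D : Set ℂ} (hD : IsOpen D)
    (hsc : ∀ z ∈ D, IsSimplyConnected (connectedComponentIn D z)) {N : ℂ → ℂ}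
    (hN : DifferentiableOn ℂ N D) (h0 : ∀ z ∈ D, N z ≠ 0) :
    ∃ A : ℂ → ℂ, DifferentiableOn ℂ A D ∧ ∀ z ∈ D, Complex.exp (A z) = N z := by
  obtain ⟨A, hA, hAN⟩ := exists_continuousOn_of_components (E := ℂ) hD
    (P := fun z a => Complex.exp a = N z) (fun z hz => by
      obtain ⟨a, ha, hae⟩ := Complex.exists_continuousOn_eqOn_exp_comp (hsc z hz)
        hD.connectedComponentIn (hN.continuousOn.mono (connectedComponentIn_subset D z)) (by
          rintro ⟨w, hw, hw0⟩
          exact h0 w (connectedComponentIn_subset D z hw) hw0)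
      exact ⟨a, ha, fun w hw => hae hw⟩)
  exact ⟨A, differentiableOn_of_exp hD hA hN hAN, hAN⟩

/-- A continuous function with values in the periods of `exp` is constant on preconnected sets. -/
theorem eq_zero_of_exp_eq_one_of_preconnected {S : Set ℂ} (hS : IsPreconnected S) {E : ℂ → ℂ}
    (hE : ContinuousOn E S) (h1 : ∀ z ∈ S, Complex.exp (E z) = 1) {x : ℂ} (hx : x ∈ S)
    (hx0 : E x = 0) {z : ℂ} (hz : z ∈ S) : E z = 0 := by
  have : E x = E z := by
    refine hS.induction₂ (fun x y => E x = E y) ?_ ?_ ?_ hx hz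
    · intro y hy
      filter_upwards [Metric.continuousWithinAt_iff'.1 (hE y hy) 1 one_pos, self_mem_nhdsWithin]
        with w hw hwS
      rw [dist_eq_norm] at hw
      have := eq_zero_of_exp_eq_one (w := E w - E y)
        (by rw [Complex.exp_sub, h1 w hwS, h1 y hy, div_one]) hw
      exact (sub_eq_zero.1 this).symm
    · intro a b c _ _ _ h h'
      exact h.trans h'
    · intro a b _ _ h
      exact h.symm
  rw [← this, hx0]

/-- A logarithm and its reflection differ by periods of `exp`. If there is a real point, positivity
allows a logarithm that is real there; the difference then vanishes on the preconnected upper part,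
hence everywhere. Without real points the two half planes are independent, and the logarithm is
reflected from the upper one. -/
theorem exists_symmetric_log {Ω : Set ℍ[ℝ]} (hΩ : IsBasicDomain Ω) {N : ℂ → ℂ}
    (hN : ScalarStem (trace Ω unitI) N) (h0 : ∀ z ∈ trace Ω unitI, N z ≠ 0)
    (hpos : ∀ z ∈ trace Ω unitI, z.im = 0 → 0 < (N z).re) :
    ∃ A, ScalarStem (trace Ω unitI) A ∧ ∀ z ∈ trace Ω unitI, Complex.exp (A z) = N z := by
  have hs := hΩ.axiallySymmetric
  have hD := isOpen_trace hΩ.isOpen unitI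
  obtain ⟨A, hA, hAN⟩ := exists_log hD (hΩ.simplyConnected unitI unitI_mem) hN.holo h0
  by_cases hr : ∃ x ∈ trace Ω unitI, x.im = 0
  · obtain ⟨x, hx, hx0⟩ := hr
    have hNx : N x = (((N x).re : ℝ) : ℂ) :=
      Complex.ext rfl (by simpa using hN.im_eq_zero hx hx0)
    have hxc : starRingEnd ℂ x = x := Complex.conj_eq_iff_im.2 hx0
    -- The added constant is a period of `exp`, chosen to make the value at `x` the real logarithm.
    let B : ℂ → ℂ := fun z => A z + (((Real.log (N x).re : ℝ) : ℂ) - A x)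
    have hBN : ∀ z ∈ trace Ω unitI, Complex.exp (B z) = N z := by
      intro z hz
      rw [Complex.exp_add, Complex.exp_sub, hAN z hz, hAN x hx, ← Complex.ofReal_exp,
        Real.exp_log (hpos x hx hx0), ← hNx, div_self (h0 x hx), mul_one]
    have hBd : DifferentiableOn ℂ B (trace Ω unitI) := hA.add_const _
    have hBx : starRingEnd ℂ (B x) = B x := by
      simp only [B, add_sub_cancel, Complex.conj_ofReal]
    let E : ℂ → ℂ := fun z => starRingEnd ℂ (B (starRingEnd ℂ z)) - B z
    have hEc : ContinuousOn E (trace Ω unitI) := by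
      refine ContinuousOn.sub ?_ hBd.continuousOn
      exact Complex.continuous_conj.comp_continuousOn (hBd.continuousOn.comp
        Complex.continuous_conj.continuousOn fun z hz => hs.mem_trace_conj hz)
    have hE1 : ∀ z ∈ trace Ω unitI, Complex.exp (E z) = 1 := by
      intro z hz
      have hz' := hs.mem_trace_conj hz
      rw [Complex.exp_sub, Complex.exp_conj, hBN _ hz', hN.symm z hz, Complex.conj_conj, hBN z hz,
        div_self (h0 z hz)]
    have hE0 : ∀ z ∈ trace Ω unitI, E z = 0 := by
      intro z hz
      refine hs.trace_induction (P := fun z => E z = 0) ?_ ?_ hz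
      · intro w hw
        exact eq_zero_of_exp_eq_one_of_preconnected hΩ.isPreconnected_planePoint
          (hEc.mono hs.planePoint_image_subset)
          (fun z hz => hE1 z (hs.planePoint_image_subset hz))
          (mem_planePoint_image hx hx0.ge) (by simp only [E, hxc, hBx, sub_self]) hw
      · intro w _ hw0
        have := congrArg (starRingEnd ℂ) hw0
        simp only [E, map_sub, Complex.conj_conj, map_zero] at this ⊢
        rw [← neg_sub, this, neg_zero]
    refine ⟨B, ⟨fun z hz => ?_, hBd⟩, hBN⟩
    have := sub_eq_zero.1 (hE0 _ hz)
    rw [← this, Complex.conj_conj]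
  · push Not at hr
    refine ⟨reflect A, scalarStem_reflect hr (fun z hz => hs.mem_trace_conj hz)
      fun z hz _ => (hA z hz).differentiableAt (hD.mem_nhds hz), fun z hz => ?_⟩
    rcases (hr z hz).lt_or_gt with h | h
    · have hz' := hs.mem_trace_conj hz
      rw [reflect_of_neg _ h, Complex.exp_conj, hAN _ hz', hN.symm z hz, Complex.conj_conj]
    · rw [reflect_of_pos _ h, hAN z hz]

/-- A continuous family of pairs `{v, -v}` of nonzero vectors over a simply connected open set has
a continuous selection. -/
theorem exists_continuousOn_selection {U : Set ℂ} (hU : IsSimplyConnected U) (hUo : IsOpen U)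
    {S : ℂ → (Fin 3 → ℂ) → Prop}
    (h : ∀ z ∈ U, ∃ W : ℂ → Fin 3 → ℂ, ContinuousAt W z ∧ ∀ᶠ w in 𝓝 z, W w ≠ 0 ∧
      ∀ v, S w v ↔ v = W w ∨ v = -W w) :
    ∃ W : ℂ → Fin 3 → ℂ, ContinuousOn W U ∧ ∀ z ∈ U, S z (W z) := by
  classical
  -- The pair `{v, -v}` is an orbit of `{1, -1}`. The quotient map is a covering away from `0`,
  -- where the action is free, and the selection is a lift of `z ↦ {v, -v}`.
  let R := MulAction.orbitRel ℤˣ (Fin 3 → ℂ)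
  let π : (Fin 3 → ℂ) → Quotient R := Quotient.mk R
  have hπ : ∀ v w, π v = π w ↔ v = w ∨ v = -w := by
    intro v w
    rw [Quotient.eq, MulAction.orbitRel_apply, MulAction.mem_orbit_iff]
    constructor
    · rintro ⟨u, rfl⟩
      rcases Int.units_eq_one_or u with rfl | rfl
      · left; simp
      · right; simp
    · rintro (rfl | rfl)
      · exact ⟨1, by simp⟩
      · exact ⟨-1, by simp⟩
  have hS : ∀ z ∈ U, ∃ v, S z v ∧ v ≠ 0 ∧ ∀ w, S z w ↔ π w = π v := by
    intro z hz
    obtain ⟨W, -, hW⟩ := h z hz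
    obtain ⟨h0, h1⟩ := hW.self_of_nhds
    exact ⟨W z, (h1 _).2 (Or.inl rfl), h0, fun w => by rw [h1, hπ]⟩
  choose! v hv hv0 hvS using hS
  have hc : ContinuousOn (fun z => π (v z)) U := by
    intro z hz
    obtain ⟨W, hWc, hW⟩ := h z hz
    have : ContinuousAt (fun z => π (W z)) z :=
      continuous_quotient_mk'.continuousAt.comp hWc
    refine this.continuousWithinAt.congr_of_eventuallyEq ?_ ?_
    · filter_upwards [nhdsWithin_le_nhds hW, self_mem_nhdsWithin] with w hw hwU
      rw [hπ, ← hw.2]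
      exact hv w hwU
    · rw [hπ, ← hW.self_of_nhds.2]
      exact hv z hz
  have cov := isCoveringMapOn_quotientMk_of_properlyDiscontinuousSMul (G := ℤˣ)
    (E := Fin 3 → ℂ)
  have := hU.simplyConnectedSpace
  have := hUo.locallyPathConnectedSpace
  obtain ⟨z₀, hz₀⟩ := hU.nonempty
  obtain ⟨L, ⟨-, hL⟩, -⟩ := cov.existsUnique_continuousMap_lifts
    ⟨U.domRestrict (fun z => π (v z)), continuousOn_iff_continuous_domRestrict.mp hc⟩
    (a₀ := ⟨z₀, hz₀⟩) (e₀ := v z₀) rfl (fun x => ⟨v x, by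
      rw [Set.mem_ofPred_eq, Subgroup.eq_bot_iff_forall]
      intro u hu
      rcases Int.units_eq_one_or u with rfl | rfl
      · rfl
      · exfalso
        have h2 : -v x = v x := by simpa using hu
        exact hv0 x x.2 (self_eq_neg.1 h2.symm), rfl⟩)
  refine ⟨fun z => if hz : z ∈ U then L ⟨z, hz⟩ else 0, ?_, fun z hz => ?_⟩
  · rw [continuousOn_iff_continuous_domRestrict]
    convert map_continuous L using 1
    funext z
    simp [Set.domRestrict]
  · simp only [dif_pos hz]
    rw [hvS z hz]
    exact congrFun hL ⟨z, hz⟩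

/-! ### The unit representative of a vectorial class without zeros -/

/-- The sum `f + g` tends to `2a ≠ 0`, which rules out `f = -g` near the limit. -/
theorem eventually_eq_of_eq_or_eq_neg {α E : Type*} [NormedAddCommGroup E] [NormedSpace ℝ E]
    {l : Filter α} {f g : α → E} {a : E} (hf : Filter.Tendsto f l (𝓝 a))
    (hg : Filter.Tendsto g l (𝓝 a)) (ha : a ≠ 0) (h : ∀ᶠ x in l, f x = g x ∨ f x = -g x) :
    ∀ᶠ x in l, f x = g x := by
  have h2 : a + a ≠ 0 := by
    rw [← two_smul ℝ]; exact smul_ne_zero two_ne_zero ha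
  filter_upwards [h, (hf.add hg).eventually_ne h2] with x hx hx2
  refine hx.resolve_right fun h' => hx2 ?_
  rw [h', neg_add_cancel]

namespace VectorialClass

variable {Ω : Set ℍ[ℝ]}

/-- `v` is a unit vector in the direction prescribed by `ω` over `z`. -/
def IsUnitAt (ω : VectorialClass Ω) (z : ℂ) (v : Fin 3 → ℂ) : Prop :=
  v ⬝ᵥ v = 1 ∧ ∃ U w, ω.IsMinimalRep U w ∧ z ∈ trace U unitI ∧ Par v (vec (stemOf w z))

theorem IsUnitAt.ne_zero {ω : VectorialClass Ω} {z : ℂ} {v : Fin 3 → ℂ} (h : ω.IsUnitAt z v) :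
    v ≠ 0 := by
  rintro rfl
  simpa using h.1

theorem IsUnitAt.conj {ω : VectorialClass Ω} {z : ℂ} {v : Fin 3 → ℂ} (h : ω.IsUnitAt z v) :
    ω.IsUnitAt (starRingEnd ℂ z) (star v) := by
  obtain ⟨h1, U, w, hw, hz, hp⟩ := h
  refine ⟨?_, U, w, hw, hw.axiallySymmetric.mem_trace_conj hz, ?_⟩
  · have := congrArg (starRingEnd ℂ) h1
    simpa [dotProduct, Fin.sum_univ_three] using this
  · rw [hw.vecStem.conj hz]
    exact hp.conj

theorem IsUnitAt.par {ω : VectorialClass Ω} {z : ℂ} {v : Fin 3 → ℂ} (h : ω.IsUnitAt z v)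
    {U : Set ℍ[ℝ]} {w : ℍ[ℝ] → ℍ[ℝ]} (hw : ω.IsMinimalRep U w) (hz : z ∈ trace U unitI) :
    Par v (vec (stemOf w z)) := by
  obtain ⟨-, U', w', hw', hz', hp⟩ := h
  exact hp.trans (hw'.par hw hz' hz) (hw'.vec_ne_zero hz')

/-- Both vectors span the line of the class, so `v = c v'`, and the normalisation forces `c² = 1`.
-/
theorem IsUnitAt.eq_or_eq_neg {ω : VectorialClass Ω} {z : ℂ} {v v' : Fin 3 → ℂ}
    (h : ω.IsUnitAt z v) (h' : ω.IsUnitAt z v') : v = v' ∨ v = -v' := by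
  obtain ⟨h1', U, w, hw, hz, hp⟩ := id h'
  obtain ⟨c, hc⟩ := ((h.par hw hz).trans hp.symm (hw.vec_ne_zero hz)).exists_smul h'.ne_zero
  have h1 := h.1
  rw [hc, smul_dotProduct, dotProduct_smul, h1', smul_eq_mul, smul_eq_mul, mul_one] at h1
  rcases mul_self_eq_one_iff.1 h1 with rfl | rfl
  · left; rw [hc, one_smul]
  · right; rw [hc, neg_smul, one_smul]

theorem IsUnitAt.neg {ω : VectorialClass Ω} {z : ℂ} {v : Fin 3 → ℂ} (h : ω.IsUnitAt z v) :
    ω.IsUnitAt z (-v) := by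
  obtain ⟨h1, U, w, hw, hz, hp⟩ := h
  refine ⟨by simpa using h1, U, w, hw, hz, ?_⟩
  have := hp.smul_left (-1)
  rwa [neg_smul, one_smul] at this

theorem IsMinimalRep.dotProduct_ne_zero {ω : VectorialClass Ω} (hω : ¬ ω.IsZero)
    (hZ : ω.zeroSet = ∅) {U : Set ℍ[ℝ]} {w : ℍ[ℝ] → ℍ[ℝ]} (hw : ω.IsMinimalRep U w) {z : ℂ}
    (hz : z ∈ trace U unitI) : vec (stemOf w z) ⬝ᵥ vec (stemOf w z) ≠ 0 := by
  intro h
  obtain ⟨J, hJ, h0⟩ := (hw.exists_zero_iff hz).2 h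
  have : toSlice J z ∈ ω.zeroSet :=
    ⟨hω, U, w, hw, hw.axiallySymmetric.mem_of_mem_trace hz hJ, h0⟩
  rw [hZ] at this
  exact this

/-- Without zeros of the class `w ⬝ᵥ w` never vanishes, and `w` can be divided by a local square
root of it. -/
theorem exists_local_unit (hΩ : IsAxialDomain Ω) {ω : VectorialClass Ω} (hω : ¬ ω.IsZero)
    (hZ : ω.zeroSet = ∅) {z : ℂ} (hz : z ∈ trace Ω unitI) :
    ∃ W : ℂ → Fin 3 → ℂ, (∀ i, DifferentiableAt ℂ (fun y => W y i) z) ∧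
      ∀ᶠ y in 𝓝 z, ω.IsUnitAt y (W y) := by
  obtain ⟨U, w, hU, hzU, hw⟩ := ω.exists_isMinimalRep hΩ hω (p := toSlice unitI z) hz
  have hD := isOpen_trace hU.isOpen unitI
  set V : ℂ → Fin 3 → ℂ := fun y => vec (stemOf w y) with hV
  let d : ℂ → ℂ := fun y => V y ⬝ᵥ V y
  have hd0 : ∀ y ∈ trace U unitI, d y ≠ 0 := fun y hy => hw.dotProduct_ne_zero hω hZ hy
  have hVd : ∀ i, DifferentiableAt ℂ (fun y => V y i) z := fun i =>
    ((hw.vecStem i).holo z hzU).differentiableAt (hD.mem_nhds hzU)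
  have hdd : DifferentiableAt ℂ d z := by
    simp only [d, dotProduct, Fin.sum_univ_three]
    have h0 := hVd 0
    have h1 := hVd 1
    have h2 := hVd 2
    fun_prop
  have hdz := hd0 z hzU
  -- The principal root is taken of `d y / d z`, which is near `1` and so away from the cut.
  let r : ℂ → ℂ := fun y => d z ^ (1 / 2 : ℂ) * (d y / d z) ^ (1 / 2 : ℂ)
  have hsq : ∀ x : ℂ, (x ^ (1 / 2 : ℂ)) ^ 2 = x := fun x => by
    simp
  have hr2 : ∀ y, r y ^ 2 = d y := fun y => by
    rw [mul_pow, hsq, hsq, mul_div_cancel₀ _ hdz]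
  have hrd : DifferentiableAt ℂ r z := by
    refine DifferentiableAt.const_mul (DifferentiableAt.cpow_const (hdd.div_const _) ?_) _
    rw [div_self hdz]; exact Complex.one_mem_slitPlane
  have hr0 : ∀ y ∈ trace U unitI, r y ≠ 0 := fun y hy h => hd0 y hy (by rw [← hr2, h]; simp)
  refine ⟨fun y => (r y)⁻¹ • V y, fun i => (hrd.inv (hr0 z hzU)).mul (hVd i), ?_⟩
  filter_upwards [hD.mem_nhds hzU] with y hy
  refine ⟨?_, U, w, hw, hy, (Par.refl _).smul_left _⟩
  rw [smul_dotProduct, dotProduct_smul, smul_eq_mul, smul_eq_mul]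
  change (r y)⁻¹ * ((r y)⁻¹ * d y) = 1
  rw [← hr2 y]
  field_simp [hr0 y hy]

/-- At a real point the unit vectors of the class are real. -/
theorem IsUnitAt.star_eq {ω : VectorialClass Ω} {z : ℂ} {v : Fin 3 → ℂ} (h : ω.IsUnitAt z v)
    (hr : z.im = 0) : star v = v := by
  obtain ⟨h1, U, w, hw, hz, hp⟩ := h
  obtain ⟨c, hc⟩ := hp.exists_smul (hw.vec_ne_zero hz)
  have hreal : ∀ i, ∃ t : ℝ, vec (stemOf w z) i = t := fun i =>
    ⟨(vec (stemOf w z) i).re, Complex.ext rfl (by simpa using (hw.vecStem i).im_eq_zero hz hr)⟩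
  choose t ht using hreal
  have ht' : vec (stemOf w z) = fun i => (t i : ℂ) := funext ht
  rw [hc, ht', smul_dotProduct, dotProduct_smul, smul_eq_mul, smul_eq_mul] at h1
  have hd : ((fun i => (t i : ℂ)) ⬝ᵥ fun i => (t i : ℂ)) = ((t ⬝ᵥ t : ℝ) : ℂ) := by
    simp [dotProduct]
  rw [hd] at h1
  have hT : 0 ≤ t ⬝ᵥ t := by
    simp only [dotProduct, Fin.sum_univ_three]
    nlinarith [mul_self_nonneg (t 0), mul_self_nonneg (t 1), mul_self_nonneg (t 2)]
  have hre := congrArg Complex.re h1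
  have him := congrArg Complex.im h1
  simp at hre him
  -- With `t` real, `c² (t ⬝ᵥ t) = 1` and `t ⬝ᵥ t ≥ 0` make `c²` positive, so `c` is real.
  have hcim : c.im = 0 := by
    by_contra hne
    have e : (t ⬝ᵥ t) * (c.re * c.im) = 0 := by linarith
    rcases mul_eq_zero.1 e with e | e
    · rw [e] at hre; simp at hre
    · rcases mul_eq_zero.1 e with e | e
      · rw [e] at hre
        nlinarith [mul_nonneg hT (mul_self_nonneg c.im)]
      · exact hne e
  have hcr : star c = c := Complex.conj_eq_iff_im.2 hcim
  rw [hc, ht']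
  funext i
  simp [hcr]

/-- The unit vectors over a point form a pair `{v, -v}`, so a continuous selection exists over
simply connected components; locally it is plus or minus a holomorphic one. Symmetry under
conjugation costs no extra condition, because unit vectors at real points are real. -/
theorem exists_unit (hΩ : IsBasicDomain Ω) {ω : VectorialClass Ω} (hω : ¬ ω.IsZero)
    (hZ : ω.zeroSet = ∅) : ∃ W : ℂ → Fin 3 → ℂ, VecStem (trace Ω unitI) W ∧
      ∀ z ∈ trace Ω unitI, ω.IsUnitAt z (W z) := by
  have hΩ' := hΩ.toIsAxialDomain
  have hs := hΩ.axiallySymmetric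
  have hD := isOpen_trace hΩ.isOpen unitI
  obtain ⟨W, hWc, hWu⟩ := exists_continuousOn_of_components (E := Fin 3 → ℂ) hD
    (P := fun z v => ω.IsUnitAt z v) (fun z hz =>
      exists_continuousOn_selection (hΩ.simplyConnected unitI unitI_mem z hz)
        hD.connectedComponentIn (fun y hy => by
          obtain ⟨L, hL, hLu⟩ := exists_local_unit hΩ' hω hZ (connectedComponentIn_subset _ _ hy)
          refine ⟨L, continuousAt_pi.2 fun i => (hL i).continuousAt, ?_⟩
          filter_upwards [hLu] with x hx
          refine ⟨hx.ne_zero, fun v => ⟨fun hv => hv.eq_or_eq_neg hx, ?_⟩⟩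
          rintro (rfl | rfl)
          · exact hx
          · exact hx.neg))
  have hWd : ∀ z ∈ trace Ω unitI, ∀ i, DifferentiableAt ℂ (fun y => W y i) z := by
    intro z hz
    obtain ⟨L, hL, hLu⟩ := exists_local_unit hΩ' hω hZ hz
    have hLc : ContinuousAt L z := continuousAt_pi.2 fun i => (hL i).continuousAt
    have hWcz := hWc.continuousAt (hD.mem_nhds hz)
    have hpm : ∀ᶠ y in 𝓝 z, W y = L y ∨ W y = -L y := by
      filter_upwards [hD.mem_nhds hz, hLu] with y hy hyu
      exact (hWu y hy).eq_or_eq_neg hyu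
    rcases hpm.self_of_nhds with h | h
    · have := eventually_eq_of_eq_or_eq_neg hWcz (h ▸ hLc) (hWu z hz).ne_zero hpm
      exact fun i => (hL i).congr_of_eventuallyEq (this.mono fun y hy => congrFun hy i)
    · have := eventually_eq_of_eq_or_eq_neg hWcz (g := fun y => -L y) (h ▸ hLc.neg)
        (hWu z hz).ne_zero (hpm.mono fun y hy => by rw [neg_neg]; exact hy.symm)
      exact fun i => ((hL i).neg).congr_of_eventuallyEq (this.mono fun y hy => congrFun hy i)
  by_cases hr : ∃ x ∈ trace Ω unitI, x.im = 0
  · obtain ⟨x, hx, hx0⟩ := hr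
    -- The reflected selection is `± W`; the sign is constant on the preconnected upper part of the
    -- trace and is `+` at the real point `x`.
    let W' : ℂ → Fin 3 → ℂ := fun z => star (W (starRingEnd ℂ z))
    have hW'c : ContinuousOn W' (trace Ω unitI) :=
      (hWc.comp Complex.continuous_conj.continuousOn fun z hz => hs.mem_trace_conj hz).star
    have hW'u : ∀ z ∈ trace Ω unitI, ω.IsUnitAt z (W' z) := by
      intro z hz
      have := (hWu _ (hs.mem_trace_conj hz)).conj
      rwa [Complex.conj_conj] at this
    have hpm : ∀ z ∈ trace Ω unitI, W' z = W z ∨ W' z = -W z := fun z hz =>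
      (hW'u z hz).eq_or_eq_neg (hWu z hz)
    have hx' : W' x = W x := by
      change star (W (starRingEnd ℂ x)) = W x
      rw [Complex.conj_eq_iff_im.2 hx0]
      exact (hWu x hx).star_eq hx0
    have hup : ∀ z ∈ planePoint '' Ω, W' z = W z := by
      have hsub := hs.planePoint_image_subset
      intro z hz
      refine (hΩ'.isPreconnected_planePoint.induction₂ (fun x y => W' x = W x ↔ W' y = W y)
        ?_ ?_ ?_ (mem_planePoint_image hx hx0.ge) hz).1 hx'
      · intro y hy
        have hmem : ∀ᶠ t in 𝓝[planePoint '' Ω] y, t ∈ trace Ω unitI := by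
          filter_upwards [self_mem_nhdsWithin] with t ht using hsub ht
        have c1 := (hW'c.mono hsub) y hy
        have c2 := (hWc.mono hsub) y hy
        rcases hpm y (hsub hy) with h | h
        · filter_upwards [eventually_eq_of_eq_or_eq_neg (f := W') (g := W) (a := W' y) c1
            (h ▸ c2) (hW'u y (hsub hy)).ne_zero (hmem.mono fun t ht => hpm t ht)] with t ht
          exact ⟨fun _ => ht, fun _ => h⟩
        · filter_upwards [eventually_eq_of_eq_or_eq_neg (f := W') (g := fun t => -W t) (a := W' y)
            c1 (h ▸ c2.neg) (hW'u y (hsub hy)).ne_zero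
            (hmem.mono fun t ht => by rw [neg_neg]; exact (hpm t ht).symm), hmem] with t ht htD
          have hne : ∀ s ∈ trace Ω unitI, -W s ≠ W s := fun s hs' h' =>
            (hWu s hs').ne_zero (self_eq_neg.1 h'.symm)
          rw [h, ht]
          exact ⟨fun h' => absurd h' (hne y (hsub hy)), fun h' => absurd h' (hne t htD)⟩
      · intro a b c _ _ _ h h'
        exact h.trans h'
      · intro a b _ _ h
        exact h.symm
    have hall : ∀ z ∈ trace Ω unitI, W' z = W z := fun z hz => by
      refine hs.trace_induction (P := fun z => W' z = W z) hup (fun y _ hy => ?_) hz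
      change star (W (starRingEnd ℂ (starRingEnd ℂ y))) = W (starRingEnd ℂ y)
      rw [Complex.conj_conj, ← hy, star_star]
    refine ⟨W, fun i => ⟨fun z hz => ?_, fun z hz => (hWd z hz i).differentiableWithinAt⟩, hWu⟩
    have := hall z hz
    rw [← this]
    change _ = star (star (W (starRingEnd ℂ z) i))
    rw [star_star]
  · push Not at hr
    refine ⟨fun z i => reflect (fun y => W y i) z, fun i => scalarStem_reflect hr
      (fun z hz => hs.mem_trace_conj hz) fun z hz _ => hWd z hz i, fun z hz => ?_⟩
    rcases (hr z hz).lt_or_gt with h | h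
    · have := (hWu _ (hs.mem_trace_conj hz)).conj
      rw [Complex.conj_conj] at this
      convert this using 1
      funext i
      exact reflect_of_neg _ h
    · convert hWu z hz using 1
      funext i
      exact reflect_of_pos _ h

end VectorialClass

/-! ### The function `arccos u / sin (arccos u)` on `ℂ ∖ (-∞, -1]` -/

/-- The entire function `sin z / z`. -/
def csinc : ℂ → ℂ := dslope Complex.sin 0

theorem csinc_mul (z : ℂ) : csinc z * z = Complex.sin z := by
  have := sub_smul_dslope Complex.sin 0 z
  simp only [sub_zero, Complex.sin_zero, smul_eq_mul] at this
  rw [csinc, mul_comm, this]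

theorem csinc_zero : csinc 0 = 1 := by
  rw [csinc, dslope_same, Complex.deriv_sin, Complex.cos_zero]

theorem csinc_eq_div {z : ℂ} (hz : z ≠ 0) : csinc z = Complex.sin z / z := by
  rw [eq_div_iff hz, csinc_mul]

theorem csinc_neg (z : ℂ) : csinc (-z) = csinc z := by
  by_cases hz : z = 0
  · rw [hz, neg_zero]
  · rw [csinc_eq_div hz, csinc_eq_div (neg_ne_zero.2 hz), Complex.sin_neg, neg_div_neg_eq]

theorem csinc_conj (z : ℂ) : csinc (starRingEnd ℂ z) = starRingEnd ℂ (csinc z) := by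
  by_cases hz : z = 0
  · rw [hz, map_zero, csinc_zero, map_one]
  · rw [csinc_eq_div hz, csinc_eq_div ((map_ne_zero _).2 hz), Complex.sin_conj, map_div₀]

theorem differentiable_csinc : Differentiable ℂ csinc := by
  rw [← differentiableOn_univ]
  exact (Complex.differentiableOn_dslope Filter.univ_mem).2 Complex.differentiable_sin.differentiableOn

/-- The complex argument of a point `c + i s` of the complexified circle. -/
def circleArg (c s : ℂ) : ℂ := -Complex.I * Complex.log (c + Complex.I * s)

section CircleArg

variable {c s : ℂ}

theorem circle_mul (h : c ^ 2 + s ^ 2 = 1) :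
    (c + Complex.I * s) * (c + Complex.I * -s) = 1 := by
  linear_combination h - s ^ 2 * Complex.I_sq

/-- If `ζ = c + i s` were real and nonpositive, its inverse `c - i s` would also have negative real
part, but the two real parts add up to `2 Re c > 0`. -/
theorem circle_mem_slitPlane (h : c ^ 2 + s ^ 2 = 1) (hc : 0 < c.re) :
    c + Complex.I * s ∈ Complex.slitPlane := by
  rw [Complex.mem_slitPlane_iff]
  by_contra hne
  push Not at hne
  obtain ⟨h1, h2⟩ := hne
  have hre := congrArg Complex.re (circle_mul h)
  have hsum : (c + Complex.I * s).re + (c + Complex.I * -s).re = 2 * c.re := by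
    simp only [Complex.add_re, mul_neg, Complex.neg_re]; ring
  rw [Complex.mul_re, h2, zero_mul, sub_zero, Complex.one_re] at hre
  nlinarith

theorem exp_circleArg (h : c ^ 2 + s ^ 2 = 1) :
    Complex.exp (circleArg c s * Complex.I) = c + Complex.I * s := by
  have hm := circle_mul h
  rw [circleArg, show -Complex.I * Complex.log (c + Complex.I * s) * Complex.I =
    Complex.log (c + Complex.I * s) by linear_combination (-Complex.log (c + Complex.I * s)) *
      Complex.I_sq]
  exact Complex.exp_log (left_ne_zero_of_mul_eq_one hm)

theorem circleArg_neg (h : c ^ 2 + s ^ 2 = 1) (hc : 0 < c.re) :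
    circleArg c (-s) = -circleArg c s := by
  have hinv : c + Complex.I * -s = (c + Complex.I * s)⁻¹ :=
    eq_inv_of_mul_eq_one_right (circle_mul h)
  rw [circleArg, circleArg, hinv, Complex.log_inv _
    (Complex.slitPlane_arg_ne_pi (circle_mem_slitPlane h hc))]
  ring

theorem cos_circleArg (h : c ^ 2 + s ^ 2 = 1) (hc : 0 < c.re) :
    Complex.cos (circleArg c s) = c := by
  have h1 := exp_circleArg h
  have h2 := exp_circleArg (c := c) (s := -s) (by rwa [neg_sq])
  rw [circleArg_neg h hc] at h2
  rw [Complex.cos, h1, h2]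
  ring

theorem sin_circleArg (h : c ^ 2 + s ^ 2 = 1) (hc : 0 < c.re) :
    Complex.sin (circleArg c s) = s := by
  have h1 := exp_circleArg h
  have h2 := exp_circleArg (c := c) (s := -s) (by rwa [neg_sq])
  rw [circleArg_neg h hc] at h2
  rw [Complex.sin, h1, h2]
  linear_combination (-s) * Complex.I_sq

theorem circleArg_conj (h : c ^ 2 + s ^ 2 = 1) (hc : 0 < c.re) :
    circleArg (starRingEnd ℂ c) (starRingEnd ℂ s) = starRingEnd ℂ (circleArg c s) := by
  have h' : c ^ 2 + (-s) ^ 2 = 1 := by rwa [neg_sq]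
  have e : starRingEnd ℂ c + Complex.I * starRingEnd ℂ s =
      starRingEnd ℂ (c + Complex.I * -s) := by
    simp
  rw [← neg_neg (circleArg c s), ← circleArg_neg h hc, circleArg, circleArg, e,
    Complex.log_conj _ (Complex.slitPlane_arg_ne_pi (circle_mem_slitPlane h' hc))]
  simp

/-- A zero would give `s = 0`, hence `c = 1` and angle `0`, where `csinc` equals `1`. -/
theorem csinc_circleArg_ne_zero (h : c ^ 2 + s ^ 2 = 1) (hc : 0 < c.re) :
    csinc (circleArg c s) ≠ 0 := by
  intro h0
  have hs : s = 0 := by rw [← sin_circleArg h hc, ← csinc_mul, h0, zero_mul]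
  subst hs
  have hc1 : c = 1 := by
    have : c * c = 1 := by linear_combination h
    rcases mul_self_eq_one_iff.1 this with h1 | h1
    · exact h1
    · rw [h1] at hc; norm_num at hc
  rw [hc1, circleArg] at h0
  simp [csinc_zero] at h0

end CircleArg

/-- The plane slit along `(-∞, -1]`. -/
def slitDomain : Set ℂ := {u | 1 + u ∈ Complex.slitPlane}

/-- `cos (arccos u / 2)`. -/
def halfCos (u : ℂ) : ℂ := ((1 + u) / 2) ^ (1 / 2 : ℂ)

/-- A square root of `(1 - u) / 2`. -/
def halfSin (u : ℂ) : ℂ := ((1 - u) / 2) ^ (1 / 2 : ℂ)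

/-- `arccos u / sin (arccos u)`. -/
def arccosDivSin (u : ℂ) : ℂ := (csinc (circleArg (halfCos u) (halfSin u)) * halfCos u)⁻¹

theorem cpow_half_sq (x : ℂ) : (x ^ (1 / 2 : ℂ)) ^ 2 = x := by
  simp

theorem half_mem_slitPlane {u : ℂ} (hu : u ∈ slitDomain) : (1 + u) / 2 ∈ Complex.slitPlane := by
  have h : 1 + u ∈ Complex.slitPlane := hu
  rw [Complex.mem_slitPlane_iff] at h ⊢
  have e1 : ((1 + u) / 2).re = (1 + u).re / 2 := by simp
  have e2 : ((1 + u) / 2).im = (1 + u).im / 2 := by simp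
  rw [e1, e2]
  rcases h with h | h
  · left; positivity
  · right; exact div_ne_zero h two_ne_zero

/-- The principal root halves an argument lying strictly between `-π` and `π`. -/
theorem re_cpow_half_pos {x : ℂ} (hx : x ∈ Complex.slitPlane) : 0 < (x ^ (1 / 2 : ℂ)).re := by
  rw [Complex.cpow_def_of_ne_zero (Complex.slitPlane_ne_zero hx), Complex.exp_re]
  apply mul_pos (Real.exp_pos _)
  have e : (Complex.log x * (1 / 2)).im = Complex.arg x / 2 := by
    rw [show Complex.log x * (1 / 2) = Complex.log x * ((1 / 2 : ℝ) : ℂ) by norm_num,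
      Complex.im_mul_ofReal, Complex.log_im]
    ring
  rw [e]
  have h1 := Complex.neg_pi_lt_arg x
  have h2 := (Complex.arg_le_pi x).lt_of_ne (Complex.slitPlane_arg_ne_pi hx)
  exact Real.cos_pos_of_mem_Ioo ⟨by linarith, by linarith⟩

theorem halfCos_re_pos {u : ℂ} (hu : u ∈ slitDomain) : 0 < (halfCos u).re :=
  re_cpow_half_pos (half_mem_slitPlane hu)

theorem halfCos_sq_add (u s : ℂ) (hs : s ^ 2 = (1 - u) / 2) : halfCos u ^ 2 + s ^ 2 = 1 := by
  rw [halfCos, cpow_half_sq, hs]; ring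

theorem halfSin_sq (u : ℂ) : halfSin u ^ 2 = (1 - u) / 2 := cpow_half_sq _

/-- For `θ = 2α` the double angle formula gives `sin θ / θ = csinc α * cos α`. Another root `s` only
changes the sign of `α`, and `csinc` is even. -/
theorem arccosDivSin_eq {u s : ℂ} (hu : u ∈ slitDomain) (hs : s ^ 2 = (1 - u) / 2) :
    arccosDivSin u = (csinc (circleArg (halfCos u) s) * halfCos u)⁻¹ := by
  rw [arccosDivSin]
  rcases sq_eq_sq_iff_eq_or_eq_neg.1 ((halfSin_sq u).trans hs.symm) with h | h
  · rw [h]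
  · rw [h, circleArg_neg (halfCos_sq_add u s hs) (halfCos_re_pos hu), csinc_neg]

theorem isOpen_slitDomain : IsOpen slitDomain :=
  Complex.isOpen_slitPlane.preimage (continuous_const.add continuous_id)

theorem differentiableAt_halfCos {u : ℂ} (hu : u ∈ slitDomain) : DifferentiableAt ℂ halfCos u := by
  unfold halfCos
  exact DifferentiableAt.cpow_const (by fun_prop) (half_mem_slitPlane hu)

theorem halfCos_ne_zero {u : ℂ} (hu : u ∈ slitDomain) : halfCos u ≠ 0 := fun h => by
  have := halfCos_re_pos hu
  rw [h] at this
  simp at this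

/-- Away from `u = 1` a locally holomorphic root of `(1 - u) / 2` may be used. At `u = 1` the root
branches, but the function is continuous, so the singularity is removable. -/
theorem differentiableOn_arccosDivSin : DifferentiableOn ℂ arccosDivSin slitDomain := by
  have h1 : (1 : ℂ) ∈ slitDomain := by
    change (1 : ℂ) + 1 ∈ Complex.slitPlane
    rw [Complex.mem_slitPlane_iff]; left; norm_num
  rw [← Complex.differentiableOn_compl_singleton_and_continuousAt_iff
    (isOpen_slitDomain.mem_nhds h1)]
  constructor
  · rintro u ⟨hu, hu1⟩
    have hu1' : 1 - u ≠ 0 := sub_ne_zero.2 fun h => hu1 h.symm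
    -- This root is holomorphic near `u`, since `(1 - v) / (1 - u)` is near `1`.
    let s : ℂ → ℂ := fun v => halfSin u * ((1 - v) / (1 - u)) ^ (1 / 2 : ℂ)
    have hs : ∀ v, s v ^ 2 = (1 - v) / 2 := fun v => by
      rw [mul_pow, halfSin_sq, cpow_half_sq]
      field_simp
    have hsd : DifferentiableAt ℂ s u := by
      refine DifferentiableAt.const_mul (DifferentiableAt.cpow_const (by fun_prop) ?_) _
      rw [div_self hu1']; exact Complex.one_mem_slitPlane
    have hcd := differentiableAt_halfCos hu
    have hne := halfCos_ne_zero hu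
    have hsq := halfCos_sq_add u (s u) (hs u)
    have hpos := halfCos_re_pos hu
    have hcirc : DifferentiableAt ℂ (fun v => circleArg (halfCos v) (s v)) u := by
      unfold circleArg
      exact DifferentiableAt.const_mul (DifferentiableAt.clog (hcd.add (hsd.const_mul _))
        (circle_mem_slitPlane hsq hpos)) _
    have hd : DifferentiableAt ℂ
        (fun v => (csinc (circleArg (halfCos v) (s v)) * halfCos v)⁻¹) u := by
      refine DifferentiableAt.inv (DifferentiableAt.mul ?_ hcd)
        (mul_ne_zero (csinc_circleArg_ne_zero hsq hpos) hne)
      exact (differentiable_csinc _).comp u hcirc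
    refine (hd.congr_of_eventuallyEq ?_).differentiableWithinAt
    filter_upwards [isOpen_slitDomain.mem_nhds hu] with v hv
    exact arccosDivSin_eq hv (hs v)
  · have hsc : ContinuousAt halfSin 1 := by
      have hz : ContinuousAt (fun x : ℂ => x ^ (1 / 2 : ℂ)) 0 := by
        have := Complex.continuousAt_cpow_zero_of_re_pos (z := (1 / 2 : ℂ)) (by norm_num)
        exact this.comp (f := fun x : ℂ => (x, (1 / 2 : ℂ))) (by fun_prop)
      have hl : ContinuousAt (fun u : ℂ => (1 - u) / 2) 1 := by fun_prop
      have e : (1 - 1 : ℂ) / 2 = 0 := by norm_num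
      rw [← e] at hz
      exact ContinuousAt.comp (f := fun u : ℂ => (1 - u) / 2) hz hl
    have hcc := (differentiableAt_halfCos h1).continuousAt
    have hsq := halfCos_sq_add 1 _ (halfSin_sq 1)
    have hpos := halfCos_re_pos h1
    have hcirc : ContinuousAt (fun v => circleArg (halfCos v) (halfSin v)) 1 := by
      unfold circleArg
      exact continuousAt_const.mul (ContinuousAt.clog (hcc.add (continuousAt_const.mul hsc))
        (circle_mem_slitPlane hsq hpos))
    refine ContinuousAt.inv₀ (ContinuousAt.mul ?_ hcc)
      (mul_ne_zero (csinc_circleArg_ne_zero hsq hpos) (halfCos_ne_zero h1))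
    exact differentiable_csinc.continuous.continuousAt.comp hcirc

/-- `halfSin` need not commute with conjugation on its cut, but the conjugate value is still a root,
and either root may be used. -/
theorem arccosDivSin_conj {u : ℂ} (hu : u ∈ slitDomain) :
    arccosDivSin (starRingEnd ℂ u) = starRingEnd ℂ (arccosDivSin u) := by
  have h2 : starRingEnd ℂ (2 : ℂ) = 2 := Complex.conj_ofNat 2
  have hc : halfCos (starRingEnd ℂ u) = starRingEnd ℂ (halfCos u) := by
    rw [halfCos, halfCos, show (1 + starRingEnd ℂ u) / 2 = starRingEnd ℂ ((1 + u) / 2) by simp [h2],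
      Complex.conj_cpow _ _ (Complex.slitPlane_arg_ne_pi (half_mem_slitPlane hu))]
    simp [h2]
  have hu' : starRingEnd ℂ u ∈ slitDomain := by
    have h : 1 + u ∈ Complex.slitPlane := hu
    change 1 + starRingEnd ℂ u ∈ Complex.slitPlane
    rw [Complex.mem_slitPlane_iff] at h ⊢
    simpa using h
  have hs : starRingEnd ℂ (halfSin u) ^ 2 = (1 - starRingEnd ℂ u) / 2 := by
    rw [← map_pow, halfSin_sq]; simp [h2]
  rw [arccosDivSin_eq hu' hs, hc, circleArg_conj (halfCos_sq_add u _ (halfSin_sq u))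
    (halfCos_re_pos hu), csinc_conj, arccosDivSin, map_inv₀, map_mul]

/-- The defining property of `arccosDivSin`. -/
theorem exists_arccos {u : ℂ} (hu : u ∈ slitDomain) :
    ∃ θ s : ℂ, Complex.cos θ = u ∧ s * θ = Complex.sin θ ∧ (θ = 0 → s = 1) ∧
      arccosDivSin u * s = 1 := by
  have hsq := halfCos_sq_add u _ (halfSin_sq u)
  have hpos := halfCos_re_pos hu
  set α := circleArg (halfCos u) (halfSin u) with hα
  have hcos : Complex.cos α = halfCos u := cos_circleArg hsq hpos
  have hne : csinc α * halfCos u ≠ 0 :=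
    mul_ne_zero (csinc_circleArg_ne_zero hsq hpos) (halfCos_ne_zero hu)
  -- The half angle has a cosine with positive real part, which keeps the logarithm in `circleArg`
  -- off its cut.
  refine ⟨2 * α, csinc α * halfCos u, ?_, ?_, fun h => ?_, inv_mul_cancel₀ hne⟩
  · rw [Complex.cos_two_mul, hcos, halfCos, cpow_half_sq]; ring
  · rw [Complex.sin_two_mul, hcos, ← csinc_mul α]; ring
  · have h0 : α = 0 := by simpa using h
    rw [← hcos, h0, csinc_zero, Complex.cos_zero, mul_one]

/-! ### Existence of `*`-logarithms -/

section Existence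

variable {Ω : Set ℍ[ℝ]} {g : ℍ[ℝ] → ℍ[ℝ]}

theorem exists_starLog_of_stem (hs : AxiallySymmetric Ω) (hg : g ∈ SR Ω) {a : ℂ → ℂ}
    {V : ℂ → Fin 3 → ℂ} (ha : ScalarStem (trace Ω unitI) a) (hV : VecStem (trace Ω unitI) V)
    (h : ∀ z ∈ trace Ω unitI, ∃ θ s : ℂ, θ ^ 2 = V z ⬝ᵥ V z ∧
      s * θ = Complex.sin θ ∧ (θ = 0 → s = 1) ∧
      (stemOf g z).re = Complex.exp (a z) * Complex.cos θ ∧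
      vec (stemOf g z) = (Complex.exp (a z) * s) • V z) :
    ∃ f ∈ SR Ω, IsStarLog Ω f g ∧ ∀ z ∈ trace Ω unitI, vec (stemOf f z) = V z := by
  have hF := isHolomorphicStem_ofParts ha hV
  have hst : ∀ z ∈ trace Ω unitI, stemOf (induced fun z => ofParts (a z) (V z)) z =
      ofParts (a z) (V z) := fun z hz => stemOf_induced hs hF.symm hz
  refine ⟨_, induced_mem_SR hF, isStarLog_of_stem hs (induced_mem_SR hF) hg fun z hz => ?_,
    fun z hz => by rw [hst z hz, vec_ofParts]⟩
  rw [hst z hz, vec_ofParts, ofParts_re]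
  exact h z hz

theorem apply_toSlice_of_mem_SRReal (hs : AxiallySymmetric Ω) (hg : g ∈ SRReal Ω) {J : ℍ[ℝ]}
    (hJ : J ∈ unitSphere) {z : ℂ} (hz : z ∈ trace Ω unitI) :
    g (toSlice J z) = toSlice J (stemOf g z).re := by
  rw [apply_toSlice hs hg.1 hJ hz, ← phi_coe, ← ofParts_vec (stemOf g z),
    ((mem_SRReal_iff hs).1 hg).2 z hz]
  rfl

/-- A zero of the symmetrization at `z` would put a zero of `g` on the sphere over `z`. -/
theorem norm_stemOf_ne_zero (hs : AxiallySymmetric Ω) (hg : g ∈ SR Ω) (hg0 : ∀ q ∈ Ω, g q ≠ 0)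
    {z : ℂ} (hz : z ∈ trace Ω unitI) :
    (stemOf g z).re ^ 2 + vec (stemOf g z) ⬝ᵥ vec (stemOf g z) ≠ 0 := by
  intro h
  obtain ⟨J, hJ, h0⟩ := (exists_phi_eq_zero_iff _).2 h
  exact hg0 _ (hs.mem_of_mem_trace hz hJ) (by rw [apply_toSlice hs hg hJ hz, h0])

theorem toSlice_of_im_eq_zero (J : ℍ[ℝ]) {z : ℂ} (h : z.im = 0) :
    toSlice J z = (z.re : ℍ[ℝ]) := by
  rw [toSlice, h, zero_smul, add_zero]

/-- A slice-preserving function that is positive on the real axis has a positive stem function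
there. -/
theorem re_stemOf_pos (hs : AxiallySymmetric Ω) (hg : g ∈ SRReal Ω)
    (h : Set.MapsTo g (Ω ∩ realAxis) ((fun t : ℝ => (t : ℍ[ℝ])) '' Set.Ioi 0)) {z : ℂ}
    (hz : z ∈ trace Ω unitI) (hr : z.im = 0) : 0 < (stemOf g z).re.re := by
  obtain ⟨t, ht, e⟩ := h ⟨hz, z.re, (toSlice_of_im_eq_zero unitI hr).symm⟩
  have := congrArg (fun q => q.re) e
  rw [apply_toSlice_of_mem_SRReal hs hg unitI_mem hz] at this
  simp only [toSlice_re unitI_mem, Quaternion.re_coe] at this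
  rw [← this]
  exact ht

/-- A slice-preserving logarithm is real on the real axis, so its exponential is positive there.
Conversely, positivity is what a symmetric logarithm of the scalar part requires. -/
theorem exists_starLog_mem_SRReal_iff (hΩ : IsBasicDomain Ω) (hg : g ∈ SRReal Ω)
    (hg0 : ∀ q ∈ Ω, g q ≠ 0) : (∃ f ∈ SRReal Ω, IsStarLog Ω f g) ↔
      Set.MapsTo g (Ω ∩ realAxis) ((fun t : ℝ => (t : ℍ[ℝ])) '' Set.Ioi 0) := by
  have hs := hΩ.axiallySymmetric
  constructor
  · rintro ⟨f, hf, hfg⟩ _ ⟨hq, x, rfl⟩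
    have hz : (x : ℂ) ∈ trace Ω unitI := by
      change toSlice unitI x ∈ Ω
      rwa [toSlice_ofReal]
    have him : (stemOf f x).re.im = 0 :=
      (isHolomorphicStem_stemOf hs hf.1).re.im_eq_zero hz (Complex.ofReal_im x)
    refine ⟨Real.exp (stemOf f x).re.re, Real.exp_pos _, ?_⟩
    have := hfg.eq_toSlice_exp hs hf unitI_mem hz
    rw [toSlice_ofReal] at this
    rw [this, show (stemOf f x).re = (((stemOf f x).re.re : ℝ) : ℂ) from Complex.ext rfl him,
      ← Complex.ofReal_exp, toSlice_ofReal, Complex.ofReal_re]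
  · intro h
    have hv := ((mem_SRReal_iff hs).1 hg).2
    obtain ⟨A, hA, hAg⟩ := exists_symmetric_log hΩ (isHolomorphicStem_stemOf hs hg.1).re
      (fun z hz h0 => norm_stemOf_ne_zero hs hg.1 hg0 hz (by rw [h0, hv z hz]; simp))
      fun z hz => re_stemOf_pos hs hg h hz
    obtain ⟨f, hf, hfg, hfv⟩ := exists_starLog_of_stem hs hg.1 hA (VecStem.zero _) fun z hz =>
      ⟨0, 1, by simp, by simp, fun _ => rfl, by simp [hAg z hz], by simp [hv z hz]⟩
    exact ⟨f, (mem_SRReal_iff hs).2 ⟨hf, hfv⟩, hfg⟩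

namespace VectorialClass

variable {ω : VectorialClass Ω}

/-- A nowhere vanishing function has a `*`-logarithm if the class has no zeros. -/
theorem exists_starLog_of_zeroSet_eq_empty (hΩ : IsBasicDomain Ω) (hω : ¬ ω.IsZero)
    (hZ : ω.zeroSet = ∅) (hg : g ∈ ω.SR) (hg0 : ∀ q ∈ Ω, g q ≠ 0) :
    ∃ f ∈ ω.SR, IsStarLog Ω f g := by
  have hs := hΩ.axiallySymmetric
  have hΩ' := hΩ.toIsAxialDomain
  have hD := isOpen_trace hΩ.isOpen unitI
  obtain ⟨W, hW, hWu⟩ := exists_unit hΩ hω hZ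
  have hG := isHolomorphicStem_stemOf hs hg.1
  set G := stemOf g
  -- The coordinate of the vector of `g` along `W`, so that `g = g₀ + c W` with `W² = -1`.
  let c : ℂ → ℂ := fun z => vec (G z) ⬝ᵥ W z
  have hc : ScalarStem (trace Ω unitI) c := by
    simp only [c, dotProduct, Fin.sum_univ_three]
    exact (((hG.vec 0).mul (hW 0)).add ((hG.vec 1).mul (hW 1))).add ((hG.vec 2).mul (hW 2))
  have hGW : ∀ z ∈ trace Ω unitI, vec (G z) = c z • W z := fun z hz => by
    obtain ⟨h1, U, w, hw, hzU, hp⟩ := hWu z hz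
    obtain ⟨k, hk⟩ := ((par_of_mem hΩ' hg hw hzU).trans hp.symm
      (hw.vec_ne_zero hzU)).exists_smul (hWu z hz).ne_zero
    have : c z = k := by
      change vec (G z) ⬝ᵥ W z = k
      rw [hk, smul_dotProduct, h1, smul_eq_mul, mul_one]
    rw [this, hk]
  -- Replacing `W` by `± i` turns `g` into `g₀ ± i c`. The product of the two is the symmetrization,
  -- so neither vanishes.
  let N : ℂ → ℂ := fun z => (G z).re + Complex.I * c z
  have hN0 : ∀ z ∈ trace Ω unitI, N z ≠ 0 := fun z hz h0 => by
    apply norm_stemOf_ne_zero hs hg.1 hg0 hz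
    change (G z).re ^ 2 + vec (G z) ⬝ᵥ vec (G z) = 0
    rw [hGW z hz, smul_dotProduct, dotProduct_smul, (hWu z hz).1, smul_eq_mul, smul_eq_mul]
    have h0' : (G z).re + Complex.I * c z = 0 := h0
    linear_combination ((G z).re - Complex.I * c z) * h0' + c z ^ 2 * Complex.I_sq
  obtain ⟨A, hA, hAN'⟩ := exists_log (N := N) hD (hΩ.simplyConnected unitI unitI_mem)
    (hG.re.holo.add (hc.holo.const_mul Complex.I)) hN0
  have hAN : ∀ z ∈ trace Ω unitI, Complex.exp (A z) = (G z).re + Complex.I * c z := hAN'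
  -- Conjugation exchanges the factors `g₀ ± i c`, so reflecting any logarithm of one yields a
  -- logarithm of the other.
  let B : ℂ → ℂ := fun z => starRingEnd ℂ (A (starRingEnd ℂ z))
  have hB : DifferentiableOn ℂ B (trace Ω unitI) := fun z hz => by
    have := (hA.differentiableAt (hD.mem_nhds (hs.mem_trace_conj hz))).star_star
    rw [Complex.star_def, Complex.conj_conj] at this
    exact this.differentiableWithinAt
  have hBN : ∀ z ∈ trace Ω unitI, Complex.exp (B z) = (G z).re - Complex.I * c z := by
    intro z hz
    have := congrArg (starRingEnd ℂ) (hAN _ (hs.mem_trace_conj hz))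
    rw [← Complex.exp_conj] at this
    rw [this, map_add, map_mul, ← hc.symm _ (hs.mem_trace_conj hz),
      ← hG.re.symm _ (hs.mem_trace_conj hz), Complex.conj_conj, Complex.conj_I]
    ring
  have hBsymm : ∀ z, B (starRingEnd ℂ z) = starRingEnd ℂ (A z) := fun z => by
    change starRingEnd ℂ (A (starRingEnd ℂ (starRingEnd ℂ z))) = _
    rw [Complex.conj_conj]
  have hAsymm : ∀ z, A (starRingEnd ℂ z) = starRingEnd ℂ (B z) := fun z =>
    (Complex.conj_conj _).symm
  have h2 : starRingEnd ℂ (2 : ℂ) = 2 := Complex.conj_ofNat 2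
  -- Solves `a + iθ = A` and `a - iθ = B`; since reflection swaps `A` and `B`, both `a` and `θ` are
  -- stem functions.
  let θ : ℂ → ℂ := fun z => (A z - B z) / (2 * Complex.I)
  have ha : ScalarStem (trace Ω unitI) fun z => (A z + B z) / 2 :=
    ⟨fun z _ => by rw [hBsymm, hAsymm, map_div₀, map_add, h2, add_comm],
      (hA.add hB).div_const _⟩
  have hθ : ScalarStem (trace Ω unitI) θ :=
    ⟨fun z _ => by
      change (A (starRingEnd ℂ z) - B (starRingEnd ℂ z)) / (2 * Complex.I) =
        starRingEnd ℂ ((A z - B z) / (2 * Complex.I))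
      rw [hBsymm, hAsymm, map_div₀, map_sub, map_mul, h2, Complex.conj_I, mul_neg, div_neg,
        ← neg_div, neg_sub],
      (hA.sub hB).div_const _⟩
  have e1 : ∀ z, (A z + B z) / 2 + θ z * Complex.I = A z := fun z => by
    simp only [θ]
    field_simp
    ring
  have e2 : ∀ z, (A z + B z) / 2 + -θ z * Complex.I = B z := fun z => by
    simp only [θ]
    field_simp
    ring
  obtain ⟨f, hf, hfg, hfv⟩ := exists_starLog_of_stem hs hg.1 ha (VecStem.smul hθ hW)
    fun z hz => by
      have x1 := hAN z hz
      have x2 := hBN z hz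
      rw [← e1 z, Complex.exp_add, Complex.exp_mul_I] at x1
      rw [← e2 z, Complex.exp_add, Complex.exp_mul_I, Complex.cos_neg, Complex.sin_neg] at x2
      refine ⟨θ z, csinc (θ z), ?_, csinc_mul _, fun h => by rw [h, csinc_zero], ?_, ?_⟩
      · rw [smul_dotProduct, dotProduct_smul, (hWu z hz).1, smul_eq_mul, smul_eq_mul]
        ring
      · linear_combination (-1 / 2) * x1 - (1 / 2) * x2
      · rw [smul_smul, mul_assoc, csinc_mul]
        refine (hGW z hz).trans (congrArg (· • W z) (mul_left_cancel₀ Complex.I_ne_zero ?_))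
        linear_combination (-1 / 2) * x1 + (1 / 2) * x2
  refine ⟨f, mem_SR_of_par hΩ' hf fun p hp => ?_, hfg⟩
  obtain ⟨U, w, -, hpU, hw⟩ := ω.exists_isMinimalRep hΩ' hω hp
  refine ⟨U, w, hpU, hw, fun z hz => ?_⟩
  have hz' := Set.preimage_mono hw.subset hz
  rw [hfv z hz']
  exact ((hWu z hz').par hw hz).smul_left _

/-- Over every point of the hull of the zero set some minimal representative has a zero. -/
theorem exists_isotropic_minimalRep {z : ℂ}
    (hz : toSlice unitI z ∈ axialHull ω.zeroSet) :
    ∃ U w, ω.IsMinimalRep U w ∧ z ∈ trace U unitI ∧ z.im ≠ 0 ∧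
      vec (stemOf w z) ⬝ᵥ vec (stemOf w z) = 0 := by
  obtain ⟨y, I, hI, J, hJ, ⟨-, U, w, hw, hyU, hy0⟩, e⟩ := hz
  -- The points `y` and `z` name the same sphere, so they agree up to conjugation, which the sign of
  -- the unit absorbs.
  obtain ⟨I', hI', e'⟩ : ∃ I' ∈ unitSphere, toSlice I y = toSlice I' z := by
    have e1 := congrArg planePoint e
    rw [planePoint_toSlice unitI_mem, planePoint_toSlice hJ] at e1
    obtain ⟨hre, him⟩ : z.re = y.re ∧ |z.im| = |y.im| := Complex.ext_iff.1 e1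
    rcases abs_eq_abs.1 him with h | h
    · exact ⟨I, hI, by rw [Complex.ext hre h]⟩
    · refine ⟨-I, neg_mem_unitSphere hI, ?_⟩
      rw [toSlice_neg_unit, show starRingEnd ℂ z = y from
        Complex.ext (by simpa using hre) (by simp [h])]
  rw [e'] at hyU hy0
  have hzU := hw.axiallySymmetric.mem_trace_of_mem hI' hyU
  refine ⟨U, w, hw, hzU, fun h => ?_, (hw.exists_zero_iff hzU).1 ⟨I', hI', hy0⟩⟩
  exact hw.minimal.1 _ ⟨hyU, z.re, (toSlice_of_im_eq_zero I' h).symm⟩ hy0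

/-- A nowhere vanishing function has a `*`-logarithm if every sphere contains a zero of the
class. -/
theorem exists_starLog_of_axialHull_eq (hΩ : IsBasicDomain Ω) (hω : ¬ ω.IsZero)
    (hZ : axialHull ω.zeroSet = Ω) (hg : g ∈ ω.SR) (hg0 : ∀ q ∈ Ω, g q ≠ 0) :
    ∃ f ∈ ω.SR, IsStarLog Ω f g := by
  have hs := hΩ.axiallySymmetric
  have hΩ' := hΩ.toIsAxialDomain
  have hG := isHolomorphicStem_stemOf hs hg.1
  have hrep := fun z (hz : z ∈ trace Ω unitI) =>
    exists_isotropic_minimalRep (ω := ω) (z := z) (by rw [hZ]; exact hz)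
  have hiso : ∀ z ∈ trace Ω unitI, vec (stemOf g z) ⬝ᵥ vec (stemOf g z) = 0 := fun z hz => by
    obtain ⟨U, w, hw, hzU, -, h0⟩ := hrep z hz
    obtain ⟨k, hk⟩ := (par_of_mem hΩ' hg hw hzU).exists_smul (hw.vec_ne_zero hzU)
    rw [hk, smul_dotProduct, dotProduct_smul, h0, smul_zero, smul_zero]
  have hre : ∀ z ∈ trace Ω unitI, (stemOf g z).re ≠ 0 := fun z hz h0 =>
    norm_stemOf_ne_zero hs hg.1 hg0 hz (by rw [h0, hiso z hz]; simp)
  -- The positivity condition is vacuous: there are zeros of the class over every point of the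
  -- trace, and none of them is real.
  obtain ⟨A, hA, hAg⟩ := exists_symmetric_log hΩ hG.re hre fun z hz h => by
    obtain ⟨-, -, -, -, h', -⟩ := hrep z hz
    exact absurd h h'
  -- Here `θ = 0` and `exp (a + V) = e^a (1 + V)`, so `a = log g₀` and `V = G / g₀`.
  obtain ⟨f, hf, hfg, hfv⟩ := exists_starLog_of_stem hs hg.1 hA (hG.vec.smul (hG.re.inv hre))
    fun z hz => ⟨0, 1, by simp [hiso z hz], by simp, fun _ => rfl, by simp [hAg z hz], by
      rw [hAg z hz, mul_one, smul_smul, mul_inv_cancel₀ (hre z hz), one_smul]⟩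
  exact ⟨f, mem_SR_of_smul hΩ' hω hf hg fun z hz => ⟨_, hfv z hz⟩, hfg⟩

/-- A nowhere vanishing function has a `*`-logarithm if `g₀ / √(g^s)` omits `(-∞, -1]` for a branch
of the square root that is positive on the real axis. -/
theorem exists_starLog_of_sqrt (hΩ : IsBasicDomain Ω) (hω : ¬ ω.IsZero) (hg : g ∈ ω.SR)
    (hg0 : ∀ q ∈ Ω, g q ≠ 0) {r : ℍ[ℝ] → ℍ[ℝ]} (hr : r ∈ SRReal Ω)
    (hrg : ∀ q ∈ Ω, r q ^ 2 = symmetrization g q)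
    (hpos : Set.MapsTo r (Ω ∩ realAxis) ((fun t : ℝ => (t : ℍ[ℝ])) '' Set.Ioi 0))
    (hslit : Set.MapsTo (fun q => comp₀ g q * (r q)⁻¹) Ω
      ((fun t : ℝ => (t : ℍ[ℝ])) '' Set.Iic (-1))ᶜ) :
    ∃ f ∈ ω.SR, IsStarLog Ω f g := by
  have hs := hΩ.axiallySymmetric
  have hG := isHolomorphicStem_stemOf hs hg.1
  have hR := (isHolomorphicStem_stemOf hs hr.1).re
  set R : ℂ → ℂ := fun z => (stemOf r z).re
  have hR2 : ∀ z ∈ trace Ω unitI,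
      R z ^ 2 = (stemOf g z).re ^ 2 + vec (stemOf g z) ⬝ᵥ vec (stemOf g z) := fun z hz => by
    have := hrg _ hz
    rw [apply_toSlice_of_mem_SRReal hs hr unitI_mem hz, symmetrization_toSlice hs hg.1 unitI_mem hz,
      ← toSlice_pow unitI_mem] at this
    exact (toSlice_inj unitI_mem).1 this
  have hR0 : ∀ z ∈ trace Ω unitI, R z ≠ 0 := fun z hz h0 =>
    norm_stemOf_ne_zero hs hg.1 hg0 hz (by rw [← hR2 z hz, h0]; simp)
  obtain ⟨A, hA, hAR⟩ := exists_symmetric_log hΩ hR hR0 fun z hz => re_stemOf_pos hs hr hpos hz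
  -- With `e^a = R` the scalar equation becomes `cos θ = u`.
  let u : ℂ → ℂ := fun z => (stemOf g z).re / R z
  have hu : ScalarStem (trace Ω unitI) u := hG.re.div hR hR0
  have huslit : ∀ z ∈ trace Ω unitI, u z ∈ slitDomain := fun z hz => by
    change 1 + u z ∈ Complex.slitPlane
    rw [Complex.mem_slitPlane_iff]
    by_contra hne
    push Not at hne
    simp only [Complex.add_re, Complex.one_re, Complex.add_im, Complex.one_im, zero_add] at hne
    refine hslit hz ⟨(u z).re, show (u z).re ≤ -1 by linarith [hne.1], ?_⟩
    simp only
    rw [comp₀_toSlice hs hg.1 unitI_mem hz, apply_toSlice_of_mem_SRReal hs hr unitI_mem hz,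
      ← toSlice_inv unitI_mem, ← toSlice_mul unitI_mem, ← div_eq_mul_inv]
    exact (toSlice_of_im_eq_zero unitI hne.2).symm
  have hh : ScalarStem (trace Ω unitI) fun z => arccosDivSin (u z) :=
    ⟨fun z hz => by rw [hu.symm z hz, arccosDivSin_conj (huslit z hz)],
      differentiableOn_arccosDivSin.comp hu.holo huslit⟩
  -- The vector equation `R (sin θ / θ) V = G` dictates `V = (θ / sin θ) G / R`.
  obtain ⟨f, hf, hfg, hfv⟩ := exists_starLog_of_stem hs hg.1 hA (hG.vec.smul (hh.div hR hR0))
    fun z hz => by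
      obtain ⟨θ, s, hcos, hsin, hs0, hinv⟩ := exists_arccos (huslit z hz)
      have hRz := hR0 z hz
      have huz : u z * R z = (stemOf g z).re := div_mul_cancel₀ _ hRz
      refine ⟨θ, s, ?_, hsin, hs0, ?_, ?_⟩
      -- `G ⬝ᵥ G = R² - g₀² = R² sin² θ`, and the factor `θ / sin θ` turns this into `V ⬝ᵥ V = θ²`.
      · have h1 := Complex.sin_sq_add_cos_sq θ
        rw [smul_dotProduct, dotProduct_smul, smul_eq_mul, smul_eq_mul,
          show vec (stemOf g z) ⬝ᵥ vec (stemOf g z) = R z ^ 2 * Complex.sin θ ^ 2 by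
            rw [hcos] at h1
            linear_combination -hR2 z hz + (-R z ^ 2) * h1 + (u z * R z + (stemOf g z).re) * huz,
          ← hsin]
        field_simp
        linear_combination (-θ ^ 2 * (arccosDivSin (u z) * s + 1)) * hinv
      · rw [hAR z hz, hcos, mul_comm, huz]
      · rw [hAR z hz, smul_smul, show R z * s * (arccosDivSin (u z) / R z) = 1 by
          field_simp
          linear_combination hinv, one_smul]
  exact ⟨f, mem_SR_of_smul hΩ.toIsAxialDomain hω hf hg fun z hz => ⟨_, hfv z hz⟩, hfg⟩

end VectorialClass

end Existence

end StarLog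

end

/-! ### The three cases combined -/

theorem theorem1p1 (Ω : Set ℍ[ℝ]) (hΩ : IsBasicDomain Ω) (ω : VectorialClass Ω)
    (g : ℍ[ℝ] → ℍ[ℝ]) (hg : g ∈ ω.SR) (hg0 : ∀ q ∈ Ω, g q ≠ 0) :
    -- (a)
    (ω.IsZero →
      ((∃ f ∈ ω.SR, IsStarLog Ω f g) ↔
        Set.MapsTo g (Ω ∩ realAxis) ((fun t : ℝ => (t : ℍ[ℝ])) '' Set.Ioi 0)) ∧
      ((∃ f ∈ SRReal Ω, IsStarLog Ω f g) ↔
        Set.MapsTo g (Ω ∩ realAxis) ((fun t : ℝ => (t : ℍ[ℝ])) '' Set.Ioi 0))) ∧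
    -- (b)
    (¬ ω.IsZero → (ω.zeroSet = ∅ ∨ axialHull ω.zeroSet = Ω) →
      ∃ f ∈ ω.SR, IsStarLog Ω f g) ∧
    -- (c), for every branch `r` of the square root of the symmetrization of `g`
    (¬ ω.IsZero → IsDiscrete ω.zeroSet →
      ∀ r ∈ SRReal Ω, (∀ q ∈ Ω, r q ^ 2 = symmetrization g q) →
        Set.MapsTo r (Ω ∩ realAxis) ((fun t : ℝ => (t : ℍ[ℝ])) '' Set.Ioi 0) →
        Set.MapsTo (fun q => comp₀ g q * (r q)⁻¹) Ω
          ((fun t : ℝ => (t : ℍ[ℝ])) '' Set.Iic (-1))ᶜ →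
        ∃ f ∈ ω.SR, IsStarLog Ω f g) := by
  refine ⟨fun hω => ?_, fun hω hZ => ?_, fun hω _ r hr hrg hpos hslit =>
    VectorialClass.exists_starLog_of_sqrt hΩ hω hg hg0 hr hrg hpos hslit⟩
  · have hmem : ∀ f : ℍ[ℝ] → ℍ[ℝ], f ∈ ω.SR ↔ f ∈ SRReal Ω := fun f =>
      VectorialClass.isZero_mem_iff hΩ.toIsAxialDomain hω
    have h := exists_starLog_mem_SRReal_iff hΩ ((hmem g).1 hg) hg0
    simp only [hmem]
    exact ⟨h, h⟩
  · rcases hZ with hZ | hZ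
    · exact VectorialClass.exists_starLog_of_zeroSet_eq_empty hΩ hω hZ hg hg0
    · exact VectorialClass.exists_starLog_of_axialHull_eq hΩ hω hZ hg hg0
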